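/- **Data.** Let $1\le n$, $s\ge 1$ be integers, $1=d_1<d_2<\dots<d_n<d_{n+1}=s+1$ integers, and $a_1<b_1<a_2<b_2<\dots<a_s<b_s$ real numbers with $$\sum_{l=s+2-d_{i+1}}^{s+1-d_i}(b_l-a_l)=\frac1n\qquad(1\le i\le n).$$ Let $I\subseteq\{1,\dots,n\}$ (this is $I_2\cap[n]$), $x_1>0$, $y_r>0$ for $r\in I$, and $c_r=\frac1{y_rx_1}$. Let $\gamma_1,\dots,\gamma_m$ be the distinct values of the $c_r$, $r\in I$, and $n_1,\dots,n_m$ their multiplicities; $\ell=|I|$. For $1\le i\le n$ put $D_i=d_{i+1}-d_i-1$ and, for $0\le k\le D_i$, $$\beta_{i,k}=n\Big(a_1+\sum_{l=2}^{s-d_i-k+1}(a_l-b_{l-1})\Big)+n-i+1-n\sum_{l=s-d_i-k+1}^{s-d_i+1}(b_l-a_l),$$ $$\gamma_{i,k}=n\Big(a_1+\sum_{l=2}^{s-d_i-k+1}(a_l-b_{l-1})\Big)+n-i+1-n\sum_{l=s-d_i-k+2}^{s-d_i+1}(b_l-a_l)$$ (the $[\beta_{i,k},\gamma_{i,k}]$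 are the $D_i+1$ segments of the limit measure $\mathbf m_i$). Let $$\Psi_i(t)=\prod_{k=0}^{D_i}\frac{t-\beta_{i,k}}{t-\gamma_{i,k}},\qquad J_1(t)=\frac1{\Psi_1(t)-1}+(n-\ell)+\sum_{j=1}^m\frac{n_j\gamma_j}{\Psi_1(t)+\gamma_j},\qquad J_i(t)=(n-i+1)+\frac1{\Psi_i(t)-1}\quad(2\le i\le n),$$ and let $C_i$ be the rational plane algebraic curve with parametrization $$\chi_i(t)=\frac1n\Big[t-\frac{J_i(t)}{J_i'(t)}\Big],\qquad \kappa_i(t)=\frac1{J_i'(t)},$$ that is, the Zariski closure in the projective plane of the set of the points $(\chi_i(t),\kappa_i(t))$, $t$ real, where these expressions are defined. **Definitions.** An irreducible real algebraic plane curve of degree $d$ is *winding* if it meets every real line in at least $d-2$ real points counted with multiplicity, and there is a real point $p_0$ (a center) such that every real line through $p_0$ meets it in $d$ real points counted with multiplicity. The dual of a curve is the Zariski closure of the set of its tangent lines at smooth points; a *cloud curve* is the dual of a winding curve, and the *class* of a curve is the degree of its dual. A line $L$ is tangent to a curve at $p$ if $(p,L)$ lies in the conormal variety, the Zariski closure of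 the set of pairs (smooth point, tangent line there). In the degenerate case of class $1$ the curve is a single point, whose tangent lines are the lines through it and whose dual is the line formed by them. **Proposition.** $C_1$ is a cloud curve of class $(m+1)(D_1+1)$, and for $2\le i\le n$, $C_i$ is a cloud curve of class $D_i+1$. Moreover: 1. for every $1\le i\le n$, $C_i$ is tangent to the line $\kappa=1$ at exactly one point, which is a real point of the affine $(\chi,\kappa)$-plane; 2. $C_1$ is tangent to the line $\kappa=0$ at exactly $(m+1)(D_1+1)-1$ points, and for $2\le i\le n$, $C_i$ is tangent to $\kappa=0$ at exactly $D_i$ points; all of these are real points of the affine plane. -/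

import Mathlib

open scoped LinearAlgebra.Projectivization

noncomputable section

/-! Plane projective geometry. A point of the complex projective plane is written in homogeneous
coordinates `[x : y : z]`. Lines are also encoded by points of a projective plane: `[a : b : c]`
stands for the line `a x + b y + c z = 0`. -/

/-- The complex projective plane, also used as its own dual. -/
abbrev PPlane : Type := ℙ ℂ (Fin 3 → ℂ)

/-- Forms in three variables over `ℂ`. -/
abbrev Form3 : Type := MvPolynomial (Fin 3) ℂ

/-- `G` vanishes at every point of `S`; only used for homogeneous `G`. -/
def VanishesOn (G : Form3) (S : Set PPlane) : Prop :=
  ∀ q ∈ S, MvPolynomial.eval q.rep G = 0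

/-- The set of zeros of a form in the projective plane. -/
def zeroLocus (G : Form3) : Set PPlane :=
  {p | MvPolynomial.eval p.rep G = 0}

/-- Zariski closure in the projective plane. -/
def zariskiClosure (S : Set PPlane) : Set PPlane :=
  {p | ∀ (k : ℕ) (G : Form3), G.IsHomogeneous k → VanishesOn G S →
    MvPolynomial.eval p.rep G = 0}

/-- The Zariski tangent space at `p` of the affine cone over `X`: the vectors that are annihilated
by the differentials at `p` of all forms vanishing on `X`. -/
def coneTangentSpace (X : Set PPlane) (p : PPlane) : Submodule ℂ (Fin 3 → ℂ) where
  carrier := {v | ∀ (k : ℕ) (G : Form3), G.IsHomogeneous k → VanishesOn G X →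
    ∑ j, MvPolynomial.eval p.rep (MvPolynomial.pderiv j G) * v j = 0}
  zero_mem' := by
    intro k G _ _
    simp
  add_mem' := by
    intro v w hv hw k G hG hX
    simp only [Pi.add_apply, mul_add, Finset.sum_add_distrib]
    rw [hv k G hG hX, hw k G hG hX, add_zero]
  smul_mem' := by
    intro c v hv k G hG hX
    have h := hv k G hG hX
    simp only [Pi.smul_apply, smul_eq_mul]
    calc ∑ j, MvPolynomial.eval p.rep (MvPolynomial.pderiv j G) * (c * v j)
        = c * ∑ j, MvPolynomial.eval p.rep (MvPolynomial.pderiv j G) * v j := by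
          rw [Finset.mul_sum]
          exact Finset.sum_congr rfl (fun j _ => by ring)
      _ = 0 := by rw [h, mul_zero]

/-- Smooth points of an (equidimensional) projective variety `X`: the points of `X` whose tangent
space has the least possible dimension. -/
def IsSmoothPoint (X : Set PPlane) (p : PPlane) : Prop :=
  p ∈ X ∧ ∀ q ∈ X, Module.finrank ℂ (coneTangentSpace X p) ≤
    Module.finrank ℂ (coneTangentSpace X q)

/-- The line `L` contains the projective tangent space of `X` at the smooth point `p`. If `X` is a
curve this means that `L` is the tangent line of `X` at `p`; if `X` is a single point, that `L`
passes through it. -/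
def IsSmoothTangent (X : Set PPlane) (p L : PPlane) : Prop :=
  IsSmoothPoint X p ∧ ∀ v ∈ coneTangentSpace X p, ∑ j, L.rep j * v j = 0

/-- The dual variety: the Zariski closure of the set of tangent lines at smooth points. -/
def dualCurve (X : Set PPlane) : Set PPlane :=
  zariskiClosure {L | ∃ p, IsSmoothTangent X p L}

/-- `L` is a tangent line of `X` at the (possibly singular) point `p`: the pair `(p, L)` lies in
the conormal variety of `X`, that is, in the Zariski closure in `ℙ² × ℙ²` of the set of pairs
consisting of a smooth point and a tangent line at it. This closed set is cut out by the
bihomogeneous forms (the left variables are the coordinates of the point, the right ones those of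
the line) that vanish on all such pairs. -/
def IsTangentAt (X : Set PPlane) (L p : PPlane) : Prop :=
  ∀ (k l : ℕ) (G : MvPolynomial (Fin 3 ⊕ Fin 3) ℂ),
    MvPolynomial.IsWeightedHomogeneous (Sum.elim (fun _ => 1) (fun _ => 0) : _ → ℕ) G k →
    MvPolynomial.IsWeightedHomogeneous (Sum.elim (fun _ => 0) (fun _ => 1) : _ → ℕ) G l →
    (∀ q M : PPlane, IsSmoothTangent X q M → MvPolynomial.eval (Sum.elim q.rep M.rep) G = 0) →
    MvPolynomial.eval (Sum.elim p.rep L.rep) G = 0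

/-- `F` is a real form of degree `d`, irreducible over `ℂ`, with zero set `W`. -/
def IsEquationOf (F : MvPolynomial (Fin 3) ℝ) (d : ℕ) (W : Set PPlane) : Prop :=
  F.IsHomogeneous d ∧ Irreducible (MvPolynomial.map (algebraMap ℝ ℂ) F) ∧
    W = zeroLocus (MvPolynomial.map (algebraMap ℝ ℂ) F)

/-- `W` is an (irreducible) real algebraic curve of degree `d`. -/
def IsRealCurveOfDegree (W : Set PPlane) (d : ℕ) : Prop :=
  ∃ F : MvPolynomial (Fin 3) ℝ, IsEquationOf F d W

/-- The polynomial `F (u + s v)` in the variable `s`. If `u` and `v` span a line in the real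
projective plane, it describes the restriction of `F` to that line; the point `v` is `s = ∞`. -/
def restrictToLine (F : MvPolynomial (Fin 3) ℝ) (u v : Fin 3 → ℝ) : Polynomial ℝ :=
  MvPolynomial.aeval (fun j => Polynomial.C (u j) + Polynomial.C (v j) * Polynomial.X) F

/-- The number of real points, counted with multiplicity, in which the curve `F = 0` of degree `d`
meets the real line spanned by `u` and `v`, provided that this line is not contained in the curve.
The roots account for the points other than `v`, and the drop of the degree is the multiplicity
of the intersection at `v`. -/
def realIntersectionNumber (F : MvPolynomial (Fin 3) ℝ) (d : ℕ) (u v : Fin 3 → ℝ) : ℕ :=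
  (restrictToLine F u v).roots.card + (d - (restrictToLine F u v).natDegree)

/-- The degree `d` real curve `F = 0` is winding: it meets every real line in at least `d - 2` real
points counted with multiplicity, and for some real point `p₀`, the center, every real line through
`p₀` meets it in `d` real points counted with multiplicity. -/
def IsWindingForm (F : MvPolynomial (Fin 3) ℝ) (d : ℕ) : Prop :=
  (∀ u v : Fin 3 → ℝ, LinearIndependent ℝ ![u, v] →
    restrictToLine F u v = 0 ∨ d ≤ realIntersectionNumber F d u v + 2) ∧
  ∃ p₀ : Fin 3 → ℝ, p₀ ≠ 0 ∧ ∀ v : Fin 3 → ℝ, LinearIndependent ℝ ![p₀, v] →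
    restrictToLine F p₀ v ≠ 0 ∧ realIntersectionNumber F d p₀ v = d

/-- `W` is a winding curve of degree `d`. -/
def IsWindingCurve (W : Set PPlane) (d : ℕ) : Prop :=
  ∃ F : MvPolynomial (Fin 3) ℝ, IsEquationOf F d W ∧ IsWindingForm F d

/-- A cloud curve is the dual curve of a winding curve. -/
def IsCloudCurve (X : Set PPlane) : Prop :=
  ∃ (W : Set PPlane) (d : ℕ), IsWindingCurve W d ∧ X = dualCurve W

/-- The class of a curve is the degree of its dual curve. -/
def HasClass (X : Set PPlane) (d : ℕ) : Prop :=
  IsRealCurveOfDegree (dualCurve X) d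

/-- The point `[x : y : 1]`. -/
def affinePoint (x y : ℝ) : PPlane :=
  Projectivization.mk ℂ ![(x : ℂ), (y : ℂ), 1]
    (fun h => one_ne_zero (α := ℂ) (by simpa using congrFun h 2))

/-- The line `κ = h` in the plane with affine coordinates `(χ, κ)`, i.e. `[0 : 1 : -h]`. -/
def kappaLine (h : ℝ) : PPlane :=
  Projectivization.mk ℂ ![0, 1, -(h : ℂ)]
    (fun e => one_ne_zero (α := ℂ) (by simpa using congrFun e 1))

/-- The limiting parameters of a contracting square-hexagon lattice with piecewise boundary
conditions and periodic weights. All indices are one-based as usual: `d` is used on `1, …, n + 1`,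
and `a`, `b` on `1, …, s`. -/
structure SquareHexagonData where
  /-- the size of a period -/
  n : ℕ
  n_pos : 1 ≤ n
  /-- the number of segments of remaining vertices on the boundary row -/
  s : ℕ
  /-- the `l`-th segment of remaining vertices, after rescaling, is `[a l, b l]` -/
  a : ℕ → ℝ
  b : ℕ → ℝ
  a_lt_b : ∀ l, 1 ≤ l → l ≤ s → a l < b l
  b_lt_a : ∀ l, 1 ≤ l → l < s → b l < a (l + 1)
  /-- the parts `μ_t` of the boundary partition that are matched with the weight `x_i` are those
  with `d i ≤ t < d (i + 1)`; the part `μ_t` belongs to the segment with index `s + 1 - t` -/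
  d : ℕ → ℕ
  d_one : d 1 = 1
  d_last : d (n + 1) = s + 1
  d_lt : ∀ i, 1 ≤ i → i ≤ n → d i < d (i + 1)
  /-- each of the `n` weights in a period is matched with the proportion `1 / n` of all parts -/
  sum_block : ∀ i, 1 ≤ i → i ≤ n →
    ∑ l ∈ Finset.Icc (s + 2 - d (i + 1)) (s + 1 - d i), (b l - a l) = 1 / (n : ℝ)
  /-- the indices `r` in one period for which the row is of square type, i.e. `I₂ ∩ [n]` -/
  I₂ : Finset ℕ
  I₂_subset : I₂ ⊆ Finset.Icc 1 n
  /-- the edge weights -/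
  x₁ : ℝ
  x₁_pos : 0 < x₁
  y : ℕ → ℝ
  y_pos : ∀ r ∈ I₂, 0 < y r

namespace SquareHexagonData

variable (S : SquareHexagonData)

/-- `D_i`; the limit measure `𝐦_i` has `D_i + 1` segments. -/
def D (i : ℕ) : ℕ := S.d (i + 1) - S.d i - 1

/-- The left end point `β_{i,k}` of the `k`-th segment of the limit measure `𝐦_i`,
`0 ≤ k ≤ D_i`. -/
def beta (i k : ℕ) : ℝ :=
  S.n * (S.a 1 + ∑ l ∈ Finset.Icc 2 (S.s + 1 - S.d i - k), (S.a l - S.b (l - 1)))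
    + S.n - i + 1
    - S.n * ∑ l ∈ Finset.Icc (S.s + 1 - S.d i - k) (S.s + 1 - S.d i), (S.b l - S.a l)

/-- The right end point `γ_{i,k}` of the `k`-th segment of the limit measure `𝐦_i`,
`0 ≤ k ≤ D_i`. -/
def gamma (i k : ℕ) : ℝ :=
  S.n * (S.a 1 + ∑ l ∈ Finset.Icc 2 (S.s + 1 - S.d i - k), (S.a l - S.b (l - 1)))
    + S.n - i + 1
    - S.n * ∑ l ∈ Finset.Icc (S.s + 2 - S.d i - k) (S.s + 1 - S.d i), (S.b l - S.a l)

/-- `c_r = 1 / (y_r x₁)`. -/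
def c (r : ℕ) : ℝ := 1 / (S.y r * S.x₁)

/-- The set `{γ_1, …, γ_m}` of distinct values of `c_r`, `r ∈ I₂ ∩ [n]`. -/
def cValues : Finset ℝ := S.I₂.image S.c

/-- The number `m` of distinct values of `c_r`. -/
def m : ℕ := S.cValues.card

/-- The multiplicity of the value `g` among the `c_r`. -/
def mult (g : ℝ) : ℕ := (S.I₂.filter (fun r => S.c r = g)).card

/-- `Ψ_i(t)`. -/
def Psi (i : ℕ) (t : ℝ) : ℝ :=
  (∏ k ∈ Finset.range (S.D i + 1), (t - S.beta i k)) /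
    ∏ k ∈ Finset.range (S.D i + 1), (t - S.gamma i k)

/-- `J_i(t)`. -/
def J (i : ℕ) (t : ℝ) : ℝ :=
  if i = 1 then
    1 / (S.Psi 1 t - 1) + ((S.n : ℝ) - S.I₂.card)
      + ∑ g ∈ S.cValues, (S.mult g * g) / (S.Psi 1 t + g)
  else ((S.n : ℝ) - i + 1) + 1 / (S.Psi i t - 1)

/-- The parameters `t` at which no denominator in the formulas for `Ψ_i`, `J_i`, `χ_i` and `κ_i`
vanishes. -/
def IsRegularParameter (i : ℕ) (t : ℝ) : Prop :=
  (∀ k ≤ S.D i, t ≠ S.gamma i k) ∧ S.Psi i t ≠ 1 ∧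
    (i = 1 → ∀ g ∈ S.cValues, S.Psi i t ≠ -g) ∧ deriv (S.J i) t ≠ 0

/-- `χ_i(t)`. -/
def chi (i : ℕ) (t : ℝ) : ℝ := 1 / (S.n : ℝ) * (t - S.J i t / deriv (S.J i) t)

/-- `κ_i(t)`. -/
def kappa (i : ℕ) (t : ℝ) : ℝ := 1 / deriv (S.J i) t

/-- The rational algebraic curve `C_i` with parametrization `(χ_i(t), κ_i(t))`. -/
def curve (i : ℕ) : Set PPlane :=
  zariskiClosure {p | ∃ t : ℝ, S.IsRegularParameter i t ∧ p = affinePoint (S.chi i t) (S.kappa i t)}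

end SquareHexagonData

end

/-! Write `J` for `J_i`. The point `(χ, κ)` with parameter `t` satisfies `n χ + J(t) κ = t` together
with the derivative of this equation in `t`, `J'(t) κ = 1`. So `C_i` is the envelope of the lines
`[n : J(t) : -t]`, and its dual is the closure of the graph of `J`. Everything rests on one fact:
`J(t) = t + c + ∑ w_p / (p - t)` with finitely many real poles `p` and all `w_p > 0` (`PickData`).

This fact comes from the interlacing of the `β_{i,k}` and `γ_{i,k}` and from their total gap being
`1`: `Ψ_i - 1` is a combination of the `1 / (t - γ_{i,k})` with positive coefficients of sum `1`.
Hence `Ψ_i` decreases between its poles, the equation `Ψ_i = 1` has `D_i` solutions and `Ψ_i = -g`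
with `g > 0` has `D_i + 1`, all real and simple, and the residues of `1 / (Ψ_i + g)` there are
negative. Summing up, `J_1` has `(m + 1)(D_1 + 1) - 1` poles and `J_i` has `D_i` for `i ≥ 2`
(`PositiveFraction.exists_pickData`).

The graph has degree `d = #poles + 1`, with an equation linear in the second coordinate, hence
irreducible (`irreducible_Fc`). On a line that misses `[0 : 1 : 0]`, the intersection equation
changes sign between consecutive poles, which gives `d - 2` real points. A line through `[0 : 1 :
0]` meets the graph there with multiplicity at least `d - 1`, so its last point is real as well.
Thus the graph is winding (`isWindingForm_F`), and biduality (`TangentPair`) makes `C_i` a cloud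
curve of class `d`.

For the tangencies, the line `κ = 1` is the point `[0 : 1 : -1]` of the graph, reached at `t = ∞`
and smooth, so it has one point of contact (`isTangentAt_infinity`). The line `κ = 0` is `[0 : 1 :
0]`, through which one branch passes for each pole `p`; that branch gives the contact point `(p / n,
0)` (`isTangentAt_poleLine`). -/

noncomputable section

/-! ### Homogeneous and bihomogeneous forms. -/

section WeightedForms

open MvPolynomial

variable {σ τ K : Type*} [CommRing K]

lemma eval_weighted_smul {w : σ → ℕ} {H : MvPolynomial σ K} {k : ℕ}
    (hH : H.IsWeightedHomogeneous w k) (c : K) (x : σ → K) :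
    eval (fun i => c ^ w i * x i) H = c ^ k * eval x H := by
  rw [eval_eq, eval_eq, Finset.mul_sum]
  refine Finset.sum_congr rfl fun d hd => ?_
  have h : Finsupp.weight w d = k := hH (mem_support_iff.1 hd)
  rw [Finsupp.weight_apply] at h
  simp only [mul_pow, Finset.prod_mul_distrib, ← pow_mul]
  rw [Finset.prod_pow_eq_pow_sum]
  have h' : ∑ i ∈ d.support, w i * d i = k := by
    rw [← h, Finsupp.sum]
    exact Finset.sum_congr rfl fun i _ => by simp [mul_comm]
  rw [h']
  ring

lemma eval_smul_of_isHomogeneous {G : MvPolynomial σ K} {k : ℕ} (hG : G.IsHomogeneous k) (c : K)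
    (x : σ → K) : eval (c • x) G = c ^ k * eval x G := by
  have := eval_weighted_smul hG c x
  simpa [Pi.smul_def] using this

lemma IsWeightedHomogeneous.aeval_isHomogeneous {w : σ → ℕ} {H : MvPolynomial σ K} {k : ℕ}
    (hH : H.IsWeightedHomogeneous w k) {f : σ → MvPolynomial τ K}
    (hf : ∀ i, (f i).IsHomogeneous (w i)) : (aeval f H).IsHomogeneous k := by
  rw [aeval_def, eval₂_eq]
  refine IsHomogeneous.sum _ _ _ fun d hd => ?_
  have h : Finsupp.weight w d = k := hH (mem_support_iff.1 hd)
  rw [← zero_add k]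
  refine IsHomogeneous.mul (isHomogeneous_C τ _) ?_
  have h' : ∑ i ∈ d.support, w i * d i = k := by
    rw [← h, Finsupp.weight_apply, Finsupp.sum]
    exact Finset.sum_congr rfl fun i _ => by simp [mul_comm]
  rw [← h']
  exact IsHomogeneous.prod _ _ _ fun i _ => (hf i).pow _

end WeightedForms

/-- The weights that count the degree in the left variables. -/
abbrev leftWeight : Fin 3 ⊕ Fin 3 → ℕ := Sum.elim (fun _ => 1) (fun _ => 0)

/-- The weights that count the degree in the right variables. -/
abbrev rightWeight : Fin 3 ⊕ Fin 3 → ℕ := Sum.elim (fun _ => 0) (fun _ => 1)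

/-- `H` is homogeneous of degree `k` in the left and of degree `l` in the right variables. -/
def IsBihomogeneous (H : MvPolynomial (Fin 3 ⊕ Fin 3) ℂ) (k l : ℕ) : Prop :=
  H.IsWeightedHomogeneous leftWeight k ∧ H.IsWeightedHomogeneous rightWeight l

namespace IsBihomogeneous

open MvPolynomial

variable {H : MvPolynomial (Fin 3 ⊕ Fin 3) ℂ} {k l : ℕ}

lemma eval_smul (hH : IsBihomogeneous H k l) (a b : ℂ) (v w : Fin 3 → ℂ) :
    eval (Sum.elim (a • v) (b • w)) H = a ^ k * b ^ l * eval (Sum.elim v w) H := by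
  have h1 := eval_weighted_smul hH.1 a (Sum.elim v (b • w))
  have h2 := eval_weighted_smul hH.2 b (Sum.elim v w)
  have e1 : (fun i => a ^ leftWeight i * Sum.elim v (b • w) i) = Sum.elim (a • v) (b • w) := by
    funext i; rcases i with i | i <;> simp
  have e2 : (fun i => b ^ rightWeight i * Sum.elim v w i) = Sum.elim v (b • w) := by
    funext i; rcases i with i | i <;> simp
  rw [e1] at h1
  rw [e2] at h2
  rw [h1, h2]; ring

/-- Used with `f` the gradient of a form: a condition on pairs (point, line) becomes a form in the
point alone. -/
lemma aeval_isHomogeneous (hH : IsBihomogeneous H k l) {f : Fin 3 → Form3} {r : ℕ}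
    (hf : ∀ i, (f i).IsHomogeneous r) : (aeval (Sum.elim X f) H).IsHomogeneous (k + r * l) := by
  refine IsWeightedHomogeneous.aeval_isHomogeneous
    (w := Sum.elim (fun _ => 1) (fun _ => r)) ?_ ?_
  · intro d hd
    have h1 := hH.1 hd
    have h2 := hH.2 hd
    rw [Finsupp.weight_apply, Finsupp.sum_fintype _ _ (by simp), Fintype.sum_sum_type] at h1 h2 ⊢
    simp only [Sum.elim_inl, Sum.elim_inr, smul_eq_mul, mul_one, mul_zero,
      Finset.sum_const_zero, add_zero, zero_add] at h1 h2 ⊢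
    rw [h1, ← Finset.sum_mul, h2, mul_comm]
  · rintro (i | i)
    · exact isHomogeneous_X _ _
    · exact hf i

end IsBihomogeneous

/-! ### Points, proportional vectors and annihilators. -/

section Points

open MvPolynomial

lemma rep_mk_eq_smul {v : Fin 3 → ℂ} (hv : v ≠ 0) :
    ∃ a : ℂ, a ≠ 0 ∧ (Projectivization.mk ℂ v hv).rep = a • v := by
  obtain ⟨a, ha⟩ := Projectivization.exists_smul_eq_mk_rep ℂ v hv
  exact ⟨a, a.ne_zero, ha.symm⟩

lemma eval_rep_mk {G : Form3} {k : ℕ} (hG : G.IsHomogeneous k) {v : Fin 3 → ℂ} (hv : v ≠ 0) :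
    eval (Projectivization.mk ℂ v hv).rep G = 0 ↔ eval v G = 0 := by
  obtain ⟨a, ha, e⟩ := rep_mk_eq_smul hv
  rw [e, eval_smul_of_isHomogeneous hG]
  simp [ha]

lemma eval_rep_mk_mk {H : MvPolynomial (Fin 3 ⊕ Fin 3) ℂ} {k l : ℕ} (hH : IsBihomogeneous H k l)
    {v w : Fin 3 → ℂ} (hv : v ≠ 0) (hw : w ≠ 0) :
    eval (Sum.elim (Projectivization.mk ℂ v hv).rep (Projectivization.mk ℂ w hw).rep) H = 0 ↔
      eval (Sum.elim v w) H = 0 := by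
  obtain ⟨a, ha, e⟩ := rep_mk_eq_smul hv
  obtain ⟨b, hb, e'⟩ := rep_mk_eq_smul hw
  rw [e, e', hH.eval_smul]
  simp [ha, hb]

/-- Proportionality of vectors. -/
def IsParallel {R : Type*} [Mul R] (v w : Fin 3 → R) : Prop := ∀ i j, v i * w j = v j * w i

lemma IsParallel.exists_smul {v w : Fin 3 → ℂ} (h : IsParallel v w) (hw : w ≠ 0) :
    ∃ a : ℂ, v = a • w := by
  obtain ⟨j, hj⟩ := Function.ne_iff.1 hw
  refine ⟨v j / w j, funext fun i => ?_⟩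
  have hj' : w j ≠ 0 := hj
  simp only [Pi.smul_apply, smul_eq_mul]
  field_simp
  exact h i j

lemma IsParallel.symm {R : Type*} [CommRing R] {v w : Fin 3 → R} (h : IsParallel v w) :
    IsParallel w v := fun i j => by rw [mul_comm, h j i, mul_comm]

lemma eq_mk_of_isParallel {p : PPlane} {v : Fin 3 → ℂ} (hv : v ≠ 0) (h : IsParallel p.rep v) :
    p = Projectivization.mk ℂ v hv := by
  obtain ⟨a, ha⟩ := h.exists_smul hv
  rw [← Projectivization.mk_rep p, Projectivization.mk_eq_mk_iff']
  exact ⟨a, ha.symm⟩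

/-- The vectors annihilated by the covector `g`. -/
def annihilator (g : Fin 3 → ℂ) : Submodule ℂ (Fin 3 → ℂ) :=
  LinearMap.ker (∑ j, g j • (LinearMap.proj j : (Fin 3 → ℂ) →ₗ[ℂ] ℂ))

lemma mem_annihilator {g w : Fin 3 → ℂ} : w ∈ annihilator g ↔ ∑ j, g j * w j = 0 := by
  simp [annihilator, LinearMap.sum_apply]

lemma finrank_annihilator {g : Fin 3 → ℂ} (hg : g ≠ 0) : Module.finrank ℂ (annihilator g) = 2 := by
  have hne : (∑ j, g j • (LinearMap.proj j : (Fin 3 → ℂ) →ₗ[ℂ] ℂ) : Module.Dual ℂ (Fin 3 → ℂ)) ≠ 0 := by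
    intro h
    refine hg (funext fun i => ?_)
    have := LinearMap.congr_fun h (Pi.single i 1)
    simpa [LinearMap.sum_apply, Pi.single_apply] using this
  have := Module.Dual.finrank_ker_add_one_of_ne_zero hne
  rw [Module.finrank_fin_fun] at this
  exact Nat.succ_injective this

lemma isParallel_of_annihilator {g L : Fin 3 → ℂ}
    (h : ∀ w ∈ annihilator g, ∑ j, L j * w j = 0) : IsParallel L g := by
  intro i j
  have := h (g j • Pi.single i 1 - g i • Pi.single j 1) (by
    rw [mem_annihilator]
    simp [Pi.single_apply, mul_sub, Finset.sum_sub_distrib, mul_comm])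
  simp [Pi.single_apply, mul_sub, Finset.sum_sub_distrib] at this
  linear_combination this

end Points

/-! ### Zariski closures of polynomial curves. -/

section PolynomialCurves

open MvPolynomial

/-- The point with parameter `t` of a polynomial curve. -/
def curvePoint (α : Fin 3 → Polynomial ℂ) (t : ℂ) : Fin 3 → ℂ := fun j => (α j).eval t

lemma eval_aeval_curve (α : Fin 3 → Polynomial ℂ) (t : ℂ) (G : Form3) :
    (aeval α G).eval t = eval (curvePoint α t) G := by
  have : ((Polynomial.evalRingHom t).comp (aeval α : Form3 →ₐ[ℂ] Polynomial ℂ).toRingHom)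
      = eval (curvePoint α t) := by
    ext i <;> simp [curvePoint]
  exact RingHom.congr_fun this G

lemma eval_aeval_curve₂ (α β : Fin 3 → Polynomial ℂ) (t : ℂ) (H : MvPolynomial (Fin 3 ⊕ Fin 3) ℂ) :
    (aeval (Sum.elim α β) H).eval t = eval (Sum.elim (curvePoint α t) (curvePoint β t)) H := by
  have : ((Polynomial.evalRingHom t).comp
      (aeval (Sum.elim α β) : MvPolynomial (Fin 3 ⊕ Fin 3) ℂ →ₐ[ℂ] Polynomial ℂ).toRingHom)
      = eval (Sum.elim (curvePoint α t) (curvePoint β t)) := by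
    ext i
    · simp
    · rcases i with i | i <;> simp [curvePoint]
  exact RingHom.congr_fun this H

lemma eq_zero_of_eval_eq_zero_of_ne {f g : Polynomial ℂ} (hg : g ≠ 0)
    (h : ∀ t, g.eval t ≠ 0 → f.eval t = 0) : f = 0 := by
  have : f * g = 0 := Polynomial.funext fun t => by
    by_cases ht : g.eval t = 0
    · simp [ht]
    · simp [h t ht]
  exact (mul_eq_zero.1 this).resolve_right hg

lemma aeval_curve_eq_zero_iff {α : Fin 3 → Polynomial ℂ} {G : Form3} :
    aeval α G = 0 ↔ ∀ t, eval (curvePoint α t) G = 0 := by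
  constructor
  · intro h t; rw [← eval_aeval_curve, h, Polynomial.eval_zero]
  · intro h; exact Polynomial.funext fun t => by rw [eval_aeval_curve, h, Polynomial.eval_zero]

/-- The Zariski closure of the image of a polynomial parametrization. -/
def paramClosure (α : Fin 3 → Polynomial ℂ) : Set PPlane :=
  {p | ∀ (k : ℕ) (G : Form3), G.IsHomogeneous k → aeval α G = 0 → eval p.rep G = 0}

lemma mk_curvePoint_mem {α : Fin 3 → Polynomial ℂ} {t : ℂ} (h : curvePoint α t ≠ 0) :
    Projectivization.mk ℂ (curvePoint α t) h ∈ paramClosure α := by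
  intro k G hG h0
  rw [eval_rep_mk hG, ← eval_aeval_curve, h0, Polynomial.eval_zero]

lemma vanishesOn_paramClosure {α : Fin 3 → Polynomial ℂ} (hα : ∀ t, curvePoint α t ≠ 0) {G : Form3}
    {k : ℕ} (hG : G.IsHomogeneous k) : VanishesOn G (paramClosure α) ↔ aeval α G = 0 := by
  constructor
  · intro h
    refine aeval_curve_eq_zero_iff.2 fun t => ?_
    exact (eval_rep_mk hG (hα t)).1 (h _ (mk_curvePoint_mem (hα t)))
  · intro h q hq
    exact hq k G hG h

lemma mem_coneTangentSpace {α : Fin 3 → Polynomial ℂ} (hα : ∀ t, curvePoint α t ≠ 0) {p : PPlane}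
    {w : Fin 3 → ℂ} : w ∈ coneTangentSpace (paramClosure α) p ↔
      ∀ (k : ℕ) (G : Form3), G.IsHomogeneous k → aeval α G = 0 →
        ∑ j, eval p.rep (pderiv j G) * w j = 0 := by
  constructor
  · intro h k G hG h0
    exact h k G hG ((vanishesOn_paramClosure hα hG).2 h0)
  · intro h k G hG h0
    exact h k G hG ((vanishesOn_paramClosure hα hG).1 h0)

/-- Every polynomial curve satisfies a homogeneous equation. -/
lemma exists_equation (α : Fin 3 → Polynomial ℂ) :
    ∃ (k : ℕ) (G : Form3), G.IsHomogeneous k ∧ G ≠ 0 ∧ aeval α G = 0 := by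
  classical
  let x : Fin 3 → MvPolynomial (Fin 2) ℂ := fun j => X 0 * Polynomial.aeval (X 1) (α j)
  -- The cone over the curve is parametrized by three polynomials in the two variables `u, t`, and
  -- three exceed the transcendence degree.
  have hx : ¬ AlgebraicIndependent ℂ x := by
    intro h
    have h1 := h.lift_cardinalMk_le_trdeg
    rw [MvPolynomial.trdeg_of_isDomain] at h1
    simp at h1
    norm_num at h1
  rw [algebraicIndependent_iff] at hx
  push Not at hx
  obtain ⟨G, hG, hne⟩ := hx
  obtain ⟨k, hk⟩ : ∃ k, homogeneousComponent k G ≠ 0 := by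
    by_contra! h
    apply hne
    rw [← sum_homogeneousComponent G]
    simp [h]
  refine ⟨k, homogeneousComponent k G, homogeneousComponent_isHomogeneous k G, hk, ?_⟩
  refine aeval_curve_eq_zero_iff.2 fun t => ?_
  have hu : ∀ u : ℂ, eval (u • curvePoint α t) G = 0 := by
    intro u
    have : (eval (![u, t]) : MvPolynomial (Fin 2) ℂ →+* ℂ).comp
        (aeval x : Form3 →ₐ[ℂ] MvPolynomial (Fin 2) ℂ).toRingHom = eval (u • curvePoint α t) := by
      ext i
      · simp
      · simp only [RingHom.comp_apply, AlgHom.toRingHom_eq_coe, RingHom.coe_coe, aeval_X, eval_X, x,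
          map_mul, Matrix.cons_val_zero, Pi.smul_apply, smul_eq_mul, curvePoint]
        congr 1
        rw [← coe_aeval_eq_eval, RingHom.coe_coe, ← Polynomial.aeval_algHom_apply]
        simp
    rw [← this, RingHom.comp_apply, AlgHom.toRingHom_eq_coe, RingHom.coe_coe, hG, map_zero]
  -- The relation holds along the whole ray `u • α t`; as a polynomial in `u` it vanishes
  -- identically, so each homogeneous component vanishes at `α t`.
  have hp : (∑ i ∈ Finset.range (G.totalDegree + 1),
      Polynomial.C (eval (curvePoint α t) (homogeneousComponent i G)) * Polynomial.X ^ i) = 0 := by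
    refine Polynomial.funext fun u => ?_
    rw [Polynomial.eval_zero, ← hu u]
    conv_rhs => rw [← sum_homogeneousComponent G]
    rw [map_sum, Polynomial.eval_finsetSum]
    refine Finset.sum_congr rfl fun i _ => ?_
    rw [eval_smul_of_isHomogeneous (homogeneousComponent_isHomogeneous i G), Polynomial.eval_mul,
      Polynomial.eval_C, Polynomial.eval_pow, Polynomial.eval_X, mul_comm]
  by_cases hk' : k < G.totalDegree + 1
  · have h := congrArg (fun p => Polynomial.coeff p k) hp
    rw [Polynomial.finsetSum_coeff, Finset.sum_eq_single k
      (fun b _ hb => by rw [Polynomial.coeff_C_mul_X_pow, if_neg hb.symm])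
      (fun hn => absurd (Finset.mem_range.2 hk') hn),
      Polynomial.coeff_C_mul_X_pow, if_pos rfl, Polynomial.coeff_zero] at h
    exact h
  · exact absurd (homogeneousComponent_eq_zero k G (by omega)) hk

/-- Every polynomial curve satisfies a homogeneous equation whose gradient does not vanish
identically along the curve. -/
lemma exists_equation_with_gradient (α : Fin 3 → Polynomial ℂ) :
    ∃ (k : ℕ) (G : Form3) (j : Fin 3), G.IsHomogeneous k ∧ aeval α G = 0 ∧
      aeval α (pderiv j G) ≠ 0 := by
  classical
  have hex := exists_equation α
  -- For an equation of least degree, partial derivatives that vanish along the curve vanish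
  -- identically, and then Euler's identity kills the equation itself.
  obtain ⟨G, hG, hne, h0⟩ := Nat.find_spec hex
  have hmin := fun m (hm : m < Nat.find hex) => Nat.find_min hex hm
  set k := Nat.find hex
  by_contra! hcon
  have hz : ∀ j, pderiv j G = 0 := by
    intro j
    by_contra hj
    rcases Nat.eq_zero_or_pos k with hk | hk
    · rw [hk, ← totalDegree_zero_iff_isHomogeneous, totalDegree_eq_zero_iff_eq_C] at hG
      rw [hG, pderiv_C] at hj
      exact hj rfl
    · exact hmin (k - 1) (by omega) ⟨pderiv j G, hG.pderiv, hj, hcon k G j hG h0⟩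
  have he := hG.sum_X_mul_pderiv
  simp only [hz, mul_zero, Finset.sum_const_zero] at he
  rcases Nat.eq_zero_or_pos k with hk | hk
  · rw [hk, ← totalDegree_zero_iff_isHomogeneous, totalDegree_eq_zero_iff_eq_C] at hG
    rw [hG] at h0 hne
    simp only [aeval_C, Polynomial.algebraMap_eq, Polynomial.C_eq_zero] at h0
    rw [h0, C_0] at hne
    exact hne rfl
  · rcases smul_eq_zero.1 he.symm with h | h
    · omega
    · exact hne h

end PolynomialCurves
end

/-! ### Duality of parametrized curves and the conormal variety. -/

noncomputable section

open MvPolynomial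

/-- The gradient of a form at a point. -/
def formGradient (G : Form3) (v : Fin 3 → ℂ) : Fin 3 → ℂ := fun j => eval v (pderiv j G)

/-- The curve `β` describes the tangent lines of the curve `α`: the gradients along `α` of the
forms vanishing on `α` are proportional to `β`. -/
structure TangentPair (α β : Fin 3 → Polynomial ℂ) : Prop where
  left_ne_zero : ∀ t, curvePoint α t ≠ 0
  right_ne_zero : ∀ t, curvePoint β t ≠ 0
  gradient_parallel : ∀ (k : ℕ) (G : Form3), G.IsHomogeneous k → aeval α G = 0 →
    IsParallel (fun i => aeval α (pderiv i G)) β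

lemma sum_rep_mk_mul_eq_zero {g w : Fin 3 → ℂ} (hg : g ≠ 0) (hw : w ∈ annihilator g) :
    ∑ j, (Projectivization.mk ℂ g hg).rep j * w j = 0 := by
  obtain ⟨a, ha, e⟩ := rep_mk_eq_smul hg
  rw [e]
  simp only [Pi.smul_apply, smul_eq_mul, mul_assoc]
  rw [← Finset.mul_sum, mem_annihilator.1 hw, mul_zero]

namespace TangentPair

variable {α β : Fin 3 → Polynomial ℂ} (h : TangentPair α β)

include h

lemma gradient_at {k : ℕ} {G : Form3} (hG : G.IsHomogeneous k) (h0 : aeval α G = 0) (t : ℂ) :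
    IsParallel (formGradient G (curvePoint α t)) (curvePoint β t) := by
  intro i j
  have := congrArg (Polynomial.eval t) (h.gradient_parallel k G hG h0 i j)
  simp only [Polynomial.eval_mul, eval_aeval_curve] at this
  exact this

/-- Along the parametrization both gradients are multiples of `β`. The 2×2 minors are forms, so
their vanishing passes to the closure, including points that are not of the form `α t`. -/
lemma gradients_parallel {k k' : ℕ} {G G' : Form3} (hG : G.IsHomogeneous k)
    (hG' : G'.IsHomogeneous k') (h0 : aeval α G = 0) (h0' : aeval α G' = 0) {q : PPlane}
    (hq : q ∈ paramClosure α) : IsParallel (formGradient G q.rep) (formGradient G' q.rep) := by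
  intro i j
  have hom : (pderiv i G * pderiv j G' - pderiv j G * pderiv i G').IsHomogeneous
      ((k - 1) + (k' - 1)) :=
    (hG.pderiv.mul hG'.pderiv).sub (hG.pderiv.mul hG'.pderiv)
  have hz : aeval α (pderiv i G * pderiv j G' - pderiv j G * pderiv i G') = 0 := by
    refine aeval_curve_eq_zero_iff.2 fun t => ?_
    obtain ⟨a, ha⟩ := (h.gradient_at hG h0 t).exists_smul (h.right_ne_zero t)
    obtain ⟨b, hb⟩ := (h.gradient_at hG' h0' t).exists_smul (h.right_ne_zero t)
    have ha' := fun l => congrFun ha l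
    have hb' := fun l => congrFun hb l
    simp only [formGradient, Pi.smul_apply, smul_eq_mul] at ha' hb'
    simp only [map_sub, map_mul, ha', hb']
    ring
  have := hq _ _ hom hz
  rw [map_sub, map_mul, map_mul] at this
  exact sub_eq_zero.1 this

/-- The gradients at a point span at most a line, so they impose at most one linear condition. This
makes every point with a nonzero gradient smooth in the sense of least tangent dimension. -/
lemma two_le_finrank {q : PPlane} (hq : q ∈ paramClosure α) :
    2 ≤ Module.finrank ℂ (coneTangentSpace (paramClosure α) q) := by
  by_cases hall : ∀ (k : ℕ) (G : Form3), G.IsHomogeneous k → aeval α G = 0 → formGradient G q.rep = 0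
  · have : coneTangentSpace (paramClosure α) q = ⊤ := by
      refine eq_top_iff.2 fun w _ => (mem_coneTangentSpace h.left_ne_zero).2 fun k G hG h0 => ?_
      refine Finset.sum_eq_zero fun j _ => ?_
      have := congrFun (hall k G hG h0) j
      simp only [formGradient, Pi.zero_apply] at this
      rw [this, zero_mul]
    rw [this, finrank_top, Module.finrank_fin_fun]
    norm_num
  · push Not at hall
    obtain ⟨k, G, hG, h0, hne⟩ := hall
    rw [← finrank_annihilator hne]
    refine Submodule.finrank_mono fun w hw => (mem_coneTangentSpace h.left_ne_zero).2 ?_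
    intro k' G' hG' h0'
    obtain ⟨a, ha⟩ := (h.gradients_parallel hG' hG h0' h0 hq).exists_smul hne
    have ha' := fun l => congrFun ha l
    simp only [formGradient, Pi.smul_apply, smul_eq_mul] at ha'
    simp only [ha', mul_assoc]
    rw [← Finset.mul_sum]
    have := mem_annihilator.1 hw
    simp only [formGradient] at this
    rw [this, mul_zero]

lemma coneTangentSpace_curvePoint {k : ℕ} {G : Form3} (hG : G.IsHomogeneous k)
    (h0 : aeval α G = 0) {t : ℂ} (hne : formGradient G (curvePoint α t) ≠ 0) :
    coneTangentSpace (paramClosure α) (Projectivization.mk ℂ _ (h.left_ne_zero t)) =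
      annihilator (curvePoint β t) := by
  obtain ⟨a, ha, e⟩ := rep_mk_eq_smul (h.left_ne_zero t)
  ext w
  rw [mem_coneTangentSpace h.left_ne_zero, mem_annihilator]
  have key : ∀ (k : ℕ) (G : Form3), G.IsHomogeneous k →
      ∑ j, eval (Projectivization.mk ℂ _ (h.left_ne_zero t)).rep (pderiv j G) * w j =
        a ^ (k - 1) * ∑ j, formGradient G (curvePoint α t) j * w j := by
    intro k G hG
    rw [e, Finset.mul_sum]
    refine Finset.sum_congr rfl fun j _ => ?_
    rw [eval_smul_of_isHomogeneous hG.pderiv, mul_assoc]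
    rfl
  constructor
  · intro hw
    have h1 := hw k G hG h0
    rw [key k G hG] at h1
    have h2 := (mul_eq_zero.1 h1).resolve_left (pow_ne_zero _ ha)
    obtain ⟨b, hb⟩ := (h.gradient_at hG h0 t).symm.exists_smul hne
    rw [hb]
    simp only [Pi.smul_apply, smul_eq_mul, mul_assoc]
    rw [← Finset.mul_sum, h2, mul_zero]
  · intro hw k' G' hG' h0'
    rw [key k' G' hG']
    obtain ⟨b, hb⟩ := (h.gradient_at hG' h0' t).exists_smul (h.right_ne_zero t)
    rw [hb]
    simp only [Pi.smul_apply, smul_eq_mul, mul_assoc]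
    rw [← Finset.mul_sum, hw, mul_zero, mul_zero]

/-- At almost all parameters, the curve is smooth with tangent line `β t`. -/
lemma exists_polynomial_isSmoothTangent : ∃ g : Polynomial ℂ, g ≠ 0 ∧ ∀ t, g.eval t ≠ 0 →
    IsSmoothTangent (paramClosure α) (Projectivization.mk ℂ _ (h.left_ne_zero t))
      (Projectivization.mk ℂ _ (h.right_ne_zero t)) := by
  obtain ⟨k, G, j, hG, h0, hj⟩ := exists_equation_with_gradient α
  refine ⟨_, hj, fun t ht => ?_⟩
  have hne : formGradient G (curvePoint α t) ≠ 0 := by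
    intro h1
    apply ht
    rw [eval_aeval_curve]
    exact congrFun h1 j
  have hT := h.coneTangentSpace_curvePoint hG h0 hne
  refine ⟨⟨mk_curvePoint_mem _, fun q hq => ?_⟩, fun v hv => ?_⟩
  · rw [hT, finrank_annihilator (h.right_ne_zero t)]
    exact h.two_le_finrank hq
  · rw [hT] at hv
    exact sum_rep_mk_mul_eq_zero (h.right_ne_zero t) hv

/-- A tangent line at a smooth point is given by the gradient of a form vanishing on the curve. -/
lemma exists_gradient_of_isSmoothTangent {q M : PPlane}
    (hq : IsSmoothTangent (paramClosure α) q M) :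
    ∃ (k : ℕ) (G : Form3) (a : ℂ), G.IsHomogeneous k ∧ aeval α G = 0 ∧
      M.rep = a • formGradient G q.rep := by
  obtain ⟨⟨hqX, hmin⟩, hM⟩ := hq
  obtain ⟨k, G, hG, h0, hne⟩ : ∃ (k : ℕ) (G : Form3), G.IsHomogeneous k ∧ aeval α G = 0 ∧
      formGradient G q.rep ≠ 0 := by
    -- If all gradients vanished at `q`, its tangent space would have dimension 3, while some point
    -- `α t` has dimension 2; then `q` would not be smooth.
    by_contra! hall
    have htop : coneTangentSpace (paramClosure α) q = ⊤ := by
      refine eq_top_iff.2 fun w _ => (mem_coneTangentSpace h.left_ne_zero).2 fun k G hG h0 => ?_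
      refine Finset.sum_eq_zero fun j _ => ?_
      have := congrFun (hall k G hG h0) j
      simp only [formGradient, Pi.zero_apply] at this
      rw [this, zero_mul]
    obtain ⟨k, G, j, hG, h0, hj⟩ := exists_equation_with_gradient α
    obtain ⟨t, ht⟩ : ∃ t, (aeval α (pderiv j G)).eval t ≠ 0 := by
      by_contra! hz
      exact hj (Polynomial.funext fun t => by rw [hz, Polynomial.eval_zero])
    have hne : formGradient G (curvePoint α t) ≠ 0 := by
      intro h1
      apply ht
      rw [eval_aeval_curve]
      exact congrFun h1 j
    have := hmin _ (mk_curvePoint_mem (h.left_ne_zero t))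
    rw [h.coneTangentSpace_curvePoint hG h0 hne, finrank_annihilator (h.right_ne_zero t), htop,
      finrank_top, Module.finrank_fin_fun] at this
    norm_num at this
  refine ⟨k, G, ?_⟩
  have hpar : IsParallel M.rep (formGradient G q.rep) := by
    refine isParallel_of_annihilator fun w hw => hM w ?_
    refine (mem_coneTangentSpace h.left_ne_zero).2 fun k' G' hG' h0' => ?_
    obtain ⟨a, ha⟩ := (h.gradients_parallel hG' hG h0' h0 hqX).exists_smul hne
    change ∑ j, formGradient G' q.rep j * w j = 0
    rw [ha]
    simp only [Pi.smul_apply, smul_eq_mul, mul_assoc]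
    rw [← Finset.mul_sum, mem_annihilator.1 hw, mul_zero]
  obtain ⟨a, ha⟩ := hpar.exists_smul hne
  exact ⟨a, hG, h0, ha⟩

/-- A bihomogeneous form that vanishes at all pairs `(α t, β t)` vanishes at all pairs consisting
of a smooth point and a tangent line. -/
lemma eval_eq_zero_of_isSmoothTangent {k l : ℕ} {H : MvPolynomial (Fin 3 ⊕ Fin 3) ℂ}
    (hH : IsBihomogeneous H k l)
    (h0 : ∀ t, eval (Sum.elim (curvePoint α t) (curvePoint β t)) H = 0) {q M : PPlane}
    (hq : IsSmoothTangent (paramClosure α) q M) : eval (Sum.elim q.rep M.rep) H = 0 := by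
  obtain ⟨m, G, a, hG, hG0, hM⟩ := h.exists_gradient_of_isSmoothTangent hq
  have hcomp : ∀ v : Fin 3 → ℂ, eval v (aeval (Sum.elim X fun j => pderiv j G) H) =
      eval (Sum.elim v (formGradient G v)) H := by
    intro v
    have : (eval v).comp (aeval (Sum.elim X fun j => pderiv j G) :
        MvPolynomial (Fin 3 ⊕ Fin 3) ℂ →ₐ[ℂ] Form3).toRingHom =
        eval (Sum.elim v (formGradient G v)) := by
      ext i
      · simp
      · rcases i with i | i <;> simp [formGradient]
    exact RingHom.congr_fun this H
  -- Replacing the line by the gradient of `G` turns `H` into a form that vanishes along `α`, hence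
  -- on its whole closure, in particular at `q`.
  have hz : aeval α (aeval (Sum.elim X fun j => pderiv j G) H : Form3) = 0 := by
    refine aeval_curve_eq_zero_iff.2 fun t => ?_
    obtain ⟨b, hb⟩ := (h.gradient_at hG hG0 t).exists_smul (h.right_ne_zero t)
    have := hH.eval_smul 1 b (curvePoint α t) (curvePoint β t)
    rw [hcomp, hb]
    rw [one_smul, h0, mul_zero] at this
    exact this
  have h1 := hq.1.1 _ _ (hH.aeval_isHomogeneous fun i => hG.pderiv) hz
  rw [hcomp] at h1
  have := hH.eval_smul 1 a q.rep (formGradient G q.rep)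
  rw [one_smul, h1, mul_zero] at this
  rw [hM, this]

/-- The conormal variety is the closure of the pairs `(α t, β t)`: almost all of these are smooth
tangents, and a bihomogeneous form that vanishes on all of them vanishes on every smooth tangent. -/
lemma isTangentAt_iff {L p : PPlane} : IsTangentAt (paramClosure α) L p ↔
    ∀ (k l : ℕ) (H : MvPolynomial (Fin 3 ⊕ Fin 3) ℂ), IsBihomogeneous H k l →
      (∀ t, eval (Sum.elim (curvePoint α t) (curvePoint β t)) H = 0) →
      eval (Sum.elim p.rep L.rep) H = 0 := by
  constructor
  · intro hT k l H hH h0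
    exact hT k l H hH.1 hH.2 fun q M hq => h.eval_eq_zero_of_isSmoothTangent hH h0 hq
  · intro hT k l H hk hl h0
    refine hT k l H ⟨hk, hl⟩ ?_
    obtain ⟨g, hg, hgt⟩ := h.exists_polynomial_isSmoothTangent
    have : aeval (Sum.elim α β) H = 0 := by
      refine eq_zero_of_eval_eq_zero_of_ne hg fun t ht => ?_
      rw [eval_aeval_curve₂]
      exact (eval_rep_mk_mk ⟨hk, hl⟩ (h.left_ne_zero t) (h.right_ne_zero t)).1 (h0 _ _ (hgt t ht))
    intro t
    rw [← eval_aeval_curve₂, this, Polynomial.eval_zero]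

end TangentPair

/-- Forms in the line alone become bihomogeneous of degree 0 in the point, so results about pairs
specialize to the dual curve. -/
lemma isBihomogeneous_rename_inr {G : Form3} {k : ℕ} (hG : G.IsHomogeneous k) :
    IsBihomogeneous (rename Sum.inr G) 0 k := by
  have aux : ∀ d : Fin 3 ⊕ Fin 3 →₀ ℕ, coeff d (rename Sum.inr G) ≠ 0 →
      ∃ u : Fin 3 →₀ ℕ, u.mapDomain Sum.inr = d ∧ coeff u G ≠ 0 := fun d hd =>
    coeff_rename_ne_zero _ _ _ hd
  constructor
  · intro d hd
    obtain ⟨u, rfl, hu⟩ := aux d hd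
    rw [Finsupp.weight_apply, Finsupp.sum_mapDomain_index (by simp) (by simp [add_mul])]
    simp
  · intro d hd
    obtain ⟨u, rfl, hu⟩ := aux d hd
    rw [Finsupp.weight_apply, Finsupp.sum_mapDomain_index (by simp) (by simp [add_mul])]
    have := hG hu
    rw [Finsupp.weight_apply] at this
    simpa using this

lemma TangentPair.dualCurve_eq {α β : Fin 3 → Polynomial ℂ} (h : TangentPair α β) :
    dualCurve (paramClosure α) = paramClosure β := by
  ext L
  constructor
  · intro hL k G hG h0
    refine hL k G hG ?_
    rintro M ⟨q, hq⟩
    have := h.eval_eq_zero_of_isSmoothTangent (isBihomogeneous_rename_inr hG) (fun t => by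
      rw [eval_rename, Sum.elim_comp_inr]
      exact aeval_curve_eq_zero_iff.1 h0 t) hq
    rwa [eval_rename, Sum.elim_comp_inr] at this
  · intro hL k G hG h0
    refine hL k G hG ?_
    obtain ⟨g, hg, hgt⟩ := h.exists_polynomial_isSmoothTangent
    refine eq_zero_of_eval_eq_zero_of_ne hg fun t ht => ?_
    rw [eval_aeval_curve]
    exact (eval_rep_mk hG (h.right_ne_zero t)).1 (h0 _ ⟨_, hgt t ht⟩)

/-- A form vanishing on a polynomial curve has gradients annihilating the curve and its derivative;
they are proportional to `β` if `β` is up to a factor the cross product of these two. -/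
lemma TangentPair.of_cross {α β : Fin 3 → Polynomial ℂ} {δ : Polynomial ℂ} (hδ : δ ≠ 0)
    (hα : ∀ t, curvePoint α t ≠ 0) (hβ : ∀ t, curvePoint β t ≠ 0)
    (hcross : crossProduct α (fun j => Polynomial.derivative (α j)) = δ • β) :
    TangentPair α β := by
  refine ⟨hα, hβ, fun k G hG h0 => ?_⟩
  set g : Fin 3 → Polynomial ℂ := fun i => aeval α (pderiv i G) with hgdef
  -- Euler's identity along the curve.
  have h1 : ∑ j, g j * α j = 0 := by
    have := congrArg (aeval α) hG.sum_X_mul_pderiv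
    rw [map_sum, map_nsmul, h0, smul_zero] at this
    rw [← this]
    refine Finset.sum_congr rfl fun j _ => ?_
    rw [map_mul, aeval_X, mul_comm]
  -- The chain rule applied to `G(α(t)) = 0`.
  have h2 : ∑ j, g j * Polynomial.derivative (α j) = 0 := by
    have hd : Polynomial.derivative (aeval α G) = ∑ j, g j * Polynomial.derivative (α j) := by
      have : ∀ P : Form3, Polynomial.derivative (aeval α P) =
          ∑ j, aeval α (pderiv j P) * Polynomial.derivative (α j) := by
        intro P
        induction P using MvPolynomial.induction_on with
        | C a => simp
        | add p q hp hq => simp [hp, hq, add_mul, Finset.sum_add_distrib]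
        | mul_X p i hp =>
          simp only [map_mul, aeval_X, Polynomial.derivative_mul, hp, Derivation.leibniz,
            smul_eq_mul, map_add, pderiv_X, add_mul, Finset.sum_add_distrib]
          rw [add_comm]
          congr 1
          · rw [Finset.sum_eq_single i]
            · simp
            · intro b _ hb
              simp [hb.symm]
            · simp
          · rw [Finset.sum_mul]
            exact Finset.sum_congr rfl fun j _ => by ring
      exact this G
    rw [← hd, h0, Polynomial.derivative_zero]
  rw [Fin.sum_univ_three] at h1 h2
  have c0 := congrFun hcross 0
  have c1 := congrFun hcross 1
  have c2 := congrFun hcross 2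
  simp only [cross_apply, Matrix.cons_val_zero, Matrix.cons_val_one, Matrix.cons_val,
    Pi.smul_apply, smul_eq_mul] at c0 c1 c2
  -- The triple product identity `g × (α × α') = α (g · α') - α' (g · α)`, whose right side vanishes
  -- by `h1` and `h2`.
  have key : ∀ i j, δ * (g i * β j - g j * β i) = 0 := by
    intro i j
    fin_cases i <;> fin_cases j <;>
      simp only [Fin.zero_eta, Fin.mk_one, Fin.reduceFinMk]
    · ring
    · linear_combination -g 0 * c1 + g 1 * c0 + α 2 * h2 - Polynomial.derivative (α 2) * h1
    · linear_combination -g 0 * c2 + g 2 * c0 - α 1 * h2 + Polynomial.derivative (α 1) * h1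
    · linear_combination g 0 * c1 - g 1 * c0 - α 2 * h2 + Polynomial.derivative (α 2) * h1
    · ring
    · linear_combination -g 1 * c2 + g 2 * c1 + α 0 * h2 - Polynomial.derivative (α 0) * h1
    · linear_combination g 0 * c2 - g 2 * c0 + α 1 * h2 - Polynomial.derivative (α 1) * h1
    · linear_combination g 1 * c2 - g 2 * c1 - α 0 * h2 + Polynomial.derivative (α 0) * h1
    · ring
  intro i j
  exact sub_eq_zero.1 ((mul_eq_zero.1 (key i j)).resolve_left hδ)

end

/-! ### Pick functions, their graphs, and the equation of the graph. -/

noncomputable section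

/-- The data of the rational function `t + c + ∑ p ∈ poles, weight p / (p - t)` with positive
weights, together with a scaling factor `n`. -/
structure PickData where
  n : ℝ
  c : ℝ
  poles : Finset ℝ
  weight : ℝ → ℝ
  n_pos : 0 < n
  weight_pos : ∀ p ∈ poles, 0 < weight p

namespace PickData

open Polynomial

variable (A : PickData)

/-- The denominator. -/
def Q : ℝ[X] := ∏ p ∈ A.poles, (X - C p)

/-- The numerator of the polar part `∑ p, weight p / (t - p)`. -/
def E : ℝ[X] := ∑ p ∈ A.poles, C (A.weight p) * ∏ q ∈ A.poles.erase p, (X - C q)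

/-- The numerator. -/
def P : ℝ[X] := (X + C A.c) * A.Q - A.E

/-- The numerator of the derivative. -/
def N : ℝ[X] := derivative A.P * A.Q - A.P * derivative A.Q

/-- The denominator as a complex polynomial. -/
def Qc : ℂ[X] := A.Q.map (algebraMap ℝ ℂ)

/-- The polar numerator as a complex polynomial. -/
def Ec : ℂ[X] := A.E.map (algebraMap ℝ ℂ)

/-- The numerator as a complex polynomial. -/
def Pc : ℂ[X] := A.P.map (algebraMap ℝ ℂ)

/-- The numerator of the derivative as a complex polynomial. -/
def Nc : ℂ[X] := A.N.map (algebraMap ℝ ℂ)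

/-- The graph of the function, as a curve in the dual plane. -/
def graphCurve : Fin 3 → ℂ[X] := ![C (A.n : ℂ) * A.Qc, A.Pc, -(X * A.Qc)]

/-- The envelope of the lines given by the graph. -/
def envelope : Fin 3 → ℂ[X] :=
  ![X * A.Nc - A.Pc * A.Qc, C (A.n : ℂ) * A.Qc ^ 2, C (A.n : ℂ) * A.Nc]

lemma eval_derivative_Q {p : ℝ} (hp : p ∈ A.poles) :
    (derivative A.Q).eval p = ∏ q ∈ A.poles.erase p, (p - q) := by
  rw [Q, derivative_prod_finset, eval_finsetSum, Finset.sum_eq_single_of_mem p hp]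
  · simp [eval_prod]
  · intro b _ hb
    simp only [derivative_sub, derivative_X, derivative_C, sub_zero, mul_one, eval_prod, eval_sub,
      eval_X, eval_C]
    exact Finset.prod_eq_zero (Finset.mem_erase.2 ⟨hb.symm, hp⟩) (sub_self p)

lemma eval_derivative_Q_ne_zero {p : ℝ} (hp : p ∈ A.poles) : (derivative A.Q).eval p ≠ 0 := by
  rw [A.eval_derivative_Q hp]
  exact Finset.prod_ne_zero_iff.2 fun q hq => sub_ne_zero.2 (Finset.ne_of_mem_erase hq).symm

lemma eval_Q {p : ℝ} (hp : p ∈ A.poles) : A.Q.eval p = 0 := by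
  rw [Q, eval_prod]
  exact Finset.prod_eq_zero hp (by simp)

lemma eval_Q_ne_zero {t : ℝ} (ht : t ∉ A.poles) : A.Q.eval t ≠ 0 := by
  rw [Q, eval_prod]
  refine Finset.prod_ne_zero_iff.2 fun q hq => ?_
  rw [eval_sub, eval_X, eval_C]
  exact sub_ne_zero.2 fun e => ht (e ▸ hq)

lemma eval_E {p : ℝ} (hp : p ∈ A.poles) : A.E.eval p = A.weight p * (derivative A.Q).eval p := by
  rw [E, eval_finsetSum, Finset.sum_eq_single_of_mem p hp, A.eval_derivative_Q hp]
  · simp [eval_prod]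
  · intro b _ hb
    simp only [eval_mul, eval_C, eval_prod, eval_sub, eval_X]
    rw [Finset.prod_eq_zero (Finset.mem_erase.2 ⟨hb.symm, hp⟩) (sub_self p), mul_zero]

lemma eval_E_ne_zero {p : ℝ} (hp : p ∈ A.poles) : A.E.eval p ≠ 0 := by
  rw [A.eval_E hp]
  exact mul_ne_zero (A.weight_pos p hp).ne' (A.eval_derivative_Q_ne_zero hp)

lemma eval_P {p : ℝ} (hp : p ∈ A.poles) : A.P.eval p = -A.E.eval p := by
  rw [P, eval_sub, eval_mul, A.eval_Q hp, mul_zero, zero_sub]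

lemma eval_N {p : ℝ} (hp : p ∈ A.poles) :
    A.N.eval p = A.weight p * (derivative A.Q).eval p ^ 2 := by
  rw [N, eval_sub, eval_mul, eval_mul, A.eval_Q hp, A.eval_P hp, A.eval_E hp]
  ring

lemma eval_N_ne_zero {p : ℝ} (hp : p ∈ A.poles) : A.N.eval p ≠ 0 := by
  rw [A.eval_N hp]
  exact mul_ne_zero (A.weight_pos p hp).ne' (pow_ne_zero _ (A.eval_derivative_Q_ne_zero hp))

lemma eval_map_ofReal (f : ℝ[X]) (t : ℝ) :
    (f.map (algebraMap ℝ ℂ)).eval (t : ℂ) = ((f.eval t : ℝ) : ℂ) :=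
  eval_map_apply (algebraMap ℝ ℂ) t

lemma n_ne_zero : (A.n : ℂ) ≠ 0 := Complex.ofReal_ne_zero.2 A.n_pos.ne'

lemma eval_Qc (t : ℂ) : A.Qc.eval t = ∏ p ∈ A.poles, (t - p) := by
  simp [Qc, Q, Polynomial.map_prod, eval_prod]

lemma eval_Pc (t : ℂ) : A.Pc.eval t = (t + A.c) * A.Qc.eval t - A.Ec.eval t := by
  simp [Pc, P, Qc, Ec]

lemma Nc_eq : A.Nc = derivative A.Pc * A.Qc - A.Pc * derivative A.Qc := by
  simp [Nc, N, Pc, Qc, derivative_map]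

lemma exists_pole {t : ℂ} (h : A.Qc.eval t = 0) : ∃ p ∈ A.poles, t = p := by
  rw [eval_Qc, Finset.prod_eq_zero_iff] at h
  obtain ⟨p, hp, h⟩ := h
  exact ⟨p, hp, sub_eq_zero.1 h⟩

@[simp] lemma graphCurve_apply (t : ℂ) : curvePoint A.graphCurve t =
    ![(A.n : ℂ) * A.Qc.eval t, A.Pc.eval t, -(t * A.Qc.eval t)] := by
  funext i; fin_cases i <;> simp [curvePoint, graphCurve]

@[simp] lemma envelope_apply (t : ℂ) : curvePoint A.envelope t =
    ![t * A.Nc.eval t - A.Pc.eval t * A.Qc.eval t, (A.n : ℂ) * A.Qc.eval t ^ 2,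
      (A.n : ℂ) * A.Nc.eval t] := by
  funext i; fin_cases i <;> simp [curvePoint, envelope]

/-- The first coordinate vanishes only at the poles, and there the numerator does not: this uses the
nonzero weights. The same happens for the envelope with `N` in place of `P`. -/
lemma graphCurve_ne_zero (t : ℂ) : curvePoint A.graphCurve t ≠ 0 := by
  intro h
  rw [graphCurve_apply] at h
  have h0 : (A.n : ℂ) * A.Qc.eval t = 0 := congrFun h 0
  have h1 : A.Pc.eval t = 0 := congrFun h 1
  obtain ⟨p, hp, rfl⟩ := A.exists_pole ((mul_eq_zero.1 h0).resolve_left A.n_ne_zero)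
  rw [Pc, eval_map_ofReal, A.eval_P hp, Complex.ofReal_eq_zero, neg_eq_zero] at h1
  exact A.eval_E_ne_zero hp h1

lemma envelope_ne_zero (t : ℂ) : curvePoint A.envelope t ≠ 0 := by
  intro h
  rw [envelope_apply] at h
  have h1 : (A.n : ℂ) * A.Qc.eval t ^ 2 = 0 := congrFun h 1
  have h2 : (A.n : ℂ) * A.Nc.eval t = 0 := congrFun h 2
  obtain ⟨p, hp, rfl⟩ := A.exists_pole
    (pow_eq_zero_iff two_ne_zero |>.1 ((mul_eq_zero.1 h1).resolve_left A.n_ne_zero))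
  have := (mul_eq_zero.1 h2).resolve_left A.n_ne_zero
  rw [Nc, eval_map_ofReal, Complex.ofReal_eq_zero] at this
  exact A.eval_N_ne_zero hp this

lemma tangentPair_graphCurve : TangentPair A.graphCurve A.envelope := by
  refine TangentPair.of_cross one_ne_zero A.graphCurve_ne_zero A.envelope_ne_zero ?_
  rw [one_smul, cross_apply]
  funext i
  fin_cases i <;> simp [graphCurve, envelope, Nc_eq] <;> ring

/-- The cross product of the envelope with its derivative is the graph times `n (Q N' - 2 N Q')`,
which at a pole equals `-2 n N Q' ≠ 0`. Without poles the envelope is a single point, this factor is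
zero, and the case needs separate treatment. -/
lemma tangentPair_envelope (h : A.poles.Nonempty) : TangentPair A.envelope A.graphCurve := by
  have hδ : C (A.n : ℂ) * (A.Qc * derivative A.Nc - 2 * A.Nc * derivative A.Qc) ≠ 0 := by
    intro h0
    obtain ⟨p, hp⟩ := h
    have h1 := congrArg (eval (p : ℂ)) h0
    simp only [eval_mul, eval_C, eval_sub, eval_ofNat, eval_zero] at h1
    have hQ : A.Qc.eval (p : ℂ) = 0 := by rw [Qc, eval_map_ofReal, A.eval_Q hp]; simp
    have hN : A.Nc.eval (p : ℂ) ≠ 0 := by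
      rw [Nc, eval_map_ofReal, Complex.ofReal_ne_zero]; exact A.eval_N_ne_zero hp
    have hQ' : (derivative A.Qc).eval (p : ℂ) ≠ 0 := by
      rw [Qc, derivative_map, eval_map_ofReal, Complex.ofReal_ne_zero]
      exact A.eval_derivative_Q_ne_zero hp
    rw [hQ] at h1
    simp [A.n_pos.ne', hN, hQ'] at h1
  refine TangentPair.of_cross hδ A.envelope_ne_zero A.graphCurve_ne_zero ?_
  rw [cross_apply]
  funext i
  fin_cases i <;> simp [graphCurve, envelope, Nc_eq, sq] <;> ring

/-! The equation of the graph. -/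

open MvPolynomial (IsHomogeneous)

/-- The linear form `-n z - p x`. -/
def linearFactor (p : ℝ) : MvPolynomial (Fin 3) ℝ :=
  -(MvPolynomial.C A.n * MvPolynomial.X 2) - MvPolynomial.C p * MvPolynomial.X 0

/-- The homogenization of the denominator. -/
def Qh : MvPolynomial (Fin 3) ℝ := ∏ p ∈ A.poles, A.linearFactor p

/-- The homogenization of the polar numerator. -/
def Eh : MvPolynomial (Fin 3) ℝ :=
  ∑ p ∈ A.poles, MvPolynomial.C (A.weight p) * ∏ q ∈ A.poles.erase p, A.linearFactor q

/-- The equation of the graph. -/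
def F : MvPolynomial (Fin 3) ℝ :=
  (MvPolynomial.C A.n * MvPolynomial.X 1 + MvPolynomial.C A.n * MvPolynomial.X 2 -
    MvPolynomial.C A.c * MvPolynomial.X 0) * A.Qh + MvPolynomial.X 0 ^ 2 * A.Eh

/-- The equation of the graph as a complex form. -/
def Fc : Form3 := MvPolynomial.map (algebraMap ℝ ℂ) A.F

lemma isHomogeneous_C_mul_X (a : ℝ) (i : Fin 3) :
    IsHomogeneous (MvPolynomial.C a * MvPolynomial.X i : MvPolynomial (Fin 3) ℝ) 1 :=
  (MvPolynomial.isHomogeneous_X ℝ i).C_mul a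

lemma isHomogeneous_linearFactor (p : ℝ) : (A.linearFactor p).IsHomogeneous 1 :=
  (isHomogeneous_C_mul_X _ _).neg.sub (isHomogeneous_C_mul_X _ _)

lemma isHomogeneous_prod_linearFactor (Z : Finset ℝ) :
    (∏ p ∈ Z, A.linearFactor p).IsHomogeneous Z.card := by
  have := IsHomogeneous.prod Z A.linearFactor (fun _ => 1)
    fun p _ => A.isHomogeneous_linearFactor p
  simpa using this

lemma isHomogeneous_F : A.F.IsHomogeneous (A.poles.card + 1) := by
  refine IsHomogeneous.add ?_ ?_
  · rw [add_comm A.poles.card 1]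
    exact (((isHomogeneous_C_mul_X _ _).add (isHomogeneous_C_mul_X _ _)).sub
      (isHomogeneous_C_mul_X _ _)).mul (A.isHomogeneous_prod_linearFactor _)
  · rw [Eh, Finset.mul_sum]
    refine IsHomogeneous.sum _ _ _ fun p hp => ?_
    have : A.poles.card + 1 = 1 * 2 + (A.poles.erase p).card := by
      rw [Finset.card_erase_of_mem hp]
      have := Finset.card_pos.2 ⟨p, hp⟩
      omega
    rw [this]
    exact ((MvPolynomial.isHomogeneous_X ℝ 0).pow 2).mul
      ((A.isHomogeneous_prod_linearFactor _).C_mul _)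

section Values

variable {K : Type*} [Field K] [Algebra ℝ K]

/-- The value of the equation of the graph at a point of the ray with parameter `t`. -/
lemma aeval_F {v : Fin 3 → K} {t : K} (h : algebraMap ℝ K A.n * v 2 = -(v 0 * t)) :
    MvPolynomial.aeval v A.F = v 0 ^ A.poles.card *
      ((algebraMap ℝ K A.n * v 1 - v 0 * t - algebraMap ℝ K A.c * v 0) * aeval t A.Q +
        v 0 * aeval t A.E) := by
  have hl : ∀ p : ℝ, MvPolynomial.aeval v (A.linearFactor p) = v 0 * (t - algebraMap ℝ K p) := by
    intro p
    simp [linearFactor, h]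
    ring
  have hprod : ∀ Z : Finset ℝ, MvPolynomial.aeval v (∏ p ∈ Z, A.linearFactor p) =
      v 0 ^ Z.card * ∏ p ∈ Z, (t - algebraMap ℝ K p) := by
    intro Z
    rw [map_prod, Finset.prod_congr rfl fun p _ => hl p, Finset.prod_mul_distrib, Finset.prod_const]
  have hQ : aeval t A.Q = ∏ p ∈ A.poles, (t - algebraMap ℝ K p) := by
    simp [Q, map_prod]
  have hE : v 0 ^ 2 * MvPolynomial.aeval v A.Eh = v 0 ^ A.poles.card * (v 0 * aeval t A.E) := by
    rw [Eh, E, map_sum, map_sum, Finset.mul_sum, Finset.mul_sum, Finset.mul_sum]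
    refine Finset.sum_congr rfl fun p hp => ?_
    rw [map_mul, hprod, Finset.card_erase_of_mem hp]
    obtain ⟨m, hm⟩ : ∃ m, A.poles.card = m + 1 :=
      ⟨A.poles.card - 1, by have := Finset.card_pos.2 ⟨p, hp⟩; omega⟩
    rw [hm]
    simp only [MvPolynomial.aeval_C, map_mul, aeval_C, map_prod, map_sub, aeval_X,
      Nat.add_sub_cancel]
    ring
  rw [F, map_add, map_mul, map_mul, map_pow, MvPolynomial.aeval_X, hE, Qh, hprod, hQ]
  simp only [map_sub, map_add, map_mul, MvPolynomial.aeval_C, MvPolynomial.aeval_X, h]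
  ring

end Values

lemma eval_Fc (v : Fin 3 → ℂ) : MvPolynomial.eval v A.Fc = MvPolynomial.aeval v A.F := by
  rw [Fc, MvPolynomial.eval_map, MvPolynomial.aeval_def]

lemma aeval_Q_complex (t : ℂ) : aeval t A.Q = A.Qc.eval t := by
  rw [Qc, eval_map, aeval_def]

lemma aeval_E_complex (t : ℂ) : aeval t A.E = A.Ec.eval t := by
  rw [Ec, eval_map, aeval_def]

lemma isHomogeneous_Fc : A.Fc.IsHomogeneous (A.poles.card + 1) :=
  A.isHomogeneous_F.map _

lemma eval_Fc_graphCurve (t : ℂ) : MvPolynomial.eval (curvePoint A.graphCurve t) A.Fc = 0 := by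
  rw [eval_Fc, A.aeval_F (t := t) (by simp; ring), aeval_Q_complex, aeval_E_complex]
  simp only [graphCurve_apply, Matrix.cons_val_zero, Matrix.cons_val_one, Complex.coe_algebraMap,
    eval_Pc]
  ring

lemma aeval_graphCurve_Fc : MvPolynomial.aeval A.graphCurve A.Fc = 0 :=
  aeval_curve_eq_zero_iff.2 A.eval_Fc_graphCurve

/-! Irreducibility of the equation. -/

/-- The linear factors as complex forms. -/
def linearFactorC (p : ℝ) : Form3 :=
  -(MvPolynomial.C (A.n : ℂ) * MvPolynomial.X 2) - MvPolynomial.C (p : ℂ) * MvPolynomial.X 0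

lemma linearFactorC_mem (p : ℝ) : A.linearFactorC p ∈ MvPolynomial.supported ℂ ({0, 2} : Set (Fin 3)) := by
  refine sub_mem (neg_mem (mul_mem (Subalgebra.algebraMap_mem _ _) ?_))
    (mul_mem (Subalgebra.algebraMap_mem _ _) ?_) <;>
  · rw [MvPolynomial.X_mem_supported]; simp

lemma notMem_vars_of_mem_supported {f : Form3}
    (hf : f ∈ MvPolynomial.supported ℂ ({0, 2} : Set (Fin 3))) : (1 : Fin 3) ∉ f.vars := by
  intro h
  have := MvPolynomial.mem_supported.1 hf h
  simp at this

lemma irreducible_linearFactorC (p : ℝ) : Irreducible (A.linearFactorC p) := by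
  have : A.linearFactorC p = MvPolynomial.C (-(A.n : ℂ)) * MvPolynomial.X 2 +
      -(MvPolynomial.C (p : ℂ) * MvPolynomial.X 0) := by
    rw [linearFactorC, MvPolynomial.C_neg]; ring
  rw [this]
  have hu : IsUnit (MvPolynomial.C (-(A.n : ℂ)) : Form3) :=
    (IsUnit.mk0 _ (neg_ne_zero.2 A.n_ne_zero)).map MvPolynomial.C
  refine MvPolynomial.irreducible_mul_X_add _ _ _ hu.ne_zero (by simp) ?_ ?_
  · intro h
    have hmem : -(MvPolynomial.C (p : ℂ) * MvPolynomial.X 0 : Form3) ∈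
        MvPolynomial.supported ℂ ({0} : Set (Fin 3)) :=
      neg_mem (mul_mem (Subalgebra.algebraMap_mem _ _) (MvPolynomial.X_mem_supported.2 rfl))
    have := MvPolynomial.mem_supported.1 hmem h
    simp at this
  · exact hu.isRelPrime_left

/-- The coefficient of the second variable in the equation. -/
def slopeCoeff : Form3 := MvPolynomial.C (A.n : ℂ) * ∏ p ∈ A.poles, A.linearFactorC p

/-- The part of the equation without the second variable. -/
def constantPart : Form3 :=
  (MvPolynomial.C (A.n : ℂ) * MvPolynomial.X 2 - MvPolynomial.C (A.c : ℂ) * MvPolynomial.X 0) *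
    ∏ p ∈ A.poles, A.linearFactorC p +
  MvPolynomial.X 0 ^ 2 * ∑ p ∈ A.poles,
    MvPolynomial.C (A.weight p : ℂ) * ∏ q ∈ A.poles.erase p, A.linearFactorC q

lemma Fc_eq : A.Fc = A.slopeCoeff * MvPolynomial.X 1 + A.constantPart := by
  simp only [Fc, F, Qh, Eh, linearFactor, slopeCoeff, constantPart, linearFactorC, map_add, map_mul,
    map_sub, map_prod, map_sum, map_neg, map_pow, MvPolynomial.map_C, MvPolynomial.map_X,
    Complex.coe_algebraMap]
  ring

/-- The factors of the slope coefficient belong to the poles, and at a pole the remaining part is a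
nonzero multiple of `E(p)`. -/
lemma isRelPrime_slopeCoeff_constantPart : IsRelPrime A.slopeCoeff A.constantPart := by
  have hu : IsUnit (MvPolynomial.C (A.n : ℂ) : Form3) :=
    (IsUnit.mk0 _ A.n_ne_zero).map MvPolynomial.C
  refine IsRelPrime.mul_left hu.isRelPrime_left (IsRelPrime.prod_left fun p hp => ?_)
  refine (A.irreducible_linearFactorC p).isRelPrime_iff_not_dvd.2 ?_
  rintro ⟨g, hg⟩
  -- The zero of the linear factor of `p` with second coordinate 0.
  let v : Fin 3 → ℂ := ![(A.n : ℂ), 0, -(p : ℂ)]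
  have h1 : MvPolynomial.eval v A.constantPart = 0 := by
    rw [hg, map_mul]
    have : MvPolynomial.eval v (A.linearFactorC p) = 0 := by
      simp [linearFactorC, v]; ring
    rw [this, zero_mul]
  have h2 : MvPolynomial.eval v A.Fc = 0 := by
    rw [Fc_eq, map_add, map_mul, h1]
    simp [v]
  rw [eval_Fc, A.aeval_F (t := (p : ℂ)) (by simp [v]), aeval_Q_complex, aeval_E_complex, Qc, Ec,
    eval_map_ofReal, eval_map_ofReal, A.eval_Q hp] at h2
  simp [v, A.n_pos.ne', A.eval_E_ne_zero hp] at h2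

/-- The equation has degree one in the second variable and its two coefficients are coprime. -/
lemma irreducible_Fc : Irreducible A.Fc := by
  rw [Fc_eq]
  have hprod : ∀ Z : Finset ℝ, ∏ p ∈ Z, A.linearFactorC p ∈
      MvPolynomial.supported ℂ ({0, 2} : Set (Fin 3)) :=
    fun Z => prod_mem fun p _ => A.linearFactorC_mem p
  have h0 : (MvPolynomial.X 0 : Form3) ∈ MvPolynomial.supported ℂ ({0, 2} : Set (Fin 3)) :=
    MvPolynomial.X_mem_supported.2 (by simp)
  have h2 : (MvPolynomial.X 2 : Form3) ∈ MvPolynomial.supported ℂ ({0, 2} : Set (Fin 3)) :=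
    MvPolynomial.X_mem_supported.2 (by simp)
  have hC : ∀ a : ℂ, (MvPolynomial.C a : Form3) ∈ MvPolynomial.supported ℂ ({0, 2} : Set (Fin 3)) :=
    fun a => Subalgebra.algebraMap_mem _ a
  refine MvPolynomial.irreducible_mul_X_add _ _ _ ?_ ?_ ?_ A.isRelPrime_slopeCoeff_constantPart
  · refine mul_ne_zero ?_ (Finset.prod_ne_zero_iff.2 fun p _ => (A.irreducible_linearFactorC p).ne_zero)
    exact MvPolynomial.C_ne_zero.2 A.n_ne_zero
  · exact notMem_vars_of_mem_supported (mul_mem (hC _) (hprod _))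
  · exact notMem_vars_of_mem_supported (add_mem
      (mul_mem (sub_mem (mul_mem (hC _) h2) (mul_mem (hC _) h0)) (hprod _))
      (mul_mem (pow_mem h0 2) (sum_mem fun p _ => mul_mem (hC _) (hprod _))))

end PickData

end

/-! ### Behaviour at `t = ∞`, and the graph as a zero locus. -/

noncomputable section

namespace PickData

open Polynomial Filter Topology

variable (A : PickData)

/-- The rational function described by the data. -/
def value (t : ℝ) : ℝ := t + A.c + ∑ p ∈ A.poles, A.weight p / (p - t)

/-- The derivative of the rational function described by the data. -/
def slope (t : ℝ) : ℝ := 1 + ∑ p ∈ A.poles, A.weight p / (p - t) ^ 2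

lemma one_le_slope (t : ℝ) : 1 ≤ A.slope t :=
  le_add_of_nonneg_right (Finset.sum_nonneg fun p hp =>
    div_nonneg (A.weight_pos p hp).le (sq_nonneg _))

lemma eval_P_eq {t : ℝ} (ht : t ∉ A.poles) : A.P.eval t = A.value t * A.Q.eval t := by
  have hE : A.E.eval t = -(∑ p ∈ A.poles, A.weight p / (p - t)) * A.Q.eval t := by
    rw [E, Q, eval_finsetSum, eval_prod, ← Finset.sum_neg_distrib, Finset.sum_mul]
    refine Finset.sum_congr rfl fun p hp => ?_
    have hne : t - p ≠ 0 := sub_ne_zero.2 fun e => ht (e ▸ hp)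
    have hne' : p - t ≠ 0 := sub_ne_zero.2 fun e => ht (e ▸ hp)
    rw [← Finset.mul_prod_erase _ _ hp]
    simp only [eval_mul, eval_C, eval_prod, eval_sub, eval_X]
    field_simp
    ring
  rw [P, eval_sub, eval_mul, hE, value]
  simp only [eval_add, eval_X, eval_C]
  ring

lemma hasDerivAt_value {t : ℝ} (ht : t ∉ A.poles) : HasDerivAt A.value (A.slope t) t := by
  have h : ∀ p ∈ A.poles, HasDerivAt (fun s => A.weight p / (p - s))
      (A.weight p / (p - t) ^ 2) t := by
    intro p hp
    have hne : p - t ≠ 0 := sub_ne_zero.2 fun e => ht (e ▸ hp)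
    have := (hasDerivAt_const t (A.weight p)).div ((hasDerivAt_id t).const_sub p) hne
    convert! this using 1
    simp
  exact ((hasDerivAt_id t).add_const A.c).add (HasDerivAt.fun_sum h)

lemma eventually_notMem_poles {t : ℝ} (ht : t ∉ A.poles) : ∀ᶠ s in 𝓝 t, s ∉ A.poles :=
  (A.poles.finite_toSet.isClosed.isOpen_compl).mem_nhds (by simpa using ht)

lemma eval_N_eq {t : ℝ} (ht : t ∉ A.poles) : A.N.eval t = A.slope t * A.Q.eval t ^ 2 := by
  have hQ := A.eval_Q_ne_zero ht
  have h1 : HasDerivAt (fun s => A.P.eval s / A.Q.eval s) (A.N.eval t / A.Q.eval t ^ 2) t := by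
    have := (A.P.hasDerivAt t).div (A.Q.hasDerivAt t) hQ
    convert! this using 1
    simp [N]
  have h2 : A.value =ᶠ[𝓝 t] fun s => A.P.eval s / A.Q.eval s := by
    filter_upwards [A.eventually_notMem_poles ht] with s hs
    rw [A.eval_P_eq hs, mul_div_cancel_right₀ _ (A.eval_Q_ne_zero hs)]
  have := (A.hasDerivAt_value ht).unique (h1.congr_of_eventuallyEq h2)
  rw [this]
  field_simp

/-- The point of the graph at infinity. -/
def graphInfinity : Fin 3 → ℂ := ![0, 1, -1]

/-- The point of the envelope at infinity. -/
def envelopeInfinity : Fin 3 → ℂ := ![-(A.c : ℂ), A.n, A.n]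

lemma tendsto_inv_sub (p : ℝ) : Tendsto (fun t : ℝ => (p - t)⁻¹) atTop (𝓝 0) :=
  tendsto_inv_atBot_zero.comp (tendsto_atBot_add_const_left _ p tendsto_neg_atTop_atBot)

lemma tendsto_value_div : Tendsto (fun t : ℝ => A.value t * t⁻¹) atTop (𝓝 1) := by
  have h1 : Tendsto (fun t : ℝ => 1 + (A.c + ∑ p ∈ A.poles, A.weight p * (p - t)⁻¹) * t⁻¹) atTop
      (𝓝 (1 + (A.c + ∑ p ∈ A.poles, A.weight p * 0) * 0)) :=
    tendsto_const_nhds.add ((tendsto_const_nhds.add (tendsto_finsetSum _ fun p _ =>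
      (tendsto_inv_sub p).const_mul _)).mul tendsto_inv_atTop_zero)
  simp only [mul_zero, add_zero] at h1
  refine h1.congr' ?_
  filter_upwards [eventually_gt_atTop 0] with t ht
  simp only [value, div_eq_mul_inv]
  field_simp
  ring

lemma tendsto_slope : Tendsto A.slope atTop (𝓝 1) := by
  have h1 : Tendsto (fun t : ℝ => 1 + ∑ p ∈ A.poles, A.weight p * ((p - t)⁻¹ * (p - t)⁻¹)) atTop
      (𝓝 (1 + ∑ p ∈ A.poles, A.weight p * (0 * 0))) :=
    tendsto_const_nhds.add (tendsto_finsetSum _ fun p _ =>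
      ((tendsto_inv_sub p).mul (tendsto_inv_sub p)).const_mul _)
  simp only [mul_zero, Finset.sum_const_zero, add_zero] at h1
  refine h1.congr fun t => ?_
  simp only [slope, div_eq_mul_inv, ← mul_inv, sq]

lemma eventually_notMem_poles_atTop : ∀ᶠ t : ℝ in atTop, t ∉ A.poles := by
  obtain ⟨M, hM⟩ := A.poles.bddAbove
  filter_upwards [eventually_gt_atTop M] with t ht hmem
  exact absurd (hM hmem) (not_le.2 ht)

/-- The terms linear in `t` cancel, so the first coordinate of the envelope has a finite limit; this
is what makes the tangency with `κ = 1` an affine point. -/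
lemma tendsto_intercept : Tendsto (fun t : ℝ => t * A.slope t - A.value t) atTop (𝓝 (-A.c)) := by
  have h1 : Tendsto (fun t : ℝ => -A.c + ∑ p ∈ A.poles, A.weight p *
        (p * ((p - t)⁻¹ * (p - t)⁻¹) - 2 * (p - t)⁻¹)) atTop
      (𝓝 (-A.c + ∑ p ∈ A.poles, A.weight p * (p * (0 * 0) - 2 * 0))) :=
    tendsto_const_nhds.add (tendsto_finsetSum _ fun p _ =>
      ((((tendsto_inv_sub p).mul (tendsto_inv_sub p)).const_mul _).sub
        ((tendsto_inv_sub p).const_mul _)).const_mul _)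
  simp only [mul_zero, sub_zero, Finset.sum_const_zero, add_zero] at h1
  refine h1.congr' ?_
  filter_upwards [A.eventually_notMem_poles_atTop] with t ht
  have : ∑ p ∈ A.poles, A.weight p * (p * ((p - t)⁻¹ * (p - t)⁻¹) - 2 * (p - t)⁻¹) =
      t * ∑ p ∈ A.poles, A.weight p / (p - t) ^ 2 - ∑ p ∈ A.poles, A.weight p / (p - t) := by
    rw [Finset.mul_sum, ← Finset.sum_sub_distrib]
    refine Finset.sum_congr rfl fun p hp => ?_
    have hne : p - t ≠ 0 := sub_ne_zero.2 fun e => ht (e ▸ hp)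
    field_simp
    ring
  rw [this, slope, value]
  ring

lemma curvePoint_graphCurve_eq {t : ℝ} (ht : t ∉ A.poles) (ht0 : t ≠ 0) :
    curvePoint A.graphCurve t = ((t * A.Q.eval t : ℝ) : ℂ) •
      ![((A.n * t⁻¹ : ℝ) : ℂ), ((A.value t * t⁻¹ : ℝ) : ℂ), -1] := by
  rw [graphCurve_apply, Qc, Pc, eval_map_ofReal, eval_map_ofReal, A.eval_P_eq ht]
  have : (t : ℂ) ≠ 0 := Complex.ofReal_ne_zero.2 ht0
  funext i
  fin_cases i <;> simp <;> field_simp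

lemma curvePoint_envelope_eq {t : ℝ} (ht : t ∉ A.poles) :
    curvePoint A.envelope t = ((A.Q.eval t ^ 2 : ℝ) : ℂ) •
      ![((t * A.slope t - A.value t : ℝ) : ℂ), (A.n : ℂ), ((A.n * A.slope t : ℝ) : ℂ)] := by
  rw [envelope_apply, Qc, Pc, Nc, eval_map_ofReal, eval_map_ofReal, eval_map_ofReal,
    A.eval_P_eq ht, A.eval_N_eq ht]
  funext i
  fin_cases i <;> simp <;> ring

/-- The parametrizations miss the parameter `∞`. After division by `Q²` and `t Q` the pair converges
for real `t → ∞`, and closed conditions pass to the limit. -/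
lemma eval_infinity {k l : ℕ} {H : MvPolynomial (Fin 3 ⊕ Fin 3) ℂ} (hH : IsBihomogeneous H k l)
    (h0 : ∀ t, MvPolynomial.eval (Sum.elim (curvePoint A.envelope t) (curvePoint A.graphCurve t)) H
      = 0) : MvPolynomial.eval (Sum.elim A.envelopeInfinity graphInfinity) H = 0 := by
  have hlim : Tendsto (fun t : ℝ => Sum.elim
      ![((t * A.slope t - A.value t : ℝ) : ℂ), (A.n : ℂ), ((A.n * A.slope t : ℝ) : ℂ)]
      ![((A.n * t⁻¹ : ℝ) : ℂ), ((A.value t * t⁻¹ : ℝ) : ℂ), -1]) atTop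
      (𝓝 (Sum.elim A.envelopeInfinity graphInfinity)) := by
    have hR : ∀ {f : ℝ → ℝ} {a : ℝ}, Tendsto f atTop (𝓝 a) →
        Tendsto (fun t => ((f t : ℝ) : ℂ)) atTop (𝓝 (a : ℂ)) := fun h =>
      (Complex.continuous_ofReal.tendsto _).comp h
    rw [tendsto_pi_nhds]
    rintro (i | i) <;> fin_cases i
    · simpa [envelopeInfinity] using hR A.tendsto_intercept
    · simp [envelopeInfinity]
    · simpa [envelopeInfinity] using hR (A.tendsto_slope.const_mul A.n)
    · simpa [graphInfinity] using hR (tendsto_inv_atTop_zero.const_mul A.n)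
    · simpa [graphInfinity] using hR A.tendsto_value_div
    · simp [graphInfinity]
  have hcont := ((MvPolynomial.continuous_eval H).tendsto _).comp hlim
  refine tendsto_nhds_unique hcont (tendsto_const_nhds.congr' ?_)
  filter_upwards [A.eventually_notMem_poles_atTop, eventually_gt_atTop 0] with t ht ht0
  have := h0 t
  rw [A.curvePoint_envelope_eq ht, A.curvePoint_graphCurve_eq ht ht0.ne', hH.eval_smul] at this
  have hQ := A.eval_Q_ne_zero ht
  have hne : (((A.Q.eval t ^ 2 : ℝ) : ℂ) ^ k * ((t * A.Q.eval t : ℝ) : ℂ) ^ l) ≠ 0 := by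
    refine mul_ne_zero (pow_ne_zero _ ?_) (pow_ne_zero _ ?_) <;>
      rw [Complex.ofReal_ne_zero]
    · exact pow_ne_zero _ hQ
    · exact mul_ne_zero ht0.ne' hQ
  exact ((mul_eq_zero.1 this).resolve_left hne).symm

lemma graphInfinity_ne_zero : graphInfinity ≠ 0 := fun h => one_ne_zero (congrFun h 1)

lemma envelopeInfinity_ne_zero : A.envelopeInfinity ≠ 0 := fun h => A.n_ne_zero (congrFun h 1)

lemma mk_graphInfinity_mem :
    Projectivization.mk ℂ graphInfinity graphInfinity_ne_zero ∈ paramClosure A.graphCurve := by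
  intro k G hG h0
  rw [eval_rep_mk hG]
  have := A.eval_infinity (isBihomogeneous_rename_inr hG) fun t => by
    rw [MvPolynomial.eval_rename, Sum.elim_comp_inr]
    exact aeval_curve_eq_zero_iff.1 h0 t
  rwa [MvPolynomial.eval_rename, Sum.elim_comp_inr] at this

lemma mem_paramClosure_of_isParallel {α : Fin 3 → ℂ[X]} {t : ℂ} (h : curvePoint α t ≠ 0)
    {q : PPlane} (hq : IsParallel q.rep (curvePoint α t)) : q ∈ paramClosure α :=
  eq_mk_of_isParallel h hq ▸ mk_curvePoint_mem h

lemma eval_Fc_infinity {v : Fin 3 → ℂ} (hv : v 0 = 0) : MvPolynomial.eval v A.Fc =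
    (A.n * v 1 + A.n * v 2) * (-(A.n * v 2)) ^ A.poles.card := by
  rw [eval_Fc]
  simp [F, Qh, Eh, linearFactor, hv]

/-- The curve with the equation `F` is the closure of the graph. -/
lemma zeroLocus_Fc : zeroLocus A.Fc = paramClosure A.graphCurve := by
  ext q
  constructor
  · intro hq
    have hq0 : MvPolynomial.eval q.rep A.Fc = 0 := hq
    by_cases hx : q.rep 0 = 0
    -- On the line `x = 0` the equation becomes `n (y + z) (-n z)^#poles`, so only `[0 : 1 : -1]`
    -- (the parameter `∞`) and, if there is a pole, `[0 : 1 : 0]` remain.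
    · rw [A.eval_Fc_infinity hx, mul_eq_zero] at hq0
      rcases hq0 with h | h
      · have h' : q.rep 1 + q.rep 2 = 0 := by
          have : (A.n : ℂ) * (q.rep 1 + q.rep 2) = 0 := by linear_combination h
          exact (mul_eq_zero.1 this).resolve_left A.n_ne_zero
        have hpar : IsParallel q.rep graphInfinity := by
          intro i j
          fin_cases i <;> fin_cases j <;> simp [graphInfinity, hx] <;>
            first | linear_combination h' | linear_combination -h'
        rw [eq_mk_of_isParallel graphInfinity_ne_zero hpar]
        exact A.mk_graphInfinity_mem
      · obtain ⟨h, hc⟩ := pow_eq_zero_iff'.1 h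
        obtain ⟨p, hp⟩ := Finset.card_pos.1 (Nat.pos_of_ne_zero hc)
        have hz : q.rep 2 = 0 := (mul_eq_zero.1 (neg_eq_zero.1 h)).resolve_left A.n_ne_zero
        refine mem_paramClosure_of_isParallel (A.graphCurve_ne_zero p) ?_
        have hQ : A.Qc.eval (p : ℂ) = 0 := by rw [Qc, eval_map_ofReal, A.eval_Q hp]; simp
        intro i j
        fin_cases i <;> fin_cases j <;> simp [hx, hz, hQ]
    -- Off the line `x = 0` the parameter is recovered from `[n : J(t) : -t]`.
    · set t : ℂ := -(A.n * q.rep 2) / q.rep 0 with ht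
      have hzt : (A.n : ℂ) * q.rep 2 = -(q.rep 0 * t) := by rw [ht]; field_simp
      rw [eval_Fc, A.aeval_F (t := t) (by simpa using hzt), aeval_Q_complex, aeval_E_complex,
        mul_eq_zero] at hq0
      have h1 := hq0.resolve_left (pow_ne_zero _ hx)
      simp only [Complex.coe_algebraMap] at h1
      have h2 : (A.n : ℂ) * q.rep 1 * A.Qc.eval t = q.rep 0 * A.Pc.eval t := by
        rw [eval_Pc]; linear_combination h1
      have h3 : q.rep 1 * (t * A.Qc.eval t) = -(q.rep 2 * A.Pc.eval t) := by
        refine mul_left_cancel₀ (mul_ne_zero A.n_ne_zero hx) ?_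
        linear_combination t * q.rep 0 * h2 + q.rep 0 * A.Pc.eval t * hzt
      refine mem_paramClosure_of_isParallel (A.graphCurve_ne_zero t) ?_
      intro i j
      fin_cases i <;> fin_cases j <;> simp
      · linear_combination -h2
      · linear_combination -A.Qc.eval t * hzt
      · linear_combination h2
      · linear_combination -h3
      · linear_combination A.Qc.eval t * hzt
      · linear_combination h3
  · intro hq
    exact hq _ _ A.isHomogeneous_Fc A.aeval_graphCurve_Fc

lemma isEquationOf_F : IsEquationOf A.F (A.poles.card + 1) (paramClosure A.graphCurve) :=
  ⟨A.isHomogeneous_F, A.irreducible_Fc, A.zeroLocus_Fc.symm⟩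

end PickData

end

/-! ### Intersections with real lines: the graph is winding. -/

noncomputable section

section Restriction

open Polynomial

lemma eval_restrictToLine (F : MvPolynomial (Fin 3) ℝ) (u v : Fin 3 → ℝ) (s : ℝ) :
    (restrictToLine F u v).eval s = MvPolynomial.eval (u + s • v) F := by
  have : (evalRingHom s).comp (MvPolynomial.aeval (fun j => C (u j) + C (v j) * X) :
      MvPolynomial (Fin 3) ℝ →ₐ[ℝ] ℝ[X]).toRingHom = MvPolynomial.eval (u + s • v) := by
    ext i
    · simp
    · simp only [RingHom.comp_apply, AlgHom.toRingHom_eq_coe, RingHom.coe_coe, MvPolynomial.aeval_X,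
        coe_evalRingHom, eval_add, eval_C, eval_mul, eval_X, MvPolynomial.eval_X, Pi.add_apply,
        Pi.smul_apply, smul_eq_mul, mul_comm]
  exact RingHom.congr_fun this F

lemma natDegree_C_add_C_mul_X_le (a b : ℝ) : (C a + C b * X : ℝ[X]).natDegree ≤ 1 := by
  rw [add_comm]; exact Polynomial.natDegree_linear_le

/-- The coefficient at the formal degree `d` is the value at `v`, the point `s = ∞`; hence the
degree drops exactly when `v` lies on the curve. -/
lemma restrictToLine_degree {F : MvPolynomial (Fin 3) ℝ} {d : ℕ} (hF : F.IsHomogeneous d)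
    (u v : Fin 3 → ℝ) : (restrictToLine F u v).natDegree ≤ d ∧
      (restrictToLine F u v).coeff d = MvPolynomial.eval v F := by
  have hdeg : ∀ m : Fin 3 →₀ ℕ, ∀ j, ((C (u j) + C (v j) * X : ℝ[X]) ^ m j).natDegree ≤ m j :=
    fun m j => (natDegree_pow_le_of_le _ (natDegree_C_add_C_mul_X_le _ _)).trans (by simp)
  have hsum : ∀ m ∈ F.support, m 0 + m 1 + m 2 = d := by
    intro m hm
    have := hF (MvPolynomial.mem_support_iff.1 hm)
    rw [Finsupp.weight_apply, Finsupp.sum_fintype _ _ (by simp), Fin.sum_univ_three] at this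
    simpa using this
  have hlead : ∀ a b : ℝ, ∀ k, ((C a + C b * X : ℝ[X]) ^ k).coeff k = b ^ k := by
    intro a b k
    have := coeff_pow_of_natDegree_le (m := k) (natDegree_C_add_C_mul_X_le a b)
    rw [mul_one] at this
    rw [this]
    simp
  rw [restrictToLine, MvPolynomial.aeval_def, MvPolynomial.eval₂_eq', MvPolynomial.eval_eq']
  simp only [Fin.prod_univ_three]
  constructor
  · refine natDegree_sum_le_of_forall_le _ _ fun m hm => ?_
    rw [← hsum m hm]
    refine natDegree_C_mul_le _ _ |>.trans ?_
    exact natDegree_mul_le_of_le (natDegree_mul_le_of_le (hdeg m 0) (hdeg m 1)) (hdeg m 2)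
  · rw [finsetSum_coeff]
    refine Finset.sum_congr rfl fun m hm => ?_
    rw [← hsum m hm, algebraMap_eq, coeff_C_mul,
      coeff_mul_add_eq_of_natDegree_le (natDegree_mul_le_of_le (hdeg m 0) (hdeg m 1)) (hdeg m 2),
      coeff_mul_add_eq_of_natDegree_le (hdeg m 0) (hdeg m 1), hlead, hlead, hlead]

end Restriction

open Polynomial in
/-- A polynomial whose signs at the points of `Z` alternate has at least `Z.card - 1` roots. -/
lemma card_le_card_roots_add_one (Z : Finset ℝ) (h : ℝ[X])
    (hs : ∀ x ∈ Z, 0 < h.eval x * ∏ q ∈ Z.erase x, (x - q)) :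
    Z.card ≤ h.roots.toFinset.card + 1 := by
  refine Finset.card_le_of_interleaved fun x hx y hy hxy hgap => ?_
  have hne : h ≠ 0 := by
    rintro rfl
    simpa using hs x hx
  have hy' : y ∈ Z.erase x := Finset.mem_erase.2 ⟨hxy.ne', hy⟩
  have hx' : x ∈ Z.erase y := Finset.mem_erase.2 ⟨hxy.ne, hx⟩
  -- No point of `Z` lies between `x` and `y`, so every other point is on the same side of both.
  -- Only the factors `x - y` and `y - x` differ in sign, which forces opposite signs of `h`.
  have hpos : 0 < (∏ q ∈ (Z.erase x).erase y, (x - q)) * ∏ q ∈ (Z.erase x).erase y, (y - q) := by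
    rw [← Finset.prod_mul_distrib]
    refine Finset.prod_pos fun q hq => ?_
    simp only [Finset.mem_erase] at hq
    have hg := hgap q hq.2.2
    rw [Set.mem_Ioo, not_and_or, not_lt, not_lt] at hg
    rcases hg with hg | hg
    · have h1 : q < x := lt_of_le_of_ne hg hq.2.1
      exact mul_pos (by linarith) (by linarith)
    · have h1 : y < q := lt_of_le_of_ne hg (Ne.symm hq.1)
      exact mul_pos_of_neg_of_neg (by linarith) (by linarith)
  have h1 := hs x hx
  have h2 := hs y hy
  rw [← Finset.mul_prod_erase _ _ hy'] at h1
  rw [← Finset.mul_prod_erase _ _ hx', Finset.erase_right_comm] at h2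
  have hneg : h.eval x * h.eval y < 0 := by
    have h3 := mul_pos h1 h2
    by_contra hcon
    have hcon' := not_lt.1 hcon
    have : 0 ≤ h.eval x * h.eval y * ((y - x) ^ 2 *
        ((∏ q ∈ (Z.erase x).erase y, (x - q)) * ∏ q ∈ (Z.erase x).erase y, (y - q))) :=
      mul_nonneg hcon' (mul_nonneg (sq_nonneg _) hpos.le)
    nlinarith [this, h3]
  have hcont : ContinuousOn (fun t => h.eval t) (Set.Icc x y) := h.continuous.continuousOn
  obtain ⟨z, hz, hz0⟩ : ∃ z ∈ Set.Ioo x y, h.eval z = 0 := by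
    rcases mul_neg_iff.1 hneg with ⟨ha, hb⟩ | ⟨ha, hb⟩
    · obtain ⟨z, hz, e⟩ := intermediate_value_Ioo' hxy.le hcont ⟨hb, ha⟩
      exact ⟨z, hz, e⟩
    · obtain ⟨z, hz, e⟩ := intermediate_value_Ioo hxy.le hcont ⟨ha, hb⟩
      exact ⟨z, hz, e⟩
  exact ⟨z, by rw [Multiset.mem_toFinset, mem_roots hne]; exact hz0, hz.1, hz.2⟩

namespace PickData

open Polynomial

variable (A : PickData)

lemma eval_F_real {v : Fin 3 → ℝ} {t : ℝ} (h : A.n * v 2 = -(v 0 * t)) :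
    MvPolynomial.eval v A.F = v 0 ^ A.poles.card *
      ((A.n * v 1 - v 0 * t - A.c * v 0) * A.Q.eval t + v 0 * A.E.eval t) := by
  have := A.aeval_F (K := ℝ) (v := v) (t := t) (by simpa using h)
  simpa [MvPolynomial.coe_aeval_eq_eval, coe_aeval_eq_eval] using this

/-- The equation in `t` for the intersection of the graph with a line. -/
def lineEquation (w : Fin 3 → ℝ) : ℝ[X] := C (w 1) * A.P + (C (A.n * w 0) - C (w 2) * X) * A.Q

lemma eval_F_of_lineEquation {w q : Fin 3 → ℝ} {t : ℝ} (hw : w 1 ≠ 0)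
    (ht : (A.lineEquation w).eval t = 0) (hq : w 0 * q 0 + w 1 * q 1 + w 2 * q 2 = 0)
    (hqt : A.n * q 2 = -(q 0 * t)) : MvPolynomial.eval q A.F = 0 := by
  rw [A.eval_F_real hqt]
  refine mul_eq_zero_of_right _ (mul_left_cancel₀ hw ?_)
  simp only [lineEquation, P, eval_add, eval_mul, eval_sub, eval_C, eval_X] at ht
  linear_combination A.n * A.Q.eval t * hq - q 0 * ht - w 2 * A.Q.eval t * hqt

/-- At a pole the line equation equals `-w₁` times a positive weight times `Q'`. The signs of `Q'`
alternate along the simple roots of `Q`, so there is a root between any two neighbouring poles. -/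
lemma card_poles_le (w : Fin 3 → ℝ) (hw : w 1 ≠ 0) :
    A.poles.card ≤ (A.lineEquation w).roots.toFinset.card + 1 := by
  have hval : ∀ x ∈ A.poles, (A.lineEquation w).eval x * ∏ q ∈ A.poles.erase x, (x - q) =
      -(w 1) * (A.weight x * (derivative A.Q).eval x ^ 2) := by
    intro x hx
    rw [← A.eval_derivative_Q hx]
    simp only [lineEquation, eval_add, eval_mul, eval_sub, eval_C, eval_X, A.eval_Q hx,
      A.eval_P hx, A.eval_E hx]
    ring
  have hpos : ∀ x ∈ A.poles, 0 < A.weight x * (derivative A.Q).eval x ^ 2 := fun x hx =>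
    mul_pos (A.weight_pos x hx) (sq_pos_of_ne_zero (A.eval_derivative_Q_ne_zero hx))
  rcases lt_or_gt_of_ne hw with h | h
  · refine card_le_card_roots_add_one _ _ fun x hx => ?_
    rw [hval x hx]
    exact mul_pos (by linarith) (hpos x hx)
  · rw [← roots_neg]
    refine card_le_card_roots_add_one _ _ fun x hx => ?_
    rw [eval_neg, neg_mul, hval x hx]
    have := mul_pos h (hpos x hx)
    linarith

/-- The hypothesis says that the line misses `[0 : 1 : 0]`, so its points correspond to values of
`t`, and the real roots of the line equation become distinct real intersection points, at most one
of them being `v`. -/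
lemma realIntersectionNumber_of_transversal {u v : Fin 3 → ℝ} (hw : u 2 * v 0 - u 0 * v 2 ≠ 0) :
    restrictToLine A.F u v = 0 ∨
      A.poles.card + 1 ≤ realIntersectionNumber A.F (A.poles.card + 1) u v + 2 := by
  classical
  set f := restrictToLine A.F u v with hf
  by_cases hf0 : f = 0
  · exact Or.inl hf0
  right
  rw [realIntersectionNumber, ← hf]
  set w : Fin 3 → ℝ := crossProduct u v with hwdef
  have w0 : w 0 = u 1 * v 2 - u 2 * v 1 := by simp [hwdef, cross_apply]
  have w1 : w 1 = u 2 * v 0 - u 0 * v 2 := by simp [hwdef, cross_apply]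
  have w2 : w 2 = u 0 * v 1 - u 1 * v 0 := by simp [hwdef, cross_apply]
  have hw1 : w 1 ≠ 0 := by rw [w1]; exact hw
  set T := (A.lineEquation w).roots.toFinset with hT
  have hcard := A.card_poles_le w hw1
  rw [← hT] at hcard
  have hroot : ∀ t ∈ T, (A.lineEquation w).eval t = 0 := fun t ht =>
    (mem_roots'.1 (Multiset.mem_toFinset.1 ht)).2
  obtain ⟨hdeg, hlead⟩ := restrictToLine_degree A.isHomogeneous_F u v
  rw [← hf] at hdeg hlead
  let S := T.filter fun t => A.n * v 2 + t * v 0 ≠ 0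
  -- The solution `s` of `n (u₂ + s v₂) = -(u₀ + s v₀) t`, that is, the point of the line with graph
  -- parameter `t`.
  let g : ℝ → ℝ := fun t => -(t * u 0 + A.n * u 2) / (A.n * v 2 + t * v 0)
  have hmaps : ∀ t ∈ S, g t ∈ f.roots.toFinset := by
    intro t ht
    obtain ⟨htT, htv⟩ := Finset.mem_filter.1 ht
    rw [Multiset.mem_toFinset, mem_roots hf0, IsRoot, hf, eval_restrictToLine]
    refine A.eval_F_of_lineEquation hw1 (hroot t htT) ?_ ?_
    · simp only [Pi.add_apply, Pi.smul_apply, smul_eq_mul, w0, w1, w2]; ring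
    · simp only [Pi.add_apply, Pi.smul_apply, smul_eq_mul, g]
      field_simp
      ring
  have hinj : Set.InjOn g S := by
    intro t ht t' ht' e
    have htv := (Finset.mem_filter.1 ht).2
    have htv' := (Finset.mem_filter.1 ht').2
    simp only [g] at e
    rw [div_eq_div_iff htv htv'] at e
    have : (t - t') * (A.n * (u 2 * v 0 - u 0 * v 2)) = 0 := by linear_combination e
    exact sub_eq_zero.1 ((mul_eq_zero.1 this).resolve_right (mul_ne_zero A.n_pos.ne' hw))
  have hS : S.card ≤ f.roots.card :=
    (Finset.card_le_card_of_injOn g hmaps hinj).trans (Multiset.toFinset_card_le _)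
  have hST : T.card = S.card + (T.filter fun t => ¬ (A.n * v 2 + t * v 0 ≠ 0)).card :=
    (Finset.card_filter_add_card_filter_not _).symm
  -- A root `t` with vanishing denominator belongs to `v` itself; it is not a root in `s` and is
  -- counted by the drop of the degree.
  by_cases hex : ∃ t ∈ T, A.n * v 2 + t * v 0 = 0
  · obtain ⟨t, htT, htv⟩ := hex
    have hv0 : v 0 ≠ 0 := by
      intro h
      have h2 : v 2 = 0 := by
        rw [h, mul_zero, add_zero] at htv
        exact (mul_eq_zero.1 htv).resolve_left A.n_pos.ne'
      exact hw (by rw [h, h2]; ring)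
    have h1 : (T.filter fun t => ¬ (A.n * v 2 + t * v 0 ≠ 0)).card ≤ 1 := by
      refine Finset.card_le_one.2 fun a ha b hb => ?_
      have ha' := not_not.1 (Finset.mem_filter.1 ha).2
      have hb' := not_not.1 (Finset.mem_filter.1 hb).2
      exact mul_right_cancel₀ hv0 (by linarith)
    have hzero : f.coeff (A.poles.card + 1) = 0 := by
      rw [hlead]
      refine A.eval_F_of_lineEquation hw1 (hroot t htT) ?_ (by linear_combination htv)
      rw [w0, w1, w2]; ring
    have hlt : f.natDegree < A.poles.card + 1 := by
      refine lt_of_le_of_ne hdeg fun e => hf0 ?_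
      rw [← e] at hzero
      exact leadingCoeff_eq_zero.1 hzero
    omega
  · push Not at hex
    have h1 : (T.filter fun t => ¬ (A.n * v 2 + t * v 0 ≠ 0)).card = 0 := by
      rw [Finset.card_eq_zero, Finset.filter_eq_empty_iff]
      intro t ht
      exact not_not.2 (hex t ht)
    omega

/-- On a line through `[0 : 1 : 0]` the coordinates `x` and `z` are fixed multiples of one linear
polynomial `L`, so the restricted equation is `L^#poles` times a polynomial of degree at most one.
It splits over the reals. -/
lemma realIntersectionNumber_of_vertical {u v : Fin 3 → ℝ} (hw : u 2 * v 0 - u 0 * v 2 = 0) :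
    realIntersectionNumber A.F (A.poles.card + 1) u v = A.poles.card + 1 := by
  obtain ⟨e0, e2, a, b, hu0, hu2, hv0, hv2⟩ : ∃ e0 e2 a b : ℝ, u 0 = a * e0 ∧ u 2 = a * e2 ∧
      v 0 = b * e0 ∧ v 2 = b * e2 := by
    by_cases h0 : u 0 = 0
    · by_cases h2 : u 2 = 0
      · exact ⟨v 0, v 2, 0, 1, by simp [h0], by simp [h2], by simp, by simp⟩
      · refine ⟨u 0, u 2, 1, v 2 / u 2, by simp, by simp, ?_, by field_simp⟩
        field_simp; linear_combination hw
    · refine ⟨u 0, u 2, 1, v 0 / u 0, by simp, by simp, by field_simp, ?_⟩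
      field_simp; linear_combination -hw
  set f := restrictToLine A.F u v with hf
  set L : ℝ[X] := C a + C b * X with hL
  set q : ℝ := ∏ p ∈ A.poles, (-(A.n * e2) - p * e0) with hq
  set r : ℝ := (A.n * e2 - A.c * e0) * q +
    e0 ^ 2 * ∑ p ∈ A.poles, A.weight p * ∏ p' ∈ A.poles.erase p, (-(A.n * e2) - p' * e0) with hr
  have hfac : f = L ^ A.poles.card *
      (C (A.n * q * u 1 + r * a) + C (A.n * q * v 1 + r * b) * X) := by
    refine Polynomial.funext fun s => ?_
    have hprod : ∀ Z : Finset ℝ, MvPolynomial.eval (u + s • v) (∏ p ∈ Z, A.linearFactor p) =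
        (a + b * s) ^ Z.card * ∏ p ∈ Z, (-(A.n * e2) - p * e0) := by
      intro Z
      rw [map_prod, ← Finset.prod_const, ← Finset.prod_mul_distrib]
      refine Finset.prod_congr rfl fun p _ => ?_
      simp [linearFactor, hu0, hu2, hv0, hv2]
      ring
    have hE : (a + b * s) ^ 2 * MvPolynomial.eval (u + s • v) A.Eh =
        (a + b * s) ^ (A.poles.card + 1) *
          ∑ p ∈ A.poles, A.weight p * ∏ p' ∈ A.poles.erase p, (-(A.n * e2) - p' * e0) := by
      rw [Eh, map_sum, Finset.mul_sum, Finset.mul_sum]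
      refine Finset.sum_congr rfl fun p hp => ?_
      rw [map_mul, hprod, MvPolynomial.eval_C, Finset.card_erase_of_mem hp]
      obtain ⟨m, hm⟩ : ∃ m, A.poles.card = m + 1 :=
        ⟨A.poles.card - 1, by have := Finset.card_pos.2 ⟨p, hp⟩; omega⟩
      rw [hm, Nat.add_sub_cancel]
      ring
    have hx : (u + s • v) 0 = (a + b * s) * e0 := by simp [hu0, hv0]; ring
    have hz : (u + s • v) 2 = (a + b * s) * e2 := by simp [hu2, hv2]; ring
    have hy : (u + s • v) 1 = u 1 + s * v 1 := by simp
    rw [hf, eval_restrictToLine, F, map_add, map_mul, map_mul, map_pow, MvPolynomial.eval_X, Qh,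
      hprod, hx, mul_pow, mul_right_comm, hE]
    simp only [map_sub, map_add, map_mul, MvPolynomial.eval_C, MvPolynomial.eval_X, hx, hy, hz,
      eval_mul, eval_pow, eval_add, eval_C, eval_X, hL]
    rw [hr, hq]
    ring
  have hsplit : f.Splits := by
    rw [hfac]
    exact (Splits.pow (Splits.of_natDegree_le_one (natDegree_C_add_C_mul_X_le _ _)) _).mul
      (Splits.of_natDegree_le_one (natDegree_C_add_C_mul_X_le _ _))
  have hdeg := (restrictToLine_degree A.isHomogeneous_F u v).1
  rw [← hf] at hdeg
  rw [realIntersectionNumber, ← hf, ← hsplit.natDegree_eq_card_roots]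
  omega

/-- If such a line lay on the curve, its points at `s = 1` and `s = 2` would contradict the degree
one in `y`: the coefficient of `y` vanishes only at poles, where `E` is nonzero. -/
lemma restrictToLine_center_ne_zero {v : Fin 3 → ℝ} (hlin : LinearIndependent ℝ ![![0, 1, 0], v]) :
    restrictToLine A.F ![0, 1, 0] v ≠ 0 := by
  intro h0
  have hv : v 0 ≠ 0 ∨ v 2 ≠ 0 := by
    by_contra! hcon
    rw [LinearIndependent.pair_iff] at hlin
    have := (hlin (v 1) (-1) (by
      funext i
      fin_cases i <;> simp [hcon])).2
    norm_num at this
  have hval : ∀ s : ℝ, MvPolynomial.eval (![0, 1, 0] + s • v) A.F = 0 := by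
    intro s
    rw [← eval_restrictToLine, h0, eval_zero]
  by_cases hv0 : v 0 = 0
  · have hv2 := hv.resolve_left (not_not.2 hv0)
    have key : ∀ s : ℝ, s ≠ 0 → 1 + s * v 1 + s * v 2 = 0 := by
      intro s hs
      have := hval s
      simp only [F, Qh, Eh, linearFactor, map_add, map_mul, map_sub, map_neg, map_pow, map_prod,
        MvPolynomial.eval_C, MvPolynomial.eval_X, Pi.add_apply, Pi.smul_apply, smul_eq_mul, hv0,
        Matrix.cons_val_zero, Matrix.cons_val_one, Matrix.cons_val] at this
      have hne : (-(A.n * (0 + s * v 2))) ^ A.poles.card ≠ 0 :=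
        pow_ne_zero _ (neg_ne_zero.2 (mul_ne_zero A.n_pos.ne' (by simp [hs, hv2])))
      have h2 : A.n * (1 + s * v 1 + s * v 2) * (-(A.n * (0 + s * v 2))) ^ A.poles.card = 0 := by
        simp only [mul_zero, sub_zero, add_zero, Finset.prod_const, ne_eq, OfNat.ofNat_ne_zero, not_false_eq_true,
          zero_pow, zero_mul] at this
        linear_combination this
      have h3 := (mul_eq_zero.1 h2).resolve_right hne
      exact (mul_eq_zero.1 h3).resolve_left A.n_pos.ne'
    have k1 := key 1 one_ne_zero
    have k2 := key 2 two_ne_zero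
    linarith
  · set t : ℝ := -(A.n * v 2) / v 0 with ht
    have key : ∀ s : ℝ, s ≠ 0 → (A.n * (1 + s * v 1) - s * v 0 * t - A.c * (s * v 0)) * A.Q.eval t +
        s * v 0 * A.E.eval t = 0 := by
      intro s hs
      have := hval s
      rw [A.eval_F_real (t := t) (by simp [ht]; field_simp)] at this
      simp only [Pi.add_apply, Pi.smul_apply, smul_eq_mul, Matrix.cons_val_zero, Matrix.cons_val_one,
        zero_add] at this
      exact (mul_eq_zero.1 this).resolve_left (pow_ne_zero _ (mul_ne_zero hs hv0))
    have k1 := key 1 one_ne_zero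
    have k2 := key 2 two_ne_zero
    have hQ : A.Q.eval t = 0 := by
      have : A.n * A.Q.eval t = 0 := by linear_combination 2 * k1 - k2
      exact (mul_eq_zero.1 this).resolve_left A.n_pos.ne'
    have htp : t ∈ A.poles := by
      by_contra h
      exact A.eval_Q_ne_zero h hQ
    rw [hQ, mul_zero, zero_add, one_mul] at k1
    exact A.eval_E_ne_zero htp ((mul_eq_zero.1 k1).resolve_left hv0)

lemma isWindingForm_F : IsWindingForm A.F (A.poles.card + 1) := by
  refine ⟨fun u v hlin => ?_, ![0, 1, 0], fun h => one_ne_zero (congrFun h 1), fun v hlin => ?_⟩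
  · by_cases hw : u 2 * v 0 - u 0 * v 2 = 0
    · right
      rw [A.realIntersectionNumber_of_vertical hw]
      omega
    · exact A.realIntersectionNumber_of_transversal hw
  · have hne := A.restrictToLine_center_ne_zero hlin
    exact ⟨hne, A.realIntersectionNumber_of_vertical (by simp)⟩

lemma isCloudCurve_envelope : IsCloudCurve (paramClosure A.envelope) :=
  ⟨_, _, ⟨A.F, A.isEquationOf_F, A.isWindingForm_F⟩, A.tangentPair_graphCurve.dualCurve_eq.symm⟩

end PickData

end

/-! ### Class and tangent lines of the envelope. -/

noncomputable section

open MvPolynomial in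
/-- A determinant whose columns consist of homogeneous forms is homogeneous. -/
lemma isWeightedHomogeneous_det {σ ι K : Type*} [CommRing K] [Fintype ι] [DecidableEq ι]
    {w : σ → ℕ} {M : Matrix ι ι (MvPolynomial σ K)} {e : ι → ℕ}
    (h : ∀ i j, (M i j).IsWeightedHomogeneous w (e j)) :
    M.det.IsWeightedHomogeneous w (∑ j, e j) := by
  rw [Matrix.det_apply]
  refine IsWeightedHomogeneous.sum _ _ _ fun τ _ => ?_
  have := IsWeightedHomogeneous.prod Finset.univ (fun i => M (τ i) i) e fun i _ => h (τ i) i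
  rcases Int.units_eq_one_or (Equiv.Perm.sign τ) with h1 | h1
  · rw [h1, one_smul]; exact this
  · rw [h1, Units.neg_smul, one_smul]; exact this.neg

open MvPolynomial in
lemma isWeightedHomogeneous_resultant {σ K : Type*} [CommRing K] {w : σ → ℕ}
    {f g : Polynomial (MvPolynomial σ K)} {a b : ℕ}
    (hf : ∀ i, (f.coeff i).IsWeightedHomogeneous w a)
    (hg : ∀ i, (g.coeff i).IsWeightedHomogeneous w b) (m n : ℕ) :
    (Polynomial.resultant f g m n).IsWeightedHomogeneous w (m * b + n * a) := by
  have hsum : ∑ j : Fin (m + n), Fin.addCases (fun _ => b) (fun _ => a) j = m * b + n * a := by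
    rw [Fin.sum_univ_add]; simp
  rw [Polynomial.resultant, ← hsum]
  refine isWeightedHomogeneous_det fun i j => ?_
  induction j using Fin.addCases with
  | left j =>
    simp only [Polynomial.sylvester, Matrix.of_apply, Fin.addCases_left]
    split_ifs
    · exact hg _
    · exact isWeightedHomogeneous_zero _ _ _
  | right j =>
    simp only [Polynomial.sylvester, Matrix.of_apply, Fin.addCases_right]
    split_ifs
    · exact hf _
    · exact isWeightedHomogeneous_zero _ _ _

lemma IsBihomogeneous.of_linear_left {H : MvPolynomial (Fin 3 ⊕ Fin 3) ℂ} (a : Fin 3 → ℂ)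
    (h : H = ∑ i, MvPolynomial.C (a i) * MvPolynomial.X (Sum.inl i)) : IsBihomogeneous H 1 0 := by
  subst h
  exact ⟨MvPolynomial.IsWeightedHomogeneous.sum _ _ _ fun i _ =>
      (MvPolynomial.isWeightedHomogeneous_X ℂ leftWeight (Sum.inl i)).C_mul _,
    MvPolynomial.IsWeightedHomogeneous.sum _ _ _ fun i _ =>
      (MvPolynomial.isWeightedHomogeneous_X ℂ rightWeight (Sum.inl i)).C_mul _⟩

lemma IsBihomogeneous.of_linear_right {H : MvPolynomial (Fin 3 ⊕ Fin 3) ℂ} (a : Fin 3 → ℂ)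
    (h : H = ∑ i, MvPolynomial.C (a i) * MvPolynomial.X (Sum.inr i)) : IsBihomogeneous H 0 1 := by
  subst h
  exact ⟨MvPolynomial.IsWeightedHomogeneous.sum _ _ _ fun i _ =>
      (MvPolynomial.isWeightedHomogeneous_X ℂ leftWeight (Sum.inr i)).C_mul _,
    MvPolynomial.IsWeightedHomogeneous.sum _ _ _ fun i _ =>
      (MvPolynomial.isWeightedHomogeneous_X ℂ rightWeight (Sum.inr i)).C_mul _⟩

lemma IsBihomogeneous.mul {H H' : MvPolynomial (Fin 3 ⊕ Fin 3) ℂ} {k l k' l' : ℕ}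
    (h : IsBihomogeneous H k l) (h' : IsBihomogeneous H' k' l') :
    IsBihomogeneous (H * H') (k + k') (l + l') := ⟨h.1.mul h'.1, h.2.mul h'.2⟩

lemma IsBihomogeneous.sub {H H' : MvPolynomial (Fin 3 ⊕ Fin 3) ℂ} {k l : ℕ}
    (h : IsBihomogeneous H k l) (h' : IsBihomogeneous H' k l) :
    IsBihomogeneous (H - H') k l := ⟨h.1.sub h'.1, h.2.sub h'.2⟩

lemma isBihomogeneous_X_inl (i : Fin 3) :
    IsBihomogeneous (MvPolynomial.X (Sum.inl i)) 1 0 :=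
  ⟨MvPolynomial.isWeightedHomogeneous_X ℂ leftWeight (Sum.inl i),
    MvPolynomial.isWeightedHomogeneous_X ℂ rightWeight (Sum.inl i)⟩

lemma isBihomogeneous_X_inr (i : Fin 3) :
    IsBihomogeneous (MvPolynomial.X (Sum.inr i)) 0 1 :=
  ⟨MvPolynomial.isWeightedHomogeneous_X ℂ leftWeight (Sum.inr i),
    MvPolynomial.isWeightedHomogeneous_X ℂ rightWeight (Sum.inr i)⟩

namespace PickData

open Polynomial

variable (A : PickData)

/-! ### The degenerate case of class one, where the envelope is a point. -/

section NoPoles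

variable {A} (h : A.poles = ∅)

include h

lemma curvePoint_envelope_of_empty (t : ℂ) : curvePoint A.envelope t = A.envelopeInfinity := by
  have hQ : A.Q = 1 := by simp [Q, h]
  have hE : A.E = 0 := by simp [E, h]
  have hP : A.P = X + C A.c := by simp [P, hQ, hE]
  have hN : A.N = 1 := by simp [N, hQ, hP]
  rw [envelope_apply, Nc, Pc, Qc, hQ, hP, hN, envelopeInfinity]
  simp

lemma mem_paramClosure_envelope_of_empty {q : PPlane} : q ∈ paramClosure A.envelope ↔
    q = Projectivization.mk ℂ A.envelopeInfinity A.envelopeInfinity_ne_zero := by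
  constructor
  · intro hq
    refine eq_mk_of_isParallel A.envelopeInfinity_ne_zero fun i j => ?_
    have := hq 1 (MvPolynomial.C (A.envelopeInfinity j) * MvPolynomial.X i -
      MvPolynomial.C (A.envelopeInfinity i) * MvPolynomial.X j)
      (((MvPolynomial.isHomogeneous_X ℂ i).C_mul _).sub ((MvPolynomial.isHomogeneous_X ℂ j).C_mul _))
      (aeval_curve_eq_zero_iff.2 fun t => by
        rw [curvePoint_envelope_of_empty h]; simp; ring)
    simp only [map_sub, map_mul, MvPolynomial.eval_C, MvPolynomial.eval_X] at this
    linear_combination this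
  · rintro rfl k G hG h0
    rw [eval_rep_mk hG, ← curvePoint_envelope_of_empty h 0]
    exact aeval_curve_eq_zero_iff.1 h0 0

lemma mem_coneTangentSpace_of_empty {w : Fin 3 → ℂ} :
    w ∈ coneTangentSpace (paramClosure A.envelope)
      (Projectivization.mk ℂ A.envelopeInfinity A.envelopeInfinity_ne_zero) ↔
    ∃ a : ℂ, w = a • A.envelopeInfinity := by
  obtain ⟨b, hb, e⟩ := rep_mk_eq_smul A.envelopeInfinity_ne_zero
  rw [mem_coneTangentSpace A.envelope_ne_zero]
  constructor
  · intro hw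
    refine IsParallel.exists_smul (fun i j => ?_) A.envelopeInfinity_ne_zero
    have := hw 1 (MvPolynomial.C (A.envelopeInfinity j) * MvPolynomial.X i -
      MvPolynomial.C (A.envelopeInfinity i) * MvPolynomial.X j)
      (((MvPolynomial.isHomogeneous_X ℂ i).C_mul _).sub ((MvPolynomial.isHomogeneous_X ℂ j).C_mul _))
      (aeval_curve_eq_zero_iff.2 fun t => by
        rw [curvePoint_envelope_of_empty h]; simp; ring)
    simp only [map_sub, Derivation.leibniz, MvPolynomial.pderiv_C, mul_zero, add_zero,
      MvPolynomial.pderiv_X, smul_eq_mul, map_mul, MvPolynomial.eval_C, sub_mul,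
      Finset.sum_sub_distrib] at this
    rw [Finset.sum_eq_single i (fun b _ hb => by simp [hb.symm]) (by simp),
      Finset.sum_eq_single j (fun b _ hb => by simp [hb.symm]) (by simp)] at this
    simp only [Pi.single_eq_same, map_one, mul_one] at this
    linear_combination this
  · rintro ⟨a, rfl⟩ k G hG h0
    have h1 : MvPolynomial.eval A.envelopeInfinity G = 0 := by
      rw [← curvePoint_envelope_of_empty h 0]
      exact aeval_curve_eq_zero_iff.1 h0 0
    have he := congrArg (MvPolynomial.eval A.envelopeInfinity) hG.sum_X_mul_pderiv
    rw [map_nsmul, h1, smul_zero, map_sum] at he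
    rw [e]
    have : ∀ j, MvPolynomial.eval (b • A.envelopeInfinity) (MvPolynomial.pderiv j G) *
        (a • A.envelopeInfinity) j = (b ^ (k - 1) * a) *
          MvPolynomial.eval A.envelopeInfinity (MvPolynomial.X j * MvPolynomial.pderiv j G) := by
      intro j
      rw [eval_smul_of_isHomogeneous hG.pderiv, map_mul, MvPolynomial.eval_X, Pi.smul_apply,
        smul_eq_mul]
      ring
    rw [Finset.sum_congr rfl fun j _ => this j, ← Finset.mul_sum, he, mul_zero]

/-- The affine cone of a point is a line, so its tangent lines are all lines through the point;
these form the graph, which is itself a line here. -/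
lemma isSmoothTangent_of_empty {q M : PPlane} : IsSmoothTangent (paramClosure A.envelope) q M ↔
    q = Projectivization.mk ℂ A.envelopeInfinity A.envelopeInfinity_ne_zero ∧
      M ∈ paramClosure A.graphCurve := by
  have hM : M ∈ paramClosure A.graphCurve ↔ ∑ j, M.rep j * A.envelopeInfinity j = 0 := by
    rw [← zeroLocus_Fc]
    change MvPolynomial.eval M.rep A.Fc = 0 ↔ _
    have : MvPolynomial.eval M.rep A.Fc = ∑ j, M.rep j * A.envelopeInfinity j := by
      rw [eval_Fc, Fin.sum_univ_three]
      simp [F, Qh, Eh, h, envelopeInfinity]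
      ring
    rw [this]
  rw [hM]
  constructor
  · rintro ⟨⟨hq, -⟩, hT⟩
    rw [mem_paramClosure_envelope_of_empty h] at hq
    subst hq
    exact ⟨rfl, hT _ ((mem_coneTangentSpace_of_empty h).2 ⟨1, (one_smul _ _).symm⟩)⟩
  · rintro ⟨rfl, hT⟩
    refine ⟨⟨(mem_paramClosure_envelope_of_empty h).2 rfl, fun q hq => ?_⟩, fun v hv => ?_⟩
    · rw [mem_paramClosure_envelope_of_empty h] at hq
      rw [hq]
    · obtain ⟨a, rfl⟩ := (mem_coneTangentSpace_of_empty h).1 hv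
      rw [← mul_zero a, ← hT, Finset.mul_sum]
      refine Finset.sum_congr rfl fun j _ => ?_
      rw [Pi.smul_apply, smul_eq_mul]
      ring

lemma dualCurve_envelope_of_empty :
    dualCurve (paramClosure A.envelope) = paramClosure A.graphCurve := by
  ext L
  constructor
  · intro hL k G hG h0
    refine hL k G hG ?_
    rintro M ⟨q, hq⟩
    exact ((isSmoothTangent_of_empty h).1 hq).2 k G hG h0
  · intro hL k G hG h0
    exact h0 L ⟨_, (isSmoothTangent_of_empty h).2 ⟨rfl, hL⟩⟩

lemma isTangentAt_envelope_of_empty {L p : PPlane} : IsTangentAt (paramClosure A.envelope) L p ↔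
    ∀ (k l : ℕ) (H : MvPolynomial (Fin 3 ⊕ Fin 3) ℂ), IsBihomogeneous H k l →
      (∀ t, MvPolynomial.eval
        (Sum.elim (curvePoint A.envelope t) (curvePoint A.graphCurve t)) H = 0) →
      MvPolynomial.eval (Sum.elim p.rep L.rep) H = 0 := by
  constructor
  · intro hT k l H hH h0
    refine hT k l H hH.1 hH.2 fun q M hq => ?_
    obtain ⟨rfl, hM⟩ := (isSmoothTangent_of_empty h).1 hq
    obtain ⟨b, hb, e⟩ := rep_mk_eq_smul A.envelopeInfinity_ne_zero
    have hcomp : ∀ v : Fin 3 → ℂ, MvPolynomial.eval v (MvPolynomial.aeval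
        (Sum.elim (fun i => MvPolynomial.C (A.envelopeInfinity i)) MvPolynomial.X) H : Form3) =
        MvPolynomial.eval (Sum.elim A.envelopeInfinity v) H := by
      intro v
      have : (MvPolynomial.eval v).comp (MvPolynomial.aeval
          (Sum.elim (fun i => MvPolynomial.C (A.envelopeInfinity i)) MvPolynomial.X) :
          MvPolynomial (Fin 3 ⊕ Fin 3) ℂ →ₐ[ℂ] Form3).toRingHom =
          MvPolynomial.eval (Sum.elim A.envelopeInfinity v) := by
        ext i
        · simp
        · rcases i with i | i <;> simp
      exact RingHom.congr_fun this H
    have hz := hM l (MvPolynomial.aeval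
        (Sum.elim (fun i => MvPolynomial.C (A.envelopeInfinity i)) MvPolynomial.X) H)
      (IsWeightedHomogeneous.aeval_isHomogeneous hH.2 (by
        rintro (i | i)
        · exact MvPolynomial.isHomogeneous_C _ _
        · exact MvPolynomial.isHomogeneous_X _ _))
      (aeval_curve_eq_zero_iff.2 fun t => by
        rw [hcomp, ← curvePoint_envelope_of_empty h t]; exact h0 t)
    rw [hcomp] at hz
    have := hH.eval_smul b 1 A.envelopeInfinity M.rep
    rw [one_smul, hz, mul_zero] at this
    rw [e, this]
  · intro hT k l H hk hl h0
    refine hT k l H ⟨hk, hl⟩ fun t => ?_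
    rw [curvePoint_envelope_of_empty h]
    exact (eval_rep_mk_mk ⟨hk, hl⟩ A.envelopeInfinity_ne_zero (A.graphCurve_ne_zero t)).1
      (h0 _ _ ((isSmoothTangent_of_empty h).2 ⟨rfl, mk_curvePoint_mem _⟩))

end NoPoles

lemma dualCurve_envelope : dualCurve (paramClosure A.envelope) = paramClosure A.graphCurve := by
  rcases A.poles.eq_empty_or_nonempty with h | h
  · exact dualCurve_envelope_of_empty h
  · exact (A.tangentPair_envelope h).dualCurve_eq

lemma hasClass_envelope : HasClass (paramClosure A.envelope) (A.poles.card + 1) := by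
  rw [HasClass, dualCurve_envelope]
  exact ⟨A.F, A.isEquationOf_F⟩

lemma isTangentAt_envelope {p : PPlane} {w : Fin 3 → ℂ} (hw : w ≠ 0) :
    IsTangentAt (paramClosure A.envelope) (Projectivization.mk ℂ w hw) p ↔
    ∀ (k l : ℕ) (H : MvPolynomial (Fin 3 ⊕ Fin 3) ℂ), IsBihomogeneous H k l →
      (∀ t, MvPolynomial.eval
        (Sum.elim (curvePoint A.envelope t) (curvePoint A.graphCurve t)) H = 0) →
      MvPolynomial.eval (Sum.elim p.rep w) H = 0 := by
  have h1 : IsTangentAt (paramClosure A.envelope) (Projectivization.mk ℂ w hw) p ↔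
    ∀ (k l : ℕ) (H : MvPolynomial (Fin 3 ⊕ Fin 3) ℂ), IsBihomogeneous H k l →
      (∀ t, MvPolynomial.eval
        (Sum.elim (curvePoint A.envelope t) (curvePoint A.graphCurve t)) H = 0) →
      MvPolynomial.eval (Sum.elim p.rep (Projectivization.mk ℂ w hw).rep) H = 0 := by
    rcases A.poles.eq_empty_or_nonempty with h | h
    · exact isTangentAt_envelope_of_empty h
    · exact (A.tangentPair_envelope h).isTangentAt_iff
  rw [h1]
  refine forall_congr' fun k => forall_congr' fun l => forall_congr' fun H =>
    forall_congr' fun hH => forall_congr' fun _ => ?_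
  have := eval_rep_mk_mk hH p.rep_nonzero hw
  rwa [Projectivization.mk_rep] at this

/-! The tangent line at infinity. -/

/-- The term with `X 0 ^ 2` does not contribute, so the gradient is nonzero: the graph is smooth at
`[0 : 1 : -1]`. -/
lemma formGradient_Fc_infinity : formGradient A.Fc graphInfinity =
    ((A.n : ℂ) ^ A.poles.card) • A.envelopeInfinity := by
  have hF : A.Fc = (MvPolynomial.C (A.n : ℂ) * MvPolynomial.X 1 +
      MvPolynomial.C (A.n : ℂ) * MvPolynomial.X 2 - MvPolynomial.C (A.c : ℂ) * MvPolynomial.X 0) *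
      (∏ p ∈ A.poles, A.linearFactorC p) + MvPolynomial.X 0 * (MvPolynomial.X 0 *
        ∑ p ∈ A.poles, MvPolynomial.C (A.weight p : ℂ) *
          ∏ q ∈ A.poles.erase p, A.linearFactorC q) := by
    rw [Fc_eq, slopeCoeff, constantPart]
    ring
  have hprod : MvPolynomial.eval graphInfinity (∏ p ∈ A.poles, A.linearFactorC p) =
      (A.n : ℂ) ^ A.poles.card := by
    rw [map_prod, ← Finset.prod_const]
    exact Finset.prod_congr rfl fun p _ => by simp [linearFactorC, graphInfinity]
  funext j
  simp only [formGradient, hF, map_add, map_sub, Derivation.leibniz, smul_eq_mul, map_mul,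
    MvPolynomial.pderiv_C, MvPolynomial.pderiv_X, hprod, MvPolynomial.eval_C, MvPolynomial.eval_X,
    mul_zero, add_zero, Pi.smul_apply]
  fin_cases j <;> simp [graphInfinity, envelopeInfinity]

/-- Proportionality of the point to the gradient of `Fc` at the line is a bihomogeneous condition
that holds along the curve. At a smooth point of the dual it determines the point of contact; the
converse is the limit `t → ∞`. -/
lemma isTangentAt_infinity {p : PPlane} :
    IsTangentAt (paramClosure A.envelope) (Projectivization.mk ℂ graphInfinity graphInfinity_ne_zero) p
      ↔ p = Projectivization.mk ℂ A.envelopeInfinity A.envelopeInfinity_ne_zero := by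
  rw [isTangentAt_envelope]
  constructor
  · intro h
    have hpar : IsParallel p.rep (formGradient A.Fc graphInfinity) := by
      intro i j
      have hb := ((isBihomogeneous_X_inl i).mul
          (isBihomogeneous_rename_inr (A.isHomogeneous_Fc.pderiv (i := j)))).sub
        ((isBihomogeneous_X_inl j).mul
          (isBihomogeneous_rename_inr (A.isHomogeneous_Fc.pderiv (i := i))))
      have := h _ _ _ hb fun t => by
        have hg := (A.tangentPair_graphCurve.gradient_at A.isHomogeneous_Fc
          A.aeval_graphCurve_Fc t).symm i j
        rw [map_sub, map_mul, map_mul, MvPolynomial.eval_rename, MvPolynomial.eval_rename,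
          Sum.elim_comp_inr, MvPolynomial.eval_X, MvPolynomial.eval_X]
        exact sub_eq_zero.2 hg
      rw [map_sub, map_mul, map_mul, MvPolynomial.eval_rename, MvPolynomial.eval_rename,
        Sum.elim_comp_inr, MvPolynomial.eval_X, MvPolynomial.eval_X] at this
      exact sub_eq_zero.1 this
    refine eq_mk_of_isParallel A.envelopeInfinity_ne_zero fun i j => ?_
    have := hpar i j
    rw [formGradient_Fc_infinity] at this
    simp only [Pi.smul_apply, smul_eq_mul] at this
    refine mul_left_cancel₀ (pow_ne_zero A.poles.card A.n_ne_zero) ?_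
    linear_combination this
  · rintro rfl k l H hH h0
    obtain ⟨b, hb, e⟩ := rep_mk_eq_smul A.envelopeInfinity_ne_zero
    have := hH.eval_smul b 1 A.envelopeInfinity graphInfinity
    rw [one_smul, A.eval_infinity hH h0, mul_zero] at this
    rw [e, this]

/-! The tangent lines at the poles. -/

/-- The common line of all poles. -/
def poleLine : Fin 3 → ℂ := ![0, 1, 0]

lemma poleLine_ne_zero : poleLine ≠ 0 := fun h => one_ne_zero (congrFun h 1)

/-- The point of the envelope belonging to the pole `p`. -/
def polePoint (p : ℝ) : Fin 3 → ℂ := ![(p : ℂ), 0, A.n]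

lemma polePoint_ne_zero (p : ℝ) : A.polePoint p ≠ 0 := fun h => A.n_ne_zero (congrFun h 2)

lemma monic_Q : A.Q.Monic := monic_prod_X_sub_C _ _

lemma natDegree_Q : A.Q.natDegree = A.poles.card := natDegree_finsetProd_X_sub_C_eq_card _ _

lemma natDegree_E_le : A.E.natDegree ≤ A.poles.card := by
  refine natDegree_sum_le_of_forall_le _ _ fun p hp => (natDegree_C_mul_le _ _).trans ?_
  rw [natDegree_finsetProd_X_sub_C_eq_card]
  exact Finset.card_le_card (Finset.erase_subset _ _)

/-- The equation for the parameter of a tangent line. -/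
def lineParameterEquation : Polynomial (MvPolynomial (Fin 3 ⊕ Fin 3) ℂ) :=
  C (MvPolynomial.C (A.n : ℂ) * MvPolynomial.X (Sum.inr 1) +
      MvPolynomial.C (A.n : ℂ) * MvPolynomial.X (Sum.inr 2) -
      MvPolynomial.C (A.c : ℂ) * MvPolynomial.X (Sum.inr 0)) * A.Qc.map MvPolynomial.C +
    C (MvPolynomial.X (Sum.inr 0)) * A.Ec.map MvPolynomial.C

/-- An equation for the parameter of a point. -/
def pointParameterEquation : Polynomial (MvPolynomial (Fin 3 ⊕ Fin 3) ℂ) :=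
  C (MvPolynomial.C (A.n : ℂ) * MvPolynomial.X (Sum.inl 0)) * A.Nc.map MvPolynomial.C -
    C (MvPolynomial.X (Sum.inl 2)) * (X * A.Nc - A.Pc * A.Qc).map MvPolynomial.C

/-- The elimination of the parameter. -/
def eliminant : MvPolynomial (Fin 3 ⊕ Fin 3) ℂ :=
  resultant A.lineParameterEquation A.pointParameterEquation A.poles.card
    (A.pointParameterEquation.natDegree + 1)

lemma isBihomogeneous_coeff_line (i : ℕ) :
    IsBihomogeneous (A.lineParameterEquation.coeff i) 0 1 := by
  refine IsBihomogeneous.of_linear_right ![A.Ec.coeff i - A.c * A.Qc.coeff i, A.n * A.Qc.coeff i,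
    A.n * A.Qc.coeff i] ?_
  simp only [lineParameterEquation, coeff_add, coeff_C_mul, coeff_map]
  simp only [Fin.sum_univ_three, Matrix.cons_val_zero, Matrix.cons_val_one, Matrix.cons_val, map_sub, map_mul]
  ring

lemma isBihomogeneous_coeff_point (i : ℕ) :
    IsBihomogeneous (A.pointParameterEquation.coeff i) 1 0 := by
  refine IsBihomogeneous.of_linear_left ![A.n * A.Nc.coeff i, 0,
    -(X * A.Nc - A.Pc * A.Qc).coeff i] ?_
  simp only [pointParameterEquation, coeff_sub, coeff_C_mul, coeff_map]
  simp only [Fin.sum_univ_three, Matrix.cons_val_zero, Matrix.cons_val_one, Matrix.cons_val, map_sub,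
    map_mul, map_neg, map_zero]
  ring

lemma isBihomogeneous_eliminant : ∃ k l, IsBihomogeneous A.eliminant k l :=
  ⟨_, _, isWeightedHomogeneous_resultant (fun i => (A.isBihomogeneous_coeff_line i).1)
    (fun i => (A.isBihomogeneous_coeff_point i).1) _ _,
    isWeightedHomogeneous_resultant (fun i => (A.isBihomogeneous_coeff_line i).2)
    (fun i => (A.isBihomogeneous_coeff_point i).2) _ _⟩

lemma map_line (q w : Fin 3 → ℂ) :
    A.lineParameterEquation.map (MvPolynomial.eval (Sum.elim q w)) =
      C (A.n * w 1 + A.n * w 2 - A.c * w 0) * A.Qc + C (w 0) * A.Ec := by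
  have : (MvPolynomial.eval (Sum.elim q w)).comp MvPolynomial.C = RingHom.id ℂ := by ext; simp
  simp [lineParameterEquation, Polynomial.map_map, this]

lemma map_point (q w : Fin 3 → ℂ) :
    A.pointParameterEquation.map (MvPolynomial.eval (Sum.elim q w)) =
      C (A.n * q 0) * A.Nc - C (q 2) * (X * A.Nc - A.Pc * A.Qc) := by
  have : (MvPolynomial.eval (Sum.elim q w)).comp MvPolynomial.C = RingHom.id ℂ := by ext; simp
  simp [pointParameterEquation, Polynomial.map_map, this]

lemma natDegree_line_le : A.lineParameterEquation.natDegree ≤ A.poles.card := by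
  refine (natDegree_add_le _ _).trans (max_le ?_ ?_) <;>
    refine (natDegree_C_mul_le _ _).trans (natDegree_map_le.trans (natDegree_map_le.trans ?_))
  · exact A.natDegree_Q.le
  · exact A.natDegree_E_le

lemma eval_eliminant_curve (t : ℂ) : MvPolynomial.eval
    (Sum.elim (curvePoint A.envelope t) (curvePoint A.graphCurve t)) A.eliminant = 0 := by
  -- The resultant is a combination of the two equations, which share the root `t`. The formal
  -- degree of the second is raised by one so that it is never zero, as the identity requires.
  obtain ⟨f, g, -, -, h⟩ := exists_mul_add_mul_eq_C_resultant A.lineParameterEquation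
    A.pointParameterEquation A.natDegree_line_le
    (Nat.le_succ A.pointParameterEquation.natDegree) (Or.inr (Nat.succ_ne_zero _))
  have h1 := congrArg (fun r => (r.map (MvPolynomial.eval
    (Sum.elim (curvePoint A.envelope t) (curvePoint A.graphCurve t)))).eval t) h
  simp only [Polynomial.map_add, Polynomial.map_mul, Polynomial.map_C, eval_add, eval_mul, eval_C,
    map_line, map_point] at h1
  refine Eq.trans h1.symm ?_
  simp only [graphCurve_apply, envelope_apply, Matrix.cons_val_zero, Matrix.cons_val_one,
    Matrix.cons_val, eval_sub, eval_mul, eval_C, eval_X, eval_Pc]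
  ring

lemma splits_Qc : A.Qc.Splits := by
  rw [Qc, Q, Polynomial.map_prod]
  refine Splits.prod fun p _ => ?_
  rw [Polynomial.map_sub, map_X, map_C]
  exact Splits.X_sub_C _

/-- At `[0 : 1 : 0]` the gradient of the graph vanishes as soon as there are two poles, so the
contact points are found by elimination: the resultant is, up to a nonzero factor, the product over
the poles of the point equation. -/
lemma exists_pole_of_eval_eliminant {q : Fin 3 → ℂ}
    (h : MvPolynomial.eval (Sum.elim q poleLine) A.eliminant = 0) :
    ∃ p ∈ A.poles, (A.n : ℂ) * q 0 = p * q 2 := by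
  have hcard : A.poles.card = A.Qc.natDegree := by
    rw [Qc, A.monic_Q.natDegree_map, natDegree_Q]
  rw [eliminant, ← resultant_map_map, map_line, map_point] at h
  -- The line equation is written with `n z` in place of `-x t`. Its formal degree is therefore that
  -- of `Q`, and it does not drop at this line.
  have hl : (C ((A.n : ℂ) * poleLine 1 + A.n * poleLine 2 - A.c * poleLine 0) * A.Qc +
      C (poleLine 0) * A.Ec) = C (A.n : ℂ) * A.Qc := by
    simp [poleLine]
  rw [hl, resultant_C_mul_left, mul_eq_zero, hcard,
    resultant_eq_prod_eval _ _ _ (by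
      rw [← A.map_point q poleLine]
      exact natDegree_map_le.trans (Nat.le_succ _)) A.splits_Qc] at h
  have h1 := h.resolve_left (pow_ne_zero _ A.n_ne_zero)
  have hmonic : A.Qc.Monic := A.monic_Q.map _
  rw [hmonic.leadingCoeff, one_pow, one_mul, Multiset.prod_eq_zero_iff, Multiset.mem_map] at h1
  obtain ⟨z, hz, hz0⟩ := h1
  have hQz : A.Qc.eval z = 0 := (mem_roots'.1 hz).2
  obtain ⟨p, hp, rfl⟩ := A.exists_pole hQz
  refine ⟨p, hp, ?_⟩
  have hN : A.Nc.eval (p : ℂ) ≠ 0 := by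
    rw [Nc, eval_map_ofReal, Complex.ofReal_ne_zero]; exact A.eval_N_ne_zero hp
  simp only [eval_sub, eval_mul, eval_C, eval_X, hQz] at hz0
  refine mul_right_cancel₀ hN ?_
  linear_combination hz0

/-- Elimination restricts the ratio of the first and third coordinates to the poles, and incidence
with the line makes the second coordinate zero. Conversely the parameter `z` itself realizes the
pair. -/
lemma isTangentAt_poleLine {p : PPlane} :
    IsTangentAt (paramClosure A.envelope) (Projectivization.mk ℂ poleLine poleLine_ne_zero) p ↔
      ∃ z ∈ A.poles, p = Projectivization.mk ℂ (A.polePoint z) (A.polePoint_ne_zero z) := by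
  rw [isTangentAt_envelope]
  constructor
  · intro h
    obtain ⟨k, l, hkl⟩ := A.isBihomogeneous_eliminant
    obtain ⟨z, hz, hpz⟩ := A.exists_pole_of_eval_eliminant (h k l _ hkl A.eval_eliminant_curve)
    have hinc : IsBihomogeneous (∑ j : Fin 3, MvPolynomial.X (Sum.inl j) *
        MvPolynomial.X (Sum.inr j)) 1 1 :=
      ⟨MvPolynomial.IsWeightedHomogeneous.sum _ _ _ fun j _ =>
        ((isBihomogeneous_X_inl j).mul (isBihomogeneous_X_inr j)).1,
      MvPolynomial.IsWeightedHomogeneous.sum _ _ _ fun j _ =>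
        ((isBihomogeneous_X_inl j).mul (isBihomogeneous_X_inr j)).2⟩
    have h1 := h 1 1 _ hinc fun t => by
      simp [Fin.sum_univ_three]
      ring
    simp only [map_add, map_mul, MvPolynomial.eval_X, Sum.elim_inl, Sum.elim_inr, poleLine,
      Fin.sum_univ_three, Matrix.cons_val_zero, Matrix.cons_val_one, Matrix.cons_val, mul_zero,
      mul_one, zero_add, add_zero] at h1
    refine ⟨z, hz, eq_mk_of_isParallel _ fun i j => ?_⟩
    fin_cases i <;> fin_cases j <;> simp [polePoint, h1] <;>
      first | linear_combination hpz | linear_combination -hpz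
  · rintro ⟨z, hz, rfl⟩ k l H hH h0
    have hQ : A.Qc.eval (z : ℂ) = 0 := by rw [Qc, eval_map_ofReal, A.eval_Q hz]; simp
    have hN : A.Nc.eval (z : ℂ) ≠ 0 := by
      rw [Nc, eval_map_ofReal, Complex.ofReal_ne_zero]; exact A.eval_N_ne_zero hz
    have hP : A.Pc.eval (z : ℂ) ≠ 0 := by
      rw [Pc, eval_map_ofReal, Complex.ofReal_ne_zero, A.eval_P hz, neg_ne_zero]
      exact A.eval_E_ne_zero hz
    have h1 : curvePoint A.envelope z = A.Nc.eval (z : ℂ) • A.polePoint z := by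
      rw [envelope_apply, hQ]
      funext i; fin_cases i <;> simp [polePoint] <;> ring
    have h2 : curvePoint A.graphCurve z = A.Pc.eval (z : ℂ) • poleLine := by
      rw [graphCurve_apply, hQ]
      funext i; fin_cases i <;> simp [poleLine]
    have h3 := h0 z
    rw [h1, h2, hH.eval_smul] at h3
    have h4 := (mul_eq_zero.1 h3).resolve_left
      (mul_ne_zero (pow_ne_zero _ hN) (pow_ne_zero _ hP))
    obtain ⟨b, hb, e⟩ := rep_mk_eq_smul (A.polePoint_ne_zero z)
    have := hH.eval_smul b 1 (A.polePoint z) poleLine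
    rw [one_smul, h4, mul_zero] at this
    rw [e, this]

lemma isTangentAt_kappaLine_one {p : PPlane} :
    IsTangentAt (paramClosure A.envelope) (kappaLine 1) p ↔ p = affinePoint (-A.c / A.n) 1 := by
  have hL : kappaLine 1 = Projectivization.mk ℂ graphInfinity graphInfinity_ne_zero := by
    rw [kappaLine, Projectivization.mk_eq_mk_iff']
    exact ⟨1, by simp [graphInfinity]⟩
  have hP : affinePoint (-A.c / A.n) 1 =
      Projectivization.mk ℂ A.envelopeInfinity A.envelopeInfinity_ne_zero := by
    rw [affinePoint, Projectivization.mk_eq_mk_iff']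
    refine ⟨(A.n : ℂ)⁻¹, ?_⟩
    have := A.n_ne_zero
    funext i
    fin_cases i <;> simp [envelopeInfinity] <;> field_simp
  rw [hL, hP, isTangentAt_infinity]

lemma isTangentAt_kappaLine_zero {p : PPlane} :
    IsTangentAt (paramClosure A.envelope) (kappaLine 0) p ↔
      ∃ χ ∈ A.poles.image (fun z => z / A.n), p = affinePoint χ 0 := by
  have hL : kappaLine 0 = Projectivization.mk ℂ poleLine poleLine_ne_zero := by
    rw [kappaLine, Projectivization.mk_eq_mk_iff']
    exact ⟨1, by simp [poleLine]⟩
  have hP : ∀ z, affinePoint (z / A.n) 0 =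
      Projectivization.mk ℂ (A.polePoint z) (A.polePoint_ne_zero z) := by
    intro z
    rw [affinePoint, Projectivization.mk_eq_mk_iff']
    refine ⟨(A.n : ℂ)⁻¹, ?_⟩
    have := A.n_ne_zero
    funext i
    fin_cases i <;> simp [polePoint] <;> field_simp
  rw [hL, isTangentAt_poleLine]
  constructor
  · rintro ⟨z, hz, rfl⟩
    exact ⟨_, Finset.mem_image_of_mem _ hz, (hP z).symm⟩
  · rintro ⟨χ, hχ, rfl⟩
    obtain ⟨z, hz, rfl⟩ := Finset.mem_image.1 hχ
    exact ⟨z, hz, hP z⟩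

lemma card_image_poles : (A.poles.image (fun z => z / A.n)).card = A.poles.card :=
  Finset.card_image_of_injective _ fun _ _ h => (div_left_inj' A.n_pos.ne').1 h

end PickData

end

/-! ### Partial fractions of positive rational functions. -/

noncomputable section

open Polynomial

/-- The monic polynomial with simple roots in `Z`. -/
def nodalPoly (Z : Finset ℝ) : ℝ[X] := ∏ q ∈ Z, (X - C q)

/-- The derivative of the nodal polynomial at its root `z`. -/
def nodalDeriv (Z : Finset ℝ) (z : ℝ) : ℝ := ∏ q ∈ Z.erase z, (z - q)

lemma nodalDeriv_ne_zero (Z : Finset ℝ) (z : ℝ) : nodalDeriv Z z ≠ 0 :=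
  Finset.prod_ne_zero_iff.2 fun _ hq => sub_ne_zero.2 (Finset.ne_of_mem_erase hq).symm

lemma eval_nodalPoly (Z : Finset ℝ) (t : ℝ) : (nodalPoly Z).eval t = ∏ q ∈ Z, (t - q) := by
  simp [nodalPoly, eval_prod]

lemma eval_nodalPoly_eq_zero {Z : Finset ℝ} {t : ℝ} : (nodalPoly Z).eval t = 0 ↔ t ∈ Z := by
  rw [eval_nodalPoly, Finset.prod_eq_zero_iff]
  simp [sub_eq_zero]

lemma eval_nodalPoly_eq_mul_erase {Z : Finset ℝ} {z : ℝ} (hz : z ∈ Z) (t : ℝ) :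
    (nodalPoly Z).eval t = (t - z) * (nodalPoly (Z.erase z)).eval t := by
  rw [eval_nodalPoly, eval_nodalPoly, Finset.mul_prod_erase Z (fun q => t - q) hz]

lemma nodalPoly_eq_mul_erase {Z : Finset ℝ} {z : ℝ} (hz : z ∈ Z) :
    nodalPoly Z = (X - C z) * nodalPoly (Z.erase z) :=
  (Finset.mul_prod_erase Z (fun q => X - C q) hz).symm

lemma eval_derivative_nodalPoly {Z : Finset ℝ} {z : ℝ} (hz : z ∈ Z) :
    (derivative (nodalPoly Z)).eval z = nodalDeriv Z z := by
  rw [nodalPoly_eq_mul_erase hz, derivative_mul, eval_add, eval_mul, eval_mul, nodalDeriv,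
    ← eval_nodalPoly]
  simp

lemma monic_nodalPoly (Z : Finset ℝ) : (nodalPoly Z).Monic := monic_prod_X_sub_C _ _

lemma natDegree_nodalPoly (Z : Finset ℝ) : (nodalPoly Z).natDegree = Z.card :=
  natDegree_finsetProd_X_sub_C_eq_card _ _

/-- Lagrange interpolation at the points of `Z`. -/
lemma eq_sum_nodalPoly {Z : Finset ℝ} {H : ℝ[X]} (hH : H.degree < Z.card) :
    H = ∑ z ∈ Z, C (H.eval z / nodalDeriv Z z) * nodalPoly (Z.erase z) := by
  refine Polynomial.eq_of_degrees_lt_of_eval_finset_eq Z hH ?_ fun x hx => ?_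
  · refine (degree_sum_le _ _).trans_lt ((Finset.sup_lt_iff (WithBot.bot_lt_coe _)).2 fun z hz => ?_)
    refine (degree_le_natDegree).trans_lt (Nat.cast_lt.2 ?_)
    refine (natDegree_C_mul_le _ _).trans_lt ?_
    rw [natDegree_nodalPoly]
    exact Finset.card_erase_lt_of_mem hz
  · rw [eval_finsetSum, Finset.sum_eq_single_of_mem x hx]
    · rw [eval_mul, eval_C, eval_nodalPoly, ← nodalDeriv,
        div_mul_cancel₀ _ (nodalDeriv_ne_zero Z x)]
    · intro b _ hb
      rw [eval_mul, eval_nodalPoly_eq_zero.2 (Finset.mem_erase.2 ⟨hb.symm, hx⟩), mul_zero]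

lemma div_eq_sum_of_degree_lt {Z : Finset ℝ} {H : ℝ[X]} (hH : H.degree < Z.card) {t : ℝ}
    (ht : t ∉ Z) : H.eval t / (nodalPoly Z).eval t =
      ∑ z ∈ Z, -(H.eval z / nodalDeriv Z z) / (z - t) := by
  have hne : (nodalPoly Z).eval t ≠ 0 := fun h => ht (eval_nodalPoly_eq_zero.1 h)
  rw [div_eq_iff hne]
  conv_lhs => rw [eq_sum_nodalPoly hH]
  rw [eval_finsetSum, Finset.sum_mul]
  refine Finset.sum_congr rfl fun z hz => ?_
  have h1 : z - t ≠ 0 := sub_ne_zero.2 fun e => ht (e ▸ hz)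
  rw [eval_mul, eval_C, eval_nodalPoly_eq_mul_erase hz]
  have := nodalDeriv_ne_zero Z z
  field_simp
  ring

/-- A rational function `num / nodalPoly den` with the value `1` at infinity, with positive residues
of sum `1`. -/
structure PositiveFraction where
  den : Finset ℝ
  num : ℝ[X]
  num_monic : num.Monic
  natDegree_num : num.natDegree = den.card
  diff_monic : (num - nodalPoly den).Monic
  natDegree_diff : (num - nodalPoly den).natDegree + 1 = den.card
  residue_pos : ∀ x ∈ den, 0 < num.eval x * nodalDeriv den x
  -- A point left of all poles with a positive value; it yields one further solution of `psi = -g`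
  -- for `g > 0`.
  exists_lower : ∃ M, (∀ x ∈ den, M < x) ∧ 0 < num.eval M * (nodalPoly den).eval M

namespace PositiveFraction

variable (S : PositiveFraction)

/-- The value of the fraction. -/
def psi (t : ℝ) : ℝ := S.num.eval t / (nodalPoly S.den).eval t

/-- The numerator of the derivative of the fraction. -/
def wronskian (t : ℝ) : ℝ := (derivative S.num).eval t * (nodalPoly S.den).eval t -
  S.num.eval t * (derivative (nodalPoly S.den)).eval t

lemma degree_diff_lt : (S.num - nodalPoly S.den).degree < S.den.card := by
  refine degree_le_natDegree.trans_lt (Nat.cast_lt.2 ?_)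
  have := S.natDegree_diff
  omega

/-- Writing the fraction as `1 + ∑ r_x / (t - x)` with `r_x > 0`, the Wronskian is minus the sum of
`r_x` times the square of the nodal polynomial without `x`. At `t ∈ den` only the term `x = t`
survives. -/
lemma wronskian_neg (t : ℝ) : S.wronskian t < 0 := by
  set r : ℝ → ℝ := fun x => S.num.eval x / nodalDeriv S.den x with hr
  have hrpos : ∀ x ∈ S.den, 0 < r x := by
    intro x hx
    have h1 := S.residue_pos x hx
    have h2 := nodalDeriv_ne_zero S.den x
    have : r x = S.num.eval x * nodalDeriv S.den x / nodalDeriv S.den x ^ 2 := by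
      rw [hr]; field_simp
    rw [this]
    positivity
  have hnum : S.num = nodalPoly S.den + ∑ x ∈ S.den, C (r x) * nodalPoly (S.den.erase x) := by
    have h := eq_sum_nodalPoly S.degree_diff_lt
    rw [sub_eq_iff_eq_add'] at h
    rw [h]
    congr 1
    refine Finset.sum_congr rfl fun x hx => ?_
    rw [eval_sub, eval_nodalPoly_eq_zero.2 hx, sub_zero]
  have hW : S.wronskian t = -∑ x ∈ S.den, r x * (nodalPoly (S.den.erase x)).eval t ^ 2 := by
    rw [wronskian, hnum]
    simp only [derivative_add, derivative_sum, eval_add, eval_finsetSum, eval_mul, eval_C,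
      derivative_C_mul]
    rw [add_mul, add_mul, Finset.sum_mul, Finset.sum_mul, mul_comm (eval t (derivative _)),
      add_sub_add_left_eq_sub, ← Finset.sum_sub_distrib, ← Finset.sum_neg_distrib]
    refine Finset.sum_congr rfl fun x hx => ?_
    have hd : (derivative (nodalPoly S.den)).eval t = (nodalPoly (S.den.erase x)).eval t +
        (t - x) * (derivative (nodalPoly (S.den.erase x))).eval t := by
      conv_lhs => rw [nodalPoly_eq_mul_erase hx]
      simp [derivative_mul]
    rw [hd, eval_nodalPoly_eq_mul_erase hx]
    ring
  rw [hW, neg_lt_zero]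
  have hnn : ∀ x ∈ S.den, 0 ≤ r x * (nodalPoly (S.den.erase x)).eval t ^ 2 := fun x hx =>
    mul_nonneg (hrpos x hx).le (sq_nonneg _)
  have hpos : ∀ x ∈ S.den, (t ∈ S.den → x = t) →
      0 < r x * (nodalPoly (S.den.erase x)).eval t ^ 2 := by
    intro x hx hxt
    refine mul_pos (hrpos x hx) (sq_pos_of_ne_zero fun h0 => ?_)
    rw [eval_nodalPoly_eq_zero, Finset.mem_erase] at h0
    exact h0.1 (hxt h0.2).symm
  by_cases ht : t ∈ S.den
  · exact Finset.sum_pos' hnn ⟨t, ht, hpos t ht fun _ => rfl⟩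
  · have : S.den.Nonempty := Finset.card_pos.1 (by have := S.natDegree_diff; omega)
    obtain ⟨x, hx⟩ := this
    exact Finset.sum_pos' hnn ⟨x, hx, hpos x hx fun h => absurd h ht⟩

/-- The numerator of `psi + g`. -/
def shift (g : ℝ) : ℝ[X] := S.num + C g * nodalPoly S.den

/-- The points with `psi = -g`. -/
def level (g : ℝ) : Finset ℝ := (S.shift g).roots.toFinset

lemma card_den_le (g : ℝ) : S.den.card ≤ (S.level g).card + 1 := by
  refine card_le_card_roots_add_one _ _ fun x hx => ?_
  have := S.residue_pos x hx
  rw [shift, eval_add, eval_mul, eval_nodalPoly_eq_zero.2 hx, mul_zero, add_zero]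
  exact this

/-- Adding `M` to the poles extends the alternation of signs by one point, since `psi + g` is
positive at `M`. -/
lemma card_den_le_of_pos {g : ℝ} (hg : 0 < g) : S.den.card ≤ (S.level g).card := by
  obtain ⟨M, hM, hpos⟩ := S.exists_lower
  have hMnot : M ∉ S.den := fun h => lt_irrefl _ (hM M h)
  have := card_le_card_roots_add_one (insert M S.den) (S.shift g) fun x hx => ?_
  · rw [Finset.card_insert_of_notMem hMnot] at this
    exact Nat.le_of_succ_le_succ this
  · rcases Finset.mem_insert.1 hx with rfl | hx
    · rw [Finset.erase_insert hMnot, ← eval_nodalPoly, shift, eval_add, eval_mul, eval_C, add_mul]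
      have : 0 ≤ g * (nodalPoly S.den).eval x ^ 2 := by positivity
      nlinarith
    · have hne : x ≠ M := fun e => hMnot (e ▸ hx)
      rw [Finset.erase_insert_of_ne hne.symm, Finset.prod_insert
        (fun h => hMnot (Finset.mem_of_mem_erase h)), shift, eval_add, eval_mul,
        eval_nodalPoly_eq_zero.2 hx, mul_zero, add_zero]
      have h1 := S.residue_pos x hx
      rw [nodalDeriv] at h1
      have h2 : 0 < x - M := sub_pos.2 (hM x hx)
      calc 0 < (x - M) * (S.num.eval x * ∏ q ∈ S.den.erase x, (x - q)) := mul_pos h2 h1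
        _ = _ := by ring

lemma shift_neg_one : S.shift (-1) = S.num - nodalPoly S.den := by
  rw [shift, C_neg, C_1]; ring

lemma coeff_shift (g : ℝ) : (S.shift g).coeff S.den.card = 1 + g := by
  have h1 : S.num.coeff S.den.card = 1 := by
    rw [← S.natDegree_num]; exact S.num_monic.coeff_natDegree
  have h2 : (nodalPoly S.den).coeff S.den.card = 1 := by
    rw [← natDegree_nodalPoly]; exact (monic_nodalPoly _).coeff_natDegree
  rw [shift, coeff_add, coeff_C_mul, h1, h2, mul_one]

lemma natDegree_shift_le (g : ℝ) : (S.shift g).natDegree ≤ S.den.card := by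
  refine (natDegree_add_le _ _).trans (max_le S.natDegree_num.le ?_)
  exact (natDegree_C_mul_le _ _).trans (natDegree_nodalPoly _).le

lemma natDegree_shift {g : ℝ} (hg : 0 < g) : (S.shift g).natDegree = S.den.card :=
  le_antisymm (S.natDegree_shift_le g)
    (le_natDegree_of_ne_zero (by rw [coeff_shift]; positivity))

lemma shift_ne_zero {g : ℝ} (hg : g = -1 ∨ 0 < g) : S.shift g ≠ 0 := by
  rcases hg with rfl | hg
  · rw [shift_neg_one]; exact S.diff_monic.ne_zero
  · intro h
    have := S.coeff_shift g
    rw [h, coeff_zero] at this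
    linarith

/-- The real roots found by sign changes already exhaust the degree, which is one lower for `g =
-1`; so all roots are real and simple. -/
lemma card_level {g : ℝ} (hg : g = -1 ∨ 0 < g) : (S.level g).card = (S.shift g).natDegree := by
  refine le_antisymm ((Multiset.toFinset_card_le _).trans (card_roots' _)) ?_
  rcases hg with rfl | hg
  · have h1 := S.card_den_le (-1)
    have h2 := S.natDegree_diff
    rw [shift_neg_one]
    omega
  · rw [S.natDegree_shift hg]
    exact S.card_den_le_of_pos hg

lemma shift_eq {g : ℝ} (hg : g = -1 ∨ 0 < g) :
    S.shift g = C (S.shift g).leadingCoeff * nodalPoly (S.level g) := by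
  have hcard : (S.shift g).roots.card = (S.shift g).natDegree :=
    le_antisymm (card_roots' _) ((S.card_level hg).symm.le.trans (Multiset.toFinset_card_le _))
  have hnodup : (S.shift g).roots.Nodup := by
    rw [← Multiset.toFinset_card_eq_card_iff_nodup, hcard]
    exact S.card_level hg
  have h := C_leadingCoeff_mul_prod_multiset_X_sub_C hcard
  conv_lhs => rw [← h]
  congr 1
  rw [nodalPoly, Finset.prod, level, Multiset.toFinset_val, hnodup.dedup]

lemma mem_level {g : ℝ} (hg : g = -1 ∨ 0 < g) {z : ℝ} :
    z ∈ S.level g ↔ S.num.eval z + g * (nodalPoly S.den).eval z = 0 := by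
  rw [level, Multiset.mem_toFinset, mem_roots (S.shift_ne_zero hg), IsRoot, shift, eval_add,
    eval_mul, eval_C]

lemma notMem_den_of_mem_level {g : ℝ} (hg : g = -1 ∨ 0 < g) {z : ℝ} (hz : z ∈ S.level g) :
    z ∉ S.den := by
  intro h
  have h1 := (S.mem_level hg).1 hz
  rw [eval_nodalPoly_eq_zero.2 h, mul_zero, add_zero] at h1
  have := S.residue_pos z h
  rw [h1, zero_mul] at this
  exact lt_irrefl _ this

lemma mem_level_iff_psi {g : ℝ} (hg : g = -1 ∨ 0 < g) {z : ℝ} (hz : z ∉ S.den) :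
    z ∈ S.level g ↔ S.psi z = -g := by
  have hne : (nodalPoly S.den).eval z ≠ 0 := fun h => hz (eval_nodalPoly_eq_zero.1 h)
  rw [S.mem_level hg, psi, div_eq_iff hne]
  constructor <;> intro h <;> linear_combination h

/-- The negative of the residue of `1 / (psi + g)` at a point with `psi = -g`. -/
def residue (z : ℝ) : ℝ := -(nodalPoly S.den).eval z ^ 2 / S.wronskian z

lemma residue_pos_of_notMem {z : ℝ} (hz : z ∉ S.den) : 0 < S.residue z := by
  have hne : (nodalPoly S.den).eval z ≠ 0 := fun h => hz (eval_nodalPoly_eq_zero.1 h)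
  have := S.wronskian_neg z
  exact div_pos_of_neg_of_neg (neg_neg_of_pos (sq_pos_of_ne_zero hne)) this

/-- `1 / (psi + g)` is the nodal polynomial over its shift. Division gives the polynomial part `L`,
and the simple roots give partial fractions whose coefficients follow from the Wronskian and do not
mention `g`. -/
lemma inv_psi_add_eq {g : ℝ} (hg : g = -1 ∨ 0 < g) {L R : ℝ[X]}
    (hLR : nodalPoly S.den = L * S.shift g + R) (hR : R.degree < (S.level g).card) {t : ℝ}
    (ht : t ∉ S.den) (ht' : t ∉ S.level g) :
    1 / (S.psi t + g) = L.eval t + ∑ z ∈ S.level g, S.residue z / (z - t) := by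
  have hne : (nodalPoly S.den).eval t ≠ 0 := fun h => ht (eval_nodalPoly_eq_zero.1 h)
  have hU : (S.shift g).eval t ≠ 0 := by
    intro h
    rw [shift, eval_add, eval_mul, eval_C] at h
    exact ht' ((S.mem_level hg).2 h)
  set u := (S.shift g).leadingCoeff with hu
  have hu0 : u ≠ 0 := leadingCoeff_ne_zero.2 (S.shift_ne_zero hg)
  have hUt : (S.shift g).eval t = u * (nodalPoly (S.level g)).eval t := by
    conv_lhs => rw [S.shift_eq hg]
    rw [eval_mul, eval_C]
  have h1 : 1 / (S.psi t + g) = (nodalPoly S.den).eval t / (S.shift g).eval t := by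
    have : S.psi t + g = (S.shift g).eval t / (nodalPoly S.den).eval t := by
      rw [psi, shift, eval_add, eval_mul, eval_C]
      field_simp
    rw [this, one_div_div]
  have h2 : (nodalPoly S.den).eval t / (S.shift g).eval t = L.eval t +
      u⁻¹ * (R.eval t / (nodalPoly (S.level g)).eval t) := by
    have hN : (nodalPoly (S.level g)).eval t ≠ 0 := fun h => ht' (eval_nodalPoly_eq_zero.1 h)
    conv_lhs => rw [hLR]
    rw [eval_add, eval_mul, hUt]
    field_simp
  rw [h1, h2, div_eq_sum_of_degree_lt hR ht', Finset.mul_sum]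
  congr 1
  refine Finset.sum_congr rfl fun z hz => ?_
  have hz0 : (S.shift g).eval z = 0 := by
    rw [shift, eval_add, eval_mul, eval_C]
    exact (S.mem_level hg).1 hz
  have hRz : R.eval z = (nodalPoly S.den).eval z := by
    conv_rhs => rw [hLR]
    rw [eval_add, eval_mul, hz0, mul_zero, zero_add]
  have hder : (derivative (S.shift g)).eval z = u * nodalDeriv (S.level g) z := by
    conv_lhs => rw [S.shift_eq hg]
    rw [derivative_C_mul, eval_mul, eval_C, eval_derivative_nodalPoly hz]
  have hw : S.wronskian z = (nodalPoly S.den).eval z * (u * nodalDeriv (S.level g) z) := by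
    rw [← hder, wronskian, shift, derivative_add, derivative_C_mul, eval_add, eval_mul, eval_C]
    have := (S.mem_level hg).1 hz
    linear_combination (-(derivative (nodalPoly S.den)).eval z) * this
  have hGz : (nodalPoly S.den).eval z ≠ 0 := fun h =>
    S.notMem_den_of_mem_level hg hz (eval_nodalPoly_eq_zero.1 h)
  rw [residue, hw, hRz]
  have := nodalDeriv_ne_zero (S.level g) z
  field_simp

lemma exists_inv_psi_add {g : ℝ} (hg : 0 < g) : ∃ c : ℝ, ∀ t, t ∉ S.den → t ∉ S.level g →
    1 / (S.psi t + g) = c + ∑ z ∈ S.level g, S.residue z / (z - t) := by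
  refine ⟨(1 + g)⁻¹, fun t ht ht' => ?_⟩
  have hcard := S.card_level (Or.inr hg)
  rw [S.natDegree_shift hg] at hcard
  have := S.inv_psi_add_eq (Or.inr hg) (L := C (1 + g)⁻¹)
    (R := nodalPoly S.den - C (1 + g)⁻¹ * S.shift g) (by ring) ?_ ht ht'
  · rwa [eval_C] at this
  · rw [hcard, degree_lt_iff_coeff_zero]
    intro m hm
    rcases eq_or_lt_of_le hm with rfl | hm
    · have h2 : (nodalPoly S.den).coeff S.den.card = 1 := by
        rw [← natDegree_nodalPoly]; exact (monic_nodalPoly _).coeff_natDegree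
      rw [coeff_sub, coeff_C_mul, coeff_shift, h2]
      have : 1 + g ≠ 0 := by positivity
      field_simp
      ring
    · rw [coeff_sub, coeff_C_mul, coeff_eq_zero_of_natDegree_lt (by rwa [natDegree_nodalPoly]),
        coeff_eq_zero_of_natDegree_lt (lt_of_le_of_lt (S.natDegree_shift_le g) hm), mul_zero,
        sub_zero]

/-- Numerator and denominator are monic and their degrees differ by one, so the quotient is `t + c`.
Here the normalization of the residue sum to `1` enters. -/
lemma exists_inv_psi_sub_one : ∃ c : ℝ, ∀ t, t ∉ S.den → t ∉ S.level (-1) →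
    1 / (S.psi t - 1) = t + c + ∑ z ∈ S.level (-1), S.residue z / (z - t) := by
  have hmon : (S.shift (-1)).Monic := by rw [shift_neg_one]; exact S.diff_monic
  have hL : (nodalPoly S.den /ₘ S.shift (-1)).Monic := by
    rw [Monic, leadingCoeff_divByMonic_of_monic hmon]
    · exact monic_nodalPoly _
    · rw [degree_eq_natDegree hmon.ne_zero, degree_eq_natDegree (monic_nodalPoly _).ne_zero,
        natDegree_nodalPoly, Nat.cast_le]
      exact S.natDegree_shift_le _
  have hdeg : (nodalPoly S.den /ₘ S.shift (-1)).natDegree = 1 := by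
    rw [natDegree_divByMonic _ hmon, natDegree_nodalPoly, shift_neg_one]
    have := S.natDegree_diff
    omega
  refine ⟨(nodalPoly S.den /ₘ S.shift (-1)).coeff 0, fun t ht ht' => ?_⟩
  have := S.inv_psi_add_eq (Or.inl rfl) (L := nodalPoly S.den /ₘ S.shift (-1))
    (R := nodalPoly S.den %ₘ S.shift (-1)) (by
      rw [mul_comm, add_comm]; exact (modByMonic_add_div _ _).symm) (by
      rw [S.card_level (Or.inl rfl), ← degree_eq_natDegree hmon.ne_zero]
      exact degree_modByMonic_lt _ hmon) ht ht'
  rw [← sub_eq_add_neg] at this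
  rw [this]
  congr 1
  conv_lhs => rw [hL.eq_X_add_C hdeg]
  simp

lemma card_level_of_pos {g : ℝ} (hg : 0 < g) : (S.level g).card = S.den.card := by
  rw [S.card_level (Or.inr hg), S.natDegree_shift hg]

lemma card_level_neg_one : (S.level (-1)).card + 1 = S.den.card := by
  rw [S.card_level (Or.inl rfl), shift_neg_one, S.natDegree_diff]

lemma disjoint_level {g g' : ℝ} (hg : g = -1 ∨ 0 < g) (hg' : g' = -1 ∨ 0 < g') (hne : g ≠ g') :
    Disjoint (S.level g) (S.level g') := by
  rw [Finset.disjoint_left]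
  intro z hz hz'
  have hd := S.notMem_den_of_mem_level hg hz
  rw [S.mem_level_iff_psi hg hd] at hz
  rw [S.mem_level_iff_psi hg' hd, hz] at hz'
  exact hne (neg_inj.1 hz')

/-- A sum of fractions `w g / (psi + g)` with positive coefficients is a Pick function. -/
lemma exists_pickData (n e : ℝ) (hn : 0 < n) (V : Finset ℝ) (w : ℝ → ℝ) (hV : ∀ g ∈ V, 0 < g)
    (hw : ∀ g ∈ V, 0 < w g) : ∃ A : PickData, A.n = n ∧
      A.poles.card + 1 = (V.card + 1) * S.den.card ∧
      ∀ t, t ∉ S.den → S.psi t ≠ 1 → (∀ g ∈ V, S.psi t ≠ -g) →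
        t ∉ A.poles ∧ A.value t = 1 / (S.psi t - 1) + e + ∑ g ∈ V, w g / (S.psi t + g) := by
  classical
  have hnot : (-1 : ℝ) ∉ V := fun h => by have := hV _ h; linarith
  have hval : ∀ g ∈ insert (-1) V, g = -1 ∨ 0 < g := by
    intro g hg
    rcases Finset.mem_insert.1 hg with h | h
    · exact Or.inl h
    · exact Or.inr (hV g h)
  -- Extends the coefficients to the level `g = -1`, where `1 / (psi - 1)` has coefficient one.
  let w' : ℝ → ℝ := fun g => if g = -1 then 1 else w g
  have hw'pos : ∀ g ∈ insert (-1) V, 0 < w' g := by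
    intro g hg
    rcases Finset.mem_insert.1 hg with rfl | h
    · simp [w']
    · have : g ≠ -1 := fun e => hnot (e ▸ h)
      simp [w', this, hw g h]
  let Z : Finset ℝ := (insert (-1) V).biUnion S.level
  have hdisj : ((insert (-1) V : Finset ℝ) : Set ℝ).PairwiseDisjoint S.level := by
    intro g hg g' hg' hne
    exact S.disjoint_level (hval g hg) (hval g' hg') hne
  choose! cc hcc using fun g (hg : 0 < g) => S.exists_inv_psi_add hg
  obtain ⟨c0, hc0⟩ := S.exists_inv_psi_sub_one
  -- Each pole `z` lies on a unique level, recovered as `g = -psi z`; this lets one weight function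
  -- serve all levels.
  refine ⟨⟨n, c0 + e + ∑ g ∈ V, w g * cc g, Z, fun z => w' (-S.psi z) * S.residue z, hn, ?_⟩,
    rfl, ?_, ?_⟩
  · intro z hz
    obtain ⟨g, hg, hzg⟩ := Finset.mem_biUnion.1 hz
    have hd := S.notMem_den_of_mem_level (hval g hg) hzg
    rw [(S.mem_level_iff_psi (hval g hg) hd).1 hzg, neg_neg]
    exact mul_pos (hw'pos g hg) (S.residue_pos_of_notMem hd)
  · change Z.card + 1 = _
    rw [Finset.card_biUnion hdisj, Finset.sum_insert hnot,
      Finset.sum_congr rfl fun g hg => S.card_level_of_pos (hV g hg), Finset.sum_const, smul_eq_mul,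
      add_right_comm, S.card_level_neg_one]
    ring
  · intro t ht h1 hg
    have hnotZ : ∀ g ∈ insert (-1) V, t ∉ S.level g := by
      intro g hgm h
      rw [S.mem_level_iff_psi (hval g hgm) ht] at h
      rcases Finset.mem_insert.1 hgm with rfl | h'
      · exact h1 (by rw [h, neg_neg])
      · exact hg g h' h
    refine ⟨fun h => ?_, ?_⟩
    · obtain ⟨g, hgm, h⟩ := Finset.mem_biUnion.1 h
      exact hnotZ g hgm h
    · change t + (c0 + e + ∑ g ∈ V, w g * cc g) +
        ∑ z ∈ Z, w' (-S.psi z) * S.residue z / (z - t) = _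
      have hlev : ∀ g ∈ insert (-1) V, ∑ z ∈ S.level g, w' (-S.psi z) * S.residue z / (z - t) =
          w' g * ∑ z ∈ S.level g, S.residue z / (z - t) := by
        intro g hgm
        rw [Finset.mul_sum]
        refine Finset.sum_congr rfl fun z hz => ?_
        have hd := S.notMem_den_of_mem_level (hval g hgm) hz
        rw [(S.mem_level_iff_psi (hval g hgm) hd).1 hz, neg_neg, mul_div_assoc]
      rw [Finset.sum_biUnion hdisj, Finset.sum_congr rfl hlev, Finset.sum_insert hnot,
        hc0 t ht (hnotZ _ (Finset.mem_insert_self _ _))]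
      have hVsum : ∑ g ∈ V, w g / (S.psi t + g) = ∑ g ∈ V, w g * cc g +
          ∑ g ∈ V, w' g * ∑ z ∈ S.level g, S.residue z / (z - t) := by
        rw [← Finset.sum_add_distrib]
        refine Finset.sum_congr rfl fun g hgV => ?_
        have hne : g ≠ -1 := fun e => hnot (e ▸ hgV)
        rw [← mul_one_div, hcc g (hV g hgV) t ht (hnotZ g (Finset.mem_insert_of_mem hgV))]
        simp only [w', if_neg hne]
        ring
      rw [hVsum]
      simp only [w', if_true]
      ring

end PositiveFraction

end

/-! ### From lattice data to Pick functions, and the theorem. -/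

noncomputable section

open Polynomial

/-- Two interlacing systems `β_k < γ_k < β_{k-1} < …` of total gap `1` define a positive fraction. -/
lemma exists_positiveFraction (N : ℕ) (β γ : ℕ → ℝ) (hβγ : ∀ k ≤ N, β k < γ k)
    (hγβ : ∀ j k, j < k → k ≤ N → γ k < β j)
    (hsum : ∑ k ∈ Finset.range (N + 1), (γ k - β k) = 1) :
    ∃ R : PositiveFraction, R.den.card = N + 1 ∧ (∀ t, t ∉ R.den ↔ ∀ k ≤ N, t ≠ γ k) ∧
      ∀ t, R.psi t = (∏ k ∈ Finset.range (N + 1), (t - β k)) /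
        ∏ k ∈ Finset.range (N + 1), (t - γ k) := by
  have hlt : ∀ j k, j < k → k ≤ N → γ k < γ j := fun j k hjk hk =>
    (hγβ j k hjk hk).trans (hβγ j (by omega))
  have hinj : Set.InjOn γ (Finset.range (N + 1) : Set ℕ) := by
    intro j hj k hk h
    simp only [Finset.coe_range, Set.mem_Iio] at hj hk
    rcases lt_trichotomy j k with hjk | hjk | hjk
    · exact absurd h (hlt j k hjk (by omega)).ne'
    · exact hjk
    · exact absurd h (hlt k j hjk (by omega)).ne
  set den := (Finset.range (N + 1)).image γ with hden
  set num : ℝ[X] := ∏ k ∈ Finset.range (N + 1), (X - C (β k)) with hnum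
  have hcard : den.card = N + 1 := by
    rw [hden, Finset.card_image_of_injOn hinj, Finset.card_range]
  have hnodal : nodalPoly den = ∏ k ∈ Finset.range (N + 1), (X - C (γ k)) := by
    rw [nodalPoly, hden, Finset.prod_image hinj]
  have hnumdeg : num.natDegree = N + 1 := by
    rw [hnum, natDegree_finsetProd_X_sub_C_eq_card, Finset.card_range]
  have hnummon : num.Monic := monic_prod_X_sub_C _ _
  have hnoddeg : (nodalPoly den).natDegree = N + 1 := by rw [natDegree_nodalPoly, hcard]
  have hle : (num - nodalPoly den).natDegree ≤ N := by
    rw [natDegree_le_iff_coeff_eq_zero]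
    intro m hm
    rcases eq_or_lt_of_le (Nat.succ_le_of_lt hm) with rfl | hm
    · have h1 := hnummon.coeff_natDegree
      have h2 := (monic_nodalPoly den).coeff_natDegree
      rw [hnumdeg] at h1
      rw [hnoddeg] at h2
      rw [coeff_sub, Nat.succ_eq_add_one, h1, h2, sub_self]
    · rw [coeff_sub, coeff_eq_zero_of_natDegree_lt (by omega),
        coeff_eq_zero_of_natDegree_lt (by omega), sub_zero]
  -- The second coefficients are minus the sums of the roots, so their difference is the total gap.
  have hcoeff : (num - nodalPoly den).coeff N = 1 := by
    have h1 := Polynomial.prod_X_sub_C_coeff_card_pred (Finset.range (N + 1)) β (by simp)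
    have h2 := Polynomial.prod_X_sub_C_coeff_card_pred (Finset.range (N + 1)) γ (by simp)
    rw [Finset.card_range, Nat.add_sub_cancel] at h1 h2
    rw [coeff_sub, hnodal, hnum, h1, h2, ← hsum, Finset.sum_sub_distrib]
    ring
  have hmon : (num - nodalPoly den).Monic := monic_of_natDegree_le_of_coeff_eq_one N hle hcoeff
  have hdeg : (num - nodalPoly den).natDegree = N :=
    le_antisymm hle (le_natDegree_of_ne_zero (by rw [hcoeff]; exact one_ne_zero))
  have heval : ∀ t, num.eval t = ∏ k ∈ Finset.range (N + 1), (t - β k) := fun t => by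
    rw [hnum, eval_prod]; simp
  have heval' : ∀ t, (nodalPoly den).eval t = ∏ k ∈ Finset.range (N + 1), (t - γ k) := fun t => by
    rw [hnodal, eval_prod]; simp
  have hbound : ∀ k ≤ N, β N ≤ β k := by
    intro k hk
    rcases eq_or_lt_of_le hk with rfl | hk
    · exact le_rfl
    · exact ((hβγ N le_rfl).trans (hγβ k N hk le_rfl)).le
  refine ⟨⟨den, num, hnummon, hnumdeg.trans hcard.symm, hmon, by rw [hdeg, hcard], ?_, ?_⟩,
    hcard, ?_, ?_⟩
  · intro x hx
    obtain ⟨k, hk, rfl⟩ := Finset.mem_image.1 hx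
    have herase : den.erase (γ k) = ((Finset.range (N + 1)).erase k).image γ := by
      ext y
      simp only [hden, Finset.mem_erase, Finset.mem_image]
      constructor
      · rintro ⟨hne, j, hj, rfl⟩
        exact ⟨j, ⟨fun e => hne (e ▸ rfl), hj⟩, rfl⟩
      · rintro ⟨j, ⟨hne, hj⟩, rfl⟩
        exact ⟨fun e => hne (hinj hj hk e), j, hj, rfl⟩
    rw [nodalDeriv, herase, Finset.prod_image (hinj.mono (by simp)), heval,
      ← Finset.mul_prod_erase _ _ hk, mul_assoc, ← Finset.prod_mul_distrib]
    have hkN : k ≤ N := by simpa [Nat.lt_succ_iff] using hk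
    -- For `j ≠ k` both `β j` and `γ j` lie on the same side of `γ k`, so these factors pair off
    -- positively.
    refine mul_pos (sub_pos.2 (hβγ k hkN)) (Finset.prod_pos fun j hj => ?_)
    rw [Finset.mem_erase, Finset.mem_range] at hj
    rcases lt_or_gt_of_ne hj.1 with h | h
    · exact mul_pos_of_neg_of_neg (sub_neg.2 (hγβ j k h hkN)) (sub_neg.2 (hlt j k h hkN))
    · have h1 := hβγ j (by omega)
      have h2 := hlt k j h (by omega)
      exact mul_pos (by linarith) (by linarith)
  -- `β N` is the least of all end points, so to its left every pair of factors is a product of two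
  -- negative numbers.
  · refine ⟨β N - 1, ?_, ?_⟩
    · intro x hx
      obtain ⟨k, hk, rfl⟩ := Finset.mem_image.1 hx
      have hkN : k ≤ N := by simpa [Nat.lt_succ_iff] using hk
      linarith [hbound k hkN, hβγ k hkN]
    · rw [heval, heval', ← Finset.prod_mul_distrib]
      refine Finset.prod_pos fun k hk => ?_
      have hkN : k ≤ N := by simpa [Nat.lt_succ_iff] using hk
      have := hbound k hkN
      have := hβγ k hkN
      exact mul_pos_of_neg_of_neg (by linarith) (by linarith)
  · intro t
    simp only [hden, Finset.mem_image, Finset.mem_range, not_exists, not_and, Nat.lt_succ_iff]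
    exact ⟨fun h k hk e => h k hk e.symm, fun h k hk e => h k hk e.symm⟩
  · intro t
    rw [PositiveFraction.psi, heval, heval']

/-- The finitely many parameters at which a denominator vanishes. -/
def PositiveFraction.exceptional (R : PositiveFraction) (V : Finset ℝ) : Finset ℝ :=
  R.den ∪ (insert (-1) V).biUnion R.level

lemma PositiveFraction.notMem_exceptional (R : PositiveFraction) {V : Finset ℝ}
    (hV : ∀ g ∈ V, 0 < g) {t : ℝ} : t ∉ R.exceptional V ↔
      t ∉ R.den ∧ R.psi t ≠ 1 ∧ ∀ g ∈ V, R.psi t ≠ -g := by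
  rw [exceptional, Finset.mem_union, not_or]
  refine and_congr_right fun ht => ?_
  simp only [Finset.mem_biUnion, Finset.mem_insert, not_exists, not_and]
  constructor
  · intro h
    refine ⟨fun e => h (-1) (Or.inl rfl) ((R.mem_level_iff_psi (Or.inl rfl) ht).2 (by rw [e, neg_neg])),
      fun g hg e => h g (Or.inr hg) ((R.mem_level_iff_psi (Or.inr (hV g hg)) ht).2 e)⟩
  · rintro ⟨h1, h2⟩ g (rfl | hg) hmem
    · exact h1 (by rw [(R.mem_level_iff_psi (Or.inl rfl) ht).1 hmem, neg_neg])
    · exact h2 g hg ((R.mem_level_iff_psi (Or.inr (hV g hg)) ht).1 hmem)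

namespace SquareHexagonData

variable (S : SquareHexagonData)

lemma d_mono {i j : ℕ} (hi : 1 ≤ i) (hij : i ≤ j) (hj : j ≤ S.n + 1) : S.d i ≤ S.d j := by
  induction j, hij using Nat.le_induction with
  | base => exact le_rfl
  | succ j hij ih => exact (ih (by omega)).trans (S.d_lt j (by omega) (by omega)).le

lemma d_bounds {i : ℕ} (hi : 1 ≤ i) (hin : i ≤ S.n) :
    1 ≤ S.d i ∧ S.d i < S.d (i + 1) ∧ S.d (i + 1) ≤ S.s + 1 := by
  have h1 := S.d_mono le_rfl hi (by omega)
  have h2 := S.d_mono (i := i + 1) (j := S.n + 1) (by omega) (by omega) le_rfl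
  rw [S.d_one] at h1
  rw [S.d_last] at h2
  exact ⟨h1, S.d_lt i hi hin, h2⟩

lemma n_cast_pos : (0 : ℝ) < S.n := Nat.cast_pos.2 S.n_pos

lemma gamma_sub_beta {i k : ℕ} (hi : 1 ≤ i) (hin : i ≤ S.n) (hk : k ≤ S.D i) :
    S.gamma i k - S.beta i k =
      S.n * (S.b (S.s + 1 - S.d i - k) - S.a (S.s + 1 - S.d i - k)) := by
  obtain ⟨h1, h2, h3⟩ := S.d_bounds hi hin
  rw [D] at hk
  have h : S.s + 2 - S.d i - k = S.s + 1 - S.d i - k + 1 := by omega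
  rw [gamma, beta, h, ← Finset.insert_Icc_add_one_left_eq_Icc
    (show S.s + 1 - S.d i - k ≤ S.s + 1 - S.d i by omega), Finset.sum_insert (by simp)]
  ring

lemma beta_lt_gamma {i k : ℕ} (hi : 1 ≤ i) (hin : i ≤ S.n) (hk : k ≤ S.D i) :
    S.beta i k < S.gamma i k := by
  obtain ⟨h1, h2, h3⟩ := S.d_bounds hi hin
  have h := S.gamma_sub_beta hi hin hk
  rw [D] at hk
  have hab := S.a_lt_b (S.s + 1 - S.d i - k) (by omega) (by omega)
  have := mul_pos S.n_cast_pos (sub_pos.2 hab)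
  linarith

/-- The difference is `n` times one gap `a (j + 2) - b (j + 1)` of the boundary row: the sums of
lengths agree and the sums of gaps differ by one term. -/
lemma gamma_succ_lt_beta {i k : ℕ} (hi : 1 ≤ i) (hin : i ≤ S.n) (hk : k + 1 ≤ S.D i) :
    S.gamma i (k + 1) < S.beta i k := by
  obtain ⟨h1, h2, h3⟩ := S.d_bounds hi hin
  rw [D] at hk
  obtain ⟨j, hj⟩ : ∃ j, S.s + 1 - S.d i - k = j + 2 := ⟨S.s + 1 - S.d i - k - 2, by omega⟩
  have e1 : S.s + 1 - S.d i - (k + 1) = j + 1 := by omega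
  have e2 : S.s + 2 - S.d i - (k + 1) = j + 2 := by omega
  have hba := S.b_lt_a (j + 1) (by omega) (by omega)
  have hsub := mul_pos S.n_cast_pos (sub_pos.2 hba)
  have h : S.beta i k - S.gamma i (k + 1) = S.n * (S.a (j + 1 + 1) - S.b (j + 1)) := by
    rw [gamma, beta, hj, e1, e2, Finset.sum_Icc_succ_top (show 2 ≤ j + 1 + 1 by omega),
      show j + 1 + 1 - 1 = j + 1 by omega]
    ring
  linarith

lemma gamma_lt_beta {i j k : ℕ} (hi : 1 ≤ i) (hin : i ≤ S.n) (hjk : j < k) (hk : k ≤ S.D i) :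
    S.gamma i k < S.beta i j := by
  induction k, Nat.succ_le_of_lt hjk using Nat.le_induction with
  | base => exact S.gamma_succ_lt_beta hi hin hk
  | succ k hjk ih =>
    have h1 := S.gamma_succ_lt_beta hi hin hk
    have h2 := S.beta_lt_gamma hi hin (k := k) (by omega)
    have h3 := ih (by omega) (by omega)
    linarith

lemma sum_gamma_sub_beta {i : ℕ} (hi : 1 ≤ i) (hin : i ≤ S.n) :
    ∑ k ∈ Finset.range (S.D i + 1), (S.gamma i k - S.beta i k) = 1 := by
  obtain ⟨h1, h2, h3⟩ := S.d_bounds hi hin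
  have hn := S.n_cast_pos
  have h := S.sum_block i hi hin
  have hreindex : ∑ k ∈ Finset.range (S.D i + 1),
      (S.b (S.s + 1 - S.d i - k) - S.a (S.s + 1 - S.d i - k)) =
      ∑ l ∈ Finset.Icc (S.s + 2 - S.d (i + 1)) (S.s + 1 - S.d i), (S.b l - S.a l) := by
    refine Finset.sum_nbij' (fun k => S.s + 1 - S.d i - k) (fun l => S.s + 1 - S.d i - l) ?_ ?_ ?_ ?_
      fun _ _ => rfl
    all_goals
      intro x hx
      simp only [Finset.mem_range, Finset.mem_Icc, D] at hx ⊢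
      omega
  rw [Finset.sum_congr rfl fun k hk => S.gamma_sub_beta hi hin
    (Nat.lt_succ_iff.1 (Finset.mem_range.1 hk)), ← Finset.mul_sum, hreindex, h]
  field_simp

lemma exists_fraction {i : ℕ} (hi : 1 ≤ i) (hin : i ≤ S.n) :
    ∃ R : PositiveFraction, R.den.card = S.D i + 1 ∧
      (∀ t, t ∉ R.den ↔ ∀ k ≤ S.D i, t ≠ S.gamma i k) ∧ ∀ t, R.psi t = S.Psi i t :=
  exists_positiveFraction (S.D i) (S.beta i) (S.gamma i) (fun _ hk => S.beta_lt_gamma hi hin hk)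
    (fun _ _ hjk hk => S.gamma_lt_beta hi hin hjk hk) (S.sum_gamma_sub_beta hi hin)

lemma c_pos {g : ℝ} (hg : g ∈ S.cValues) : 0 < g := by
  obtain ⟨r, hr, rfl⟩ := Finset.mem_image.1 hg
  exact one_div_pos.2 (mul_pos (S.y_pos r hr) S.x₁_pos)

lemma mult_pos {g : ℝ} (hg : g ∈ S.cValues) : 0 < S.mult g := by
  obtain ⟨r, hr, rfl⟩ := Finset.mem_image.1 hg
  exact Finset.card_pos.2 ⟨r, Finset.mem_filter.2 ⟨hr, rfl⟩⟩

/-- A partial fraction expansion of `J_i` outside a finite set identifies the curve `C_i`. -/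
lemma curve_eq_paramClosure {i : ℕ} (A : PickData) (hn : A.n = S.n) (Z : Finset ℝ)
    (hZ : ∀ t, t ∉ Z ↔ (∀ k ≤ S.D i, t ≠ S.gamma i k) ∧ S.Psi i t ≠ 1 ∧
      (i = 1 → ∀ g ∈ S.cValues, S.Psi i t ≠ -g))
    (hA : ∀ t, t ∉ Z → t ∉ A.poles ∧ S.J i t = A.value t) :
    S.curve i = paramClosure A.envelope := by
  have hderiv : ∀ t, t ∉ Z → deriv (S.J i) t = A.slope t := by
    intro t ht
    have hev : S.J i =ᶠ[nhds t] A.value := by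
      filter_upwards [Z.finite_toSet.isClosed.isOpen_compl.mem_nhds (show t ∈ (Z : Set ℝ)ᶜ from ht)]
        with u hu
      exact (hA u hu).2
    rw [hev.deriv_eq]
    exact (A.hasDerivAt_value (hA t ht).1).deriv
  have hreg : ∀ t, S.IsRegularParameter i t ↔ t ∉ Z := by
    intro t
    rw [IsRegularParameter]
    constructor
    · rintro ⟨h1, h2, h3, _⟩
      exact (hZ t).2 ⟨h1, h2, h3⟩
    · intro ht
      obtain ⟨h1, h2, h3⟩ := (hZ t).1 ht
      refine ⟨h1, h2, h3, ?_⟩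
      rw [hderiv t ht]
      -- The condition `J' ≠ 0` excludes nothing, as the slope is at least one.
      exact (zero_lt_one.trans_le (A.one_le_slope t)).ne'
  have hpoint : ∀ t : ℝ, t ∉ Z → affinePoint (S.chi i t) (S.kappa i t) =
      Projectivization.mk ℂ (curvePoint A.envelope t) (A.envelope_ne_zero t) := by
    intro t ht
    obtain ⟨htp, hJ⟩ := hA t ht
    have hQ : ((A.Q.eval t ^ 2 : ℝ) : ℂ) ≠ 0 :=
      Complex.ofReal_ne_zero.2 (pow_ne_zero 2 (A.eval_Q_ne_zero htp))
    have hs : A.slope t ≠ 0 := (zero_lt_one.trans_le (A.one_le_slope t)).ne'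
    have hs' : (A.slope t : ℂ) ≠ 0 := Complex.ofReal_ne_zero.2 hs
    have hn' : (S.n : ℂ) ≠ 0 := by exact_mod_cast S.n_cast_pos.ne'
    refine (Projectivization.mk_eq_mk_iff' ℂ _ _ _ _).2
      ⟨((A.Q.eval t ^ 2 : ℝ) : ℂ)⁻¹ * ((S.n : ℂ) * A.slope t)⁻¹, ?_⟩
    rw [A.curvePoint_envelope_eq htp, smul_smul, chi, kappa, hderiv t ht, hJ, hn,
      mul_right_comm, inv_mul_cancel₀ hQ, one_mul]
    ext j
    fin_cases j
    · simp
      field_simp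
    · simp
      field_simp
    · simp
      field_simp
  ext p
  constructor
  · intro hp k G hG h0
    refine hp k G hG ?_
    rintro q ⟨t, ht, rfl⟩
    rw [hpoint t ((hreg t).1 ht), eval_rep_mk hG]
    exact aeval_curve_eq_zero_iff.1 h0 t
  · intro hp k G hG hvan
    refine hp k G hG ?_
    -- Real parameters outside a finite set are still infinitely many, so a polynomial vanishing at
    -- them is zero.
    have hinf : (Complex.ofReal '' ((Z : Set ℝ)ᶜ)).Infinite :=
      (Z.finite_toSet.infinite_compl).image Complex.ofReal_injective.injOn
    refine Polynomial.eq_zero_of_infinite_isRoot _ (hinf.mono ?_)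
    rintro _ ⟨t, ht, rfl⟩
    have h := hvan _ ⟨t, (hreg t).2 ht, rfl⟩
    rw [hpoint t ht, eval_rep_mk hG] at h
    exact (eval_aeval_curve _ _ _).trans h

lemma exists_pickData_one : ∃ A : PickData, S.curve 1 = paramClosure A.envelope ∧
    A.poles.card + 1 = (S.m + 1) * (S.D 1 + 1) := by
  obtain ⟨R, hcard, hden, hpsi⟩ := S.exists_fraction le_rfl S.n_pos
  have hV : ∀ g ∈ S.cValues, 0 < g := fun g hg => S.c_pos hg
  obtain ⟨A, hn, hpoles, hA⟩ := R.exists_pickData S.n (S.n - S.I₂.card) S.n_cast_pos S.cValues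
    (fun g => S.mult g * g) hV fun g hg => mul_pos (Nat.cast_pos.2 (S.mult_pos hg)) (hV g hg)
  refine ⟨A, S.curve_eq_paramClosure A hn (R.exceptional S.cValues) ?_ ?_, ?_⟩
  · intro t
    rw [R.notMem_exceptional hV, hden, hpsi]
    simp
  · intro t ht
    obtain ⟨h1, h2, h3⟩ := (R.notMem_exceptional hV).1 ht
    obtain ⟨h4, h5⟩ := hA t h1 h2 h3
    refine ⟨h4, ?_⟩
    rw [h5, J, if_pos rfl, hpsi]
  · rw [hpoles, hcard, m]

lemma exists_pickData_of_two_le {i : ℕ} (hi : 2 ≤ i) (hin : i ≤ S.n) :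
    ∃ A : PickData, S.curve i = paramClosure A.envelope ∧ A.poles.card = S.D i := by
  obtain ⟨R, hcard, hden, hpsi⟩ := S.exists_fraction (by omega) hin
  obtain ⟨A, hn, hpoles, hA⟩ := R.exists_pickData S.n (S.n - i + 1) S.n_cast_pos ∅
    (fun _ => 1) (by simp) (by simp)
  refine ⟨A, S.curve_eq_paramClosure A hn (R.exceptional ∅) ?_ ?_, ?_⟩
  · intro t
    rw [R.notMem_exceptional (by simp), hden, hpsi]
    simp [show i ≠ 1 by omega]
  · intro t ht
    obtain ⟨h1, h2, h3⟩ := (R.notMem_exceptional (by simp)).1 ht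
    obtain ⟨h4, h5⟩ := hA t h1 h2 h3
    refine ⟨h4, ?_⟩
    rw [h5, J, if_neg (by omega), hpsi, Finset.sum_empty]
    ring
  · rw [hcard, Finset.card_empty] at hpoles
    omega

end SquareHexagonData

end

theorem proposition6p7 (S : SquareHexagonData) :
    (IsCloudCurve (S.curve 1) ∧ HasClass (S.curve 1) ((S.m + 1) * (S.D 1 + 1))) ∧
    (∀ i, 2 ≤ i → i ≤ S.n →
      IsCloudCurve (S.curve i) ∧ HasClass (S.curve i) (S.D i + 1)) ∧
    (∀ i, 1 ≤ i → i ≤ S.n →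
      ∃ χ₀ : ℝ, ∀ p : PPlane,
        IsTangentAt (S.curve i) (kappaLine 1) p ↔ p = affinePoint χ₀ 1) ∧
    (∃ T : Finset ℝ, T.card = (S.m + 1) * (S.D 1 + 1) - 1 ∧
      ∀ p : PPlane, IsTangentAt (S.curve 1) (kappaLine 0) p ↔ ∃ χ ∈ T, p = affinePoint χ 0) ∧
    (∀ i, 2 ≤ i → i ≤ S.n →
      ∃ T : Finset ℝ, T.card = S.D i ∧
        ∀ p : PPlane, IsTangentAt (S.curve i) (kappaLine 0) p ↔ ∃ χ ∈ T, p = affinePoint χ 0) := by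
  obtain ⟨A, hA, hcard⟩ := S.exists_pickData_one
  refine ⟨?_, fun i hi hin => ?_, fun i hi hin => ?_, ?_, fun i hi hin => ?_⟩
  · rw [hA, ← hcard]
    exact ⟨A.isCloudCurve_envelope, A.hasClass_envelope⟩
  · obtain ⟨B, hB, hBcard⟩ := S.exists_pickData_of_two_le hi hin
    rw [hB, ← hBcard]
    exact ⟨B.isCloudCurve_envelope, B.hasClass_envelope⟩
  · obtain ⟨B, hB⟩ : ∃ B : PickData, S.curve i = paramClosure B.envelope := by
      rcases eq_or_lt_of_le hi with rfl | hi
      · exact ⟨A, hA⟩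
      · obtain ⟨B, hB, -⟩ := S.exists_pickData_of_two_le hi hin
        exact ⟨B, hB⟩
    rw [hB]
    exact ⟨-B.c / B.n, fun p => B.isTangentAt_kappaLine_one⟩
  · rw [hA, ← hcard, Nat.add_sub_cancel]
    exact ⟨_, A.card_image_poles, fun p => A.isTangentAt_kappaLine_zero⟩
  · obtain ⟨B, hB, hBcard⟩ := S.exists_pickData_of_two_le hi hin
    rw [hB, ← hBcard]
    exact ⟨_, B.card_image_poles, fun p => B.isTangentAt_kappaLine_zero⟩
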